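/- A branched surface $B$ is presented by a finite triangulation (a finite set of triangles glued along their sides) whose edges contain the branch locus, together with the data describing its interval-fibred neighbourhood $\pi\colon N(B)\to B$: at each edge, either two triangles meet smoothly, or two stacked triangles with a cusp between them merge into a third one; the vertices are smooth points, points of a single branch curve, or double points, where two branch curves cross transversely. A lamination carried by $B$ is a nonempty closed subset $\lambda\subset N(B)$, foliated by surfaces without boundary (locally $\lambda$ is a product of a disc and a closed subset of $\mathbb{R}$, with transition maps preserving the product structure) which are transverse to the interval fibres of $N(B)$; it is fully carried by $B$ if it meets every fibre. \textbf{Theorem.} There is an algorithm (a partial recursive procedure) which, given such a finite presentation of a branched surface $B$, terminates if and only if $B$ does not fully carry a lamination. Likewise there is an algorithm which, given such a presentation of $B$, terminates if and only if $B$ does not carry a lamination. -/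

import Mathlib

open Set Topology

/-!
Triangulated branched surfaces, their `I`-fibred neighbourhoods, and laminations carried by them.

A branched surface `B` is given by a finite triangulation (sides of triangles are glued in pairs or
triples, also sides of the same triangle) in which the branch locus is a union of
edges and every double point is a vertex.  The fibre of the fibred neighbourhood `N(B)` over a
vertex is cut by the cusps ending there into closed *layers*, numbered from the bottom to the top:
one layer at a smooth point, two at a point of a single branch curve, three at a double point.
In height coordinates layer `a` is `[2a, 2a+1]`, and the cusp between the layers `a` and `a+1` is
the gap `(2a+1, 2a+2)`.
-/

namespace BranchedSurface

/-- A corner of a triangle: the vertex at which it lies, the lowest and the highest layer of the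
fibre over that vertex which belong to the corner, and whether the upward direction of the fibres
over the triangle is the downward direction of the fibre over the vertex. -/
structure Corner where
  vertex : ℕ
  bot : ℕ
  top : ℕ
  flip : Bool

/-- An oriented side of a triangle: the number of the triangle, the corner opposite to the side,
and the direction in which the side is run through. -/
structure Side where
  face : ℕ
  opp : Fin 3
  rev : Bool

/-- An edge of the triangulation.  On one side of it there is a single triangle `whole`, whose
fibres are the full fibres of `N(B)` over the edge.  On the other side there is either a single
triangle `lower` (the edge is not in the branch locus), or there are two triangles, `lower` and
`upper`, with a cusp between them (a branch edge); lower and upper are understood with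
respect to the upward direction over `whole`. -/
structure Edge where
  whole : Side
  lower : Side
  upper : Option Side

/-- A finite combinatorial description: the numbers of layers over the vertices, the triangles with
their three corners, and the edges. -/
structure Code where
  layers : List ℕ
  faces : List (Fin 3 → Corner)
  edges : List Edge

/-! The data above are coded by tuples of numbers in the evident way. -/

def Corner.equivProd : Corner ≃ ℕ × ℕ × ℕ × Bool where
  toFun k := (k.vertex, k.bot, k.top, k.flip)
  invFun z := ⟨z.1, z.2.1, z.2.2.1, z.2.2.2⟩
  left_inv _ := rfl
  right_inv _ := rfl

instance : Primcodable Corner := Primcodable.ofEquiv _ Corner.equivProd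

def Side.equivProd : Side ≃ ℕ × Fin 3 × Bool where
  toFun s := (s.face, s.opp, s.rev)
  invFun z := ⟨z.1, z.2.1, z.2.2⟩
  left_inv _ := rfl
  right_inv _ := rfl

instance : Primcodable Side := Primcodable.ofEquiv _ Side.equivProd

def Edge.equivProd : Edge ≃ Side × Side × Option Side where
  toFun e := (e.whole, e.lower, e.upper)
  invFun z := ⟨z.1, z.2.1, z.2.2⟩
  left_inv _ := rfl
  right_inv _ := rfl

instance : Primcodable Edge := Primcodable.ofEquiv _ Edge.equivProd

def Code.equivProd : Code ≃ List ℕ × List (Fin 3 → Corner) × List Edge where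
  toFun B := (B.layers, B.faces, B.edges)
  invFun z := ⟨z.1, z.2.1, z.2.2⟩
  left_inv _ := rfl
  right_inv _ := rfl

instance : Primcodable Code := Primcodable.ofEquiv _ Code.equivProd

/-! ### Combinatorics -/

/-- The corner at which an oriented side starts. -/
def Side.src (s : Side) : Fin 3 := if s.rev then s.opp + 2 else s.opp + 1

/-- The corner at which an oriented side ends. -/
def Side.tgt (s : Side) : Fin 3 := if s.rev then s.opp + 1 else s.opp + 2

/-- The sides which lie opposite to `whole` at an edge. -/
def Edge.small (e : Edge) : List Side := e.lower :: e.upper.toList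

/-- All sides which meet at an edge. -/
def Edge.sides (e : Edge) : List Side := e.whole :: e.small

/-- The `i`-th corner of the triangle number `f`. -/
def Code.corner (B : Code) (f : ℕ) (i : Fin 3) : Corner :=
  B.faces.getD f (fun _ => ⟨0, 0, 0, false⟩) i

/-- The corner number `i` of the triangle number `f` lies at the vertex `v` and contains the
layer `a` of the fibre over `v`. -/
def Code.HasLayer (B : Code) (v a : ℕ) (k : ℕ × Fin 3) : Prop :=
  k.1 < B.faces.length ∧ (B.corner k.1 k.2).vertex = v ∧
    (B.corner k.1 k.2).bot ≤ a ∧ a ≤ (B.corner k.1 k.2).top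

/-- At an end of an edge, the corners `l` and `u` of the two sheets `lower` and `upper` divide the
layers of the corner `w` of `whole` among themselves, with `l` below `u` as seen from `whole`. -/
def Stacked (w l u : Corner) : Prop :=
  if w.flip then u.bot = w.bot ∧ u.top + 1 = l.bot ∧ l.top = w.top
  else l.bot = w.bot ∧ l.top + 1 = u.bot ∧ u.top = w.top

/-- The edge `e` fits together at one of its ends (`end_` picks the corner of each side at that end):
the corners lie at the same vertex, and the fibres over `whole` are divided among the opposite
sheets. -/
def Code.EndFits (B : Code) (e : Edge) (end_ : Side → Fin 3) : Prop :=
  (∀ s ∈ e.small,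
    (B.corner s.face (end_ s)).vertex = (B.corner e.whole.face (end_ e.whole)).vertex) ∧
  match e.upper with
  | none =>
      (B.corner e.lower.face (end_ e.lower)).bot =
          (B.corner e.whole.face (end_ e.whole)).bot ∧
        (B.corner e.lower.face (end_ e.lower)).top =
          (B.corner e.whole.face (end_ e.whole)).top
  | some u =>
      Stacked (B.corner e.whole.face (end_ e.whole)) (B.corner e.lower.face (end_ e.lower))
        (B.corner u.face (end_ u))

/-- At one of its ends an edge joins the corner `p` of its triangle `whole` to the corner `q` of an
opposite triangle. -/
def Code.AdjCorner (B : Code) (p q : ℕ × Fin 3) : Prop :=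
  ∃ e ∈ B.edges, ∃ s ∈ e.small,
    (p = (e.whole.face, e.whole.src) ∧ q = (s.face, s.src)) ∨
    (p = (e.whole.face, e.whole.tgt) ∧ q = (s.face, s.tgt))

/-- A set of corners is nonempty, and any two of them are joined by a chain of adjacent corners
of the set. -/
def Code.ConnectedCorners (B : Code) (K : Set (ℕ × Fin 3)) : Prop :=
  K.Nonempty ∧ ∀ p ∈ K, ∀ q ∈ K,
    Relation.EqvGen (fun p q => p ∈ K ∧ q ∈ K ∧ B.AdjCorner p q) p q

/-- The code describes a branched surface (compact, without boundary), with the three standard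
local models: a smooth disc, a branch curve, a transverse crossing of two branch curves. -/
structure Code.IsBranchedSurface (B : Code) : Prop where
  layers_pos : ∀ n ∈ B.layers, 1 ≤ n ∧ n ≤ 3
  corner_fits : ∀ f < B.faces.length, ∀ i : Fin 3,
    (B.corner f i).vertex < B.layers.length ∧ (B.corner f i).bot ≤ (B.corner f i).top ∧
      (B.corner f i).top < B.layers.getD (B.corner f i).vertex 0
  /-- every side of every triangle occurs at exactly one edge, exactly once -/
  sides_nodup : ((B.edges.flatMap Edge.sides).map fun s => (s.face, s.opp)).Nodup
  mem_sides : ∀ (f : ℕ) (i : Fin 3), f < B.faces.length ↔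
    (f, i) ∈ (B.edges.flatMap Edge.sides).map fun s => (s.face, s.opp)
  edge_fits : ∀ e ∈ B.edges, B.EndFits e Side.src ∧ B.EndFits e Side.tgt
  /-- the upward directions of the fibres compare in the same way at both ends of an edge -/
  edge_flip : ∀ e ∈ B.edges, ∀ s ∈ e.small,
    ((B.corner e.whole.face e.whole.src).flip = (B.corner s.face s.src).flip ↔
      (B.corner e.whole.face e.whole.tgt).flip = (B.corner s.face s.tgt).flip)
  /-- the corners which contain a given layer over a vertex form one cycle: together they are a
  smooth disc around the vertex -/
  layer_disc : ∀ v < B.layers.length, ∀ a < B.layers.getD v 0,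
    B.ConnectedCorners {k | B.HasLayer v a k}
  /-- consecutive layers are separated by one cusp, which is open over one arc of directions only:
  the corners which contain both layers form an arc -/
  cusp : ∀ v < B.layers.length, ∀ a, a + 1 < B.layers.getD v 0 →
    B.ConnectedCorners {k | B.HasLayer v a k ∧ B.HasLayer v (a + 1) k} ∧
      ∃ k, B.HasLayer v a k ∧ ¬ B.HasLayer v (a + 1) k
  /-- at a double point the two branch curves cross: all four quadrants occur -/
  double_point : ∀ v < B.layers.length, B.layers.getD v 0 = 3 →
    ∀ b t : ℕ, b ≤ 1 → 1 ≤ t → t ≤ 2 → ∃ f < B.faces.length, ∃ i : Fin 3,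
      (B.corner f i).vertex = v ∧ (B.corner f i).bot = b ∧ (B.corner f i).top = t

/-! ### The branched surface and its fibred neighbourhood as topological spaces -/

/-- The height of the lower end of a corner, measured upwards with respect to its triangle. -/
def Corner.lo (k : Corner) : ℝ := if k.flip then -(2 * (k.top : ℝ) + 1) else 2 * (k.bot : ℝ)

/-- The height of the upper end of a corner, measured upwards with respect to its triangle. -/
def Corner.hi (k : Corner) : ℝ := if k.flip then -(2 * (k.bot : ℝ)) else 2 * (k.top : ℝ) + 1

/-- The part of `N(B)` over the triangle number `f`: pairs of a point of the triangle (in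
barycentric coordinates) and a height between the bottom and the top, which are affine functions on
the triangle. -/
abbrev Code.Prism (B : Code) (f : Fin B.faces.length) : Type :=
  {z : stdSimplex ℝ (Fin 3) × ℝ //
    ∑ i, z.1 i * (B.corner f i).lo ≤ z.2 ∧ z.2 ≤ ∑ i, z.1 i * (B.corner f i).hi}

/-- The disjoint union of the triangles. -/
abbrev Code.Triangles (B : Code) : Type := Σ _ : Fin B.faces.length, stdSimplex ℝ (Fin 3)

/-- The disjoint union of the prisms. -/
abbrev Code.Prisms (B : Code) : Type := Σ f : Fin B.faces.length, B.Prism f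

/-- The point of the triangle below a point of a prism. -/
def Code.foot (B : Code) (p : B.Prisms) : B.Triangles := ⟨p.1, p.2.1.1⟩

/-- The height of a point of a prism. -/
def Code.height (B : Code) (p : B.Prisms) : ℝ := p.2.1.2

/-- `y` is the point with parameter `t` on the oriented side `s`. -/
def Code.OnSide (B : Code) (s : Side) (t : ℝ) (y : B.Triangles) : Prop :=
  (y.1 : ℕ) = s.face ∧ y.2 s.opp = 0 ∧ y.2 s.src = 1 - t ∧ y.2 s.tgt = t

/-- At the edge `e` the point `y` of its triangle `whole` is glued to the point `z` of the opposite
side `s`. -/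
def Code.GlueBase (B : Code) (e : Edge) (s : Side) (y z : B.Triangles) : Prop :=
  ∃ t : ℝ, B.OnSide e.whole t y ∧ B.OnSide s t z

/-- Comparison of the upward directions over the two sides: `1` if they agree, `-1` if not. -/
def Code.sign (B : Code) (e : Edge) (s : Side) : ℝ :=
  if (B.corner e.whole.face e.whole.src).flip = (B.corner s.face s.src).flip then 1 else -1

/-- At the edge `e` the point `p` of the prism over `whole` is glued to the point `q` of the prism
over the opposite side `s`: they lie over glued points, at the same height. -/
def Code.Glue (B : Code) (e : Edge) (s : Side) (p q : B.Prisms) : Prop :=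
  B.GlueBase e s (B.foot p) (B.foot q) ∧ B.height q = B.sign e s * B.height p

/-- The branched surface: triangles glued along their sides. -/
def Code.Surface (B : Code) : Type :=
  Quot fun y z : B.Triangles => ∃ e ∈ B.edges, ∃ s ∈ e.small, B.GlueBase e s y z

instance (B : Code) : TopologicalSpace B.Surface :=
  inferInstanceAs (TopologicalSpace (Quot _))

/-- The fibred neighbourhood `N(B)`: prisms glued along their vertical sides. -/
def Code.Nbhd (B : Code) : Type :=
  Quot fun p q : B.Prisms => ∃ e ∈ B.edges, ∃ s ∈ e.small, B.Glue e s p q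

instance (B : Code) : TopologicalSpace B.Nbhd :=
  inferInstanceAs (TopologicalSpace (Quot _))

/-- The point of the branched surface given by a point of a triangle. -/
def Code.toSurface (B : Code) (y : B.Triangles) : B.Surface := Quot.mk _ y

/-- The point of `N(B)` given by a point of a prism. -/
def Code.toNbhd (B : Code) (p : B.Prisms) : B.Nbhd := Quot.mk _ p

/-- The projection `π : N(B) → B`; its point preimages are the interval fibres of `N(B)`. -/
def Code.proj (B : Code) : B.Nbhd → B.Surface :=
  Quot.map B.foot fun _ _ ⟨e, he, s, hs, h⟩ => ⟨e, he, s, hs, h.1⟩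

/-- The (open) vertical boundary of `N(B)`: the points over an edge which belong to the prism over
`whole` and are not glued to any point across the edge, so that they lie in the cusp. -/
def Code.verticalBoundary (B : Code) : Set B.Nbhd :=
  {n | ∃ e ∈ B.edges, ∃ t : ℝ, ∃ p : B.Prisms, B.toNbhd p = n ∧ B.OnSide e.whole t (B.foot p) ∧
    ∀ s ∈ e.small, ∀ q : B.Prisms, ¬ B.Glue e s p q}

/-! ### Laminations -/

/-- A product chart for a subset `S` of `N(B)`: an open part of `S` is a product
`base × transversal` in which each plaque `base × {c}` is a section of `π` over `base`.  The
condition `base_spreads` says that the plaque through a point extends over a neighbourhood of its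
foot in each triangle from which the point is obtained.  If moreover `S` misses the vertical
boundary, then these triangles fit together to a smooth disc in `B`; so plaques are open surfaces
which are (topologically) transverse to the fibres. -/
structure FlowBox (B : Code) (S : Set B.Nbhd) where
  dom : Set B.Nbhd
  isOpen_dom : IsOpen dom
  base : Set B.Surface
  transversal : Set ℝ
  isClosed_transversal : IsClosed transversal
  chart : ↥(S ∩ dom) ≃ₜ base × transversal
  chart_fst : ∀ p : ↥(S ∩ dom), ((chart p).1 : B.Surface) = B.proj p
  base_spreads : ∀ p : B.Prisms, B.toNbhd p ∈ S ∩ dom →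
    ∀ᶠ y in 𝓝 (B.foot p), B.toSurface y ∈ base

/-- Two charts of `S` define the same leaves: through every common point, their plaques agree
near that point. -/
def FlowBox.Compatible {B : Code} {S : Set B.Nbhd} (α β : FlowBox B S) : Prop :=
  ∀ (p : B.Nbhd) (ha : p ∈ S ∩ α.dom) (hb : p ∈ S ∩ β.dom),
    ∀ᶠ q in 𝓝 p, ∀ (qa : q ∈ S ∩ α.dom) (qb : q ∈ S ∩ β.dom),
      (α.chart ⟨q, qa⟩).2 = (α.chart ⟨p, ha⟩).2 ↔ (β.chart ⟨q, qb⟩).2 = (β.chart ⟨p, hb⟩).2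

/-- `S` is (the support of) a lamination carried by `B`: a closed subset of `N(B)` which is
foliated by leaves without boundary that are transverse to the fibres. -/
structure Code.IsCarriedLamination (B : Code) (S : Set B.Nbhd) : Prop where
  isClosed : IsClosed S
  disjoint_vertical : Disjoint S B.verticalBoundary
  exists_atlas : ∃ A : Set (FlowBox B S), (∀ p ∈ S, ∃ α ∈ A, p ∈ α.dom) ∧
    ∀ α ∈ A, ∀ β ∈ A, α.Compatible β

/-- `B` carries a (nonempty) lamination. -/
def Code.CarriesLamination (B : Code) : Prop :=
  ∃ S : Set B.Nbhd, B.IsCarriedLamination S ∧ S.Nonempty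

/-- `B` fully carries a lamination: one which meets every fibre of `N(B)`. -/
def Code.FullyCarriesLamination (B : Code) : Prop :=
  ∃ S : Set B.Nbhd, B.IsCarriedLamination S ∧ ∀ b : B.Surface, ∃ p ∈ S, B.proj p = b

end BranchedSurface

/-! Each of the two properties amounts to the satisfiability of a primitive recursive set of
propositional clauses, and by compactness the unsatisfiability of such a set is discovered by a
finite search (`refutable_iff`, `IsClausal.rePred`). The work lies in bringing the geometric object
into this form, by two translations.

Laminations and plaque systems. A triangle is simply connected, so a carried lamination is a product
over it: every plaque extends to a section over the whole triangle (`LocalProduct.exists_global`).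
Distinct sections are disjoint, hence totally ordered, and only the triples of their heights over
the corners are retained (`exists_plaqueSystem`). Conversely the plaques may be straightened: the
affine plaques with the given triples are disjoint, fit together across the edges, and form a
product near every point (`isCarriedLamination_support`). This requires explicit control of the
gluing relation and the Hausdorff property; both come from continuous functions which separate the
gluing classes (`cases_of_inv_eq`).

Plaque systems and models. From starting points in some of the triangles, only countably many points
over the vertices are reached by following plaques from corner to corner and by passing to the
highest point of a layer. They are named by terms; what is retained is the layer of each named point
and the order of the points over one vertex (`PlaqueSystem.isModel`). Conversely, the countable
total preorder of each layer is embedded in an interval, and the closures of the resulting sets of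
triples form a plaque system (`Code.IsModel.plaqueSystem`). Taking closures could make two plaques
meet at one corner and not at another, because the maps between fibres are only known to be monotone
on a countable set. The embedding of `exists_embedding` excludes this: every named point is isolated
among the named points, and between any two points of the closure there lies, weakly, a named one.

Names act as Skolem functions, so the axioms of a model are universal apart from a finite
disjunction over layers, and hence are clauses in variables for `At x v a` and `Le x y`. Carrying
and fully carrying differ only in the starting points: one is required in some triangle, or in every
triangle. -/

namespace BranchedSurface

/-! ### Sides, corners and edges -/

theorem Side.opp_ne_src (s : Side) : s.opp ≠ s.src := by
  rcases s with ⟨f, i, r⟩; cases r <;> revert i <;> simp only [Side.src] <;> decide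

theorem Side.opp_ne_tgt (s : Side) : s.opp ≠ s.tgt := by
  rcases s with ⟨f, i, r⟩; cases r <;> revert i <;> simp only [Side.tgt] <;> decide

theorem Side.src_ne_tgt (s : Side) : s.src ≠ s.tgt := by
  rcases s with ⟨f, i, r⟩; cases r <;> revert i <;> simp only [Side.tgt, Side.src] <;> decide

theorem Side.eq_opp_or (s : Side) (i : Fin 3) : i = s.opp ∨ i = s.src ∨ i = s.tgt := by
  rcases s with ⟨f, j, r⟩; cases r <;> revert i j <;> simp only [Side.tgt, Side.src] <;> decide

theorem Side.sum_eq {M : Type*} [AddCommMonoid M] (s : Side) (F : Fin 3 → M) :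
    ∑ i, F i = F s.opp + F s.src + F s.tgt := by
  rw [Fin.sum_univ_three]
  rcases s with ⟨f, j, r⟩
  fin_cases j <;> cases r <;> simp [Side.src, Side.tgt] <;> abel

/-- Sides opposite to different corners of one triangle: the corner opposite to one of them is an
end of the other. -/
theorem Side.opp_eq_src_or_tgt {s s' : Side} (h : s'.opp ≠ s.opp) :
    s.opp = s'.src ∨ s.opp = s'.tgt := by
  rcases s'.eq_opp_or s.opp with h' | h' | h'
  · exact absurd h'.symm h
  · exact Or.inl h'
  · exact Or.inr h'

theorem barycentric_sum (y : stdSimplex ℝ (Fin 3)) : y 0 + y 1 + y 2 = 1 := by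
  have := y.2.2
  rw [Fin.sum_univ_three] at this
  exact this

theorem Side.barycentric_sum (s : Side) (y : stdSimplex ℝ (Fin 3)) :
    y s.opp + y s.src + y s.tgt = 1 := by
  rw [← s.sum_eq fun i => y i, Fin.sum_univ_three]
  exact BranchedSurface.barycentric_sum y

theorem barycentric_nonneg (y : stdSimplex ℝ (Fin 3)) (i : Fin 3) : 0 ≤ y i := y.2.1 i

theorem continuous_barycentric (i : Fin 3) : Continuous fun y : stdSimplex ℝ (Fin 3) => y i :=
  (continuous_apply i).comp continuous_subtype_val

/-- The comparison of heights over a triangle with heights over the vertex of a corner. -/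
def Corner.eps (k : Corner) : ℝ := if k.flip then -1 else 1

theorem Corner.eps_mul_eps (k : Corner) : k.eps * k.eps = 1 := by
  unfold Corner.eps; split_ifs <;> norm_num

theorem Corner.eps_ne_zero (k : Corner) : k.eps ≠ 0 := by
  unfold Corner.eps; split_ifs <;> norm_num

theorem Corner.eps_mul_cancel (k : Corner) (h : ℝ) : k.eps * (k.eps * h) = h := by
  rw [← mul_assoc, k.eps_mul_eps, one_mul]

/-- Multiplication by `eps` converts heights over the triangle into heights over the vertex. In the
latter the fibre of a corner is an interval of layers and gaps, whatever the flip, so comparisons at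
a vertex are made there. -/
theorem Corner.mem_range_iff (k : Corner) (η : ℝ) :
    (k.lo ≤ η ∧ η ≤ k.hi) ↔ (2 * (k.bot : ℝ) ≤ k.eps * η ∧ k.eps * η ≤ 2 * (k.top : ℝ) + 1) := by
  unfold Corner.lo Corner.hi Corner.eps
  split_ifs
  · constructor <;> rintro ⟨h1, h2⟩ <;> constructor <;> linarith
  · simp

/-- Agreement of the up directions as a sign; at small sides this is `Code.sign`. -/
theorem Code.sign_eq (B : Code) (e : Edge) (s : Side) :
    B.sign e s = (B.corner e.whole.face e.whole.src).eps * (B.corner s.face s.src).eps := by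
  unfold Code.sign Corner.eps
  cases (B.corner e.whole.face e.whole.src).flip <;> cases (B.corner s.face s.src).flip <;> simp

theorem Edge.whole_mem_sides (e : Edge) : e.whole ∈ e.sides := by simp [Edge.sides]

theorem Edge.small_mem_sides {e : Edge} {s : Side} (h : s ∈ e.small) : s ∈ e.sides := by
  simp [Edge.sides, h]

theorem Edge.mem_sides_iff {e : Edge} {s : Side} : s ∈ e.sides ↔ s = e.whole ∨ s ∈ e.small := by
  simp [Edge.sides]

namespace Code.IsBranchedSurface

variable {B : Code} (hB : B.IsBranchedSurface)
include hB

theorem face_lt {e : Edge} (he : e ∈ B.edges) {s : Side} (hs : s ∈ e.sides) :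
    s.face < B.faces.length :=
  (hB.mem_sides s.face s.opp).2
    (List.mem_map.2 ⟨s, List.mem_flatMap.2 ⟨e, he, hs⟩, rfl⟩)

theorem exists_side {f : ℕ} (hf : f < B.faces.length) (i : Fin 3) :
    ∃ e ∈ B.edges, ∃ s ∈ e.sides, s.face = f ∧ s.opp = i := by
  obtain ⟨s, hs, h⟩ := List.mem_map.1 ((hB.mem_sides f i).1 hf)
  obtain ⟨e, he, hs⟩ := List.mem_flatMap.1 hs
  simp only [Prod.mk.injEq] at h
  exact ⟨e, he, s, hs, h.1, h.2⟩

/-- The pairs (triangle, opposite corner) taken over all edges form one list without repetition, so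
such a pair determines both the edge and the oriented side. -/
theorem side_unique {e e' : Edge} (he : e ∈ B.edges) (he' : e' ∈ B.edges) {s s' : Side}
    (hs : s ∈ e.sides) (hs' : s' ∈ e'.sides) (hf : s.face = s'.face) (ho : s.opp = s'.opp) :
    e = e' ∧ s = s' := by
  have h1 : s = s' := List.inj_on_of_nodup_map hB.sides_nodup
    (List.mem_flatMap.2 ⟨e, he, hs⟩) (List.mem_flatMap.2 ⟨e', he', hs'⟩) (by simp [hf, ho])
  refine ⟨?_, h1⟩
  by_contra hne
  have h2 := (List.nodup_flatMap.1 (List.Nodup.of_map _ hB.sides_nodup)).2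
  have : Std.Symm (Function.onFun List.Disjoint Edge.sides) := ⟨fun a b h => List.Disjoint.symm h⟩
  exact h2.forall he he' hne hs (h1 ▸ hs')

theorem sides_nodup' {e : Edge} (he : e ∈ B.edges) : e.sides.Nodup :=
  (List.nodup_flatMap.1 (List.Nodup.of_map _ hB.sides_nodup)).1 e he

/-- Both ends of an edge at once. -/
theorem end_fits {e : Edge} (he : e ∈ B.edges) {end_ : Side → Fin 3}
    (hend : end_ = Side.src ∨ end_ = Side.tgt) : B.EndFits e end_ := by
  rcases hend with rfl | rfl
  · exact (hB.edge_fits e he).1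
  · exact (hB.edge_fits e he).2

theorem vertex_end {e : Edge} (he : e ∈ B.edges) {end_ : Side → Fin 3}
    (hend : end_ = Side.src ∨ end_ = Side.tgt) {s : Side} (hs : s ∈ e.sides) :
    (B.corner s.face (end_ s)).vertex = (B.corner e.whole.face (end_ e.whole)).vertex := by
  rcases Edge.mem_sides_iff.1 hs with rfl | hs
  · rfl
  · exact (hB.end_fits he hend).1 s hs

/-- The comparison of up directions may be made at either end of an edge. -/
theorem sign_eq_end {e : Edge} (he : e ∈ B.edges) {end_ : Side → Fin 3}
    (hend : end_ = Side.src ∨ end_ = Side.tgt) {s : Side} (hs : s ∈ e.sides) :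
    B.sign e s =
      (B.corner e.whole.face (end_ e.whole)).eps * (B.corner s.face (end_ s)).eps := by
  rw [Code.sign_eq]
  rcases hend with rfl | rfl
  · rfl
  rcases Edge.mem_sides_iff.1 hs with rfl | hs
  · rw [Corner.eps_mul_eps, Corner.eps_mul_eps]
  · have := hB.edge_flip e he s hs
    unfold Corner.eps
    revert this
    cases (B.corner e.whole.face e.whole.src).flip <;> cases (B.corner s.face s.src).flip <;>
      cases (B.corner e.whole.face e.whole.tgt).flip <;>
      cases (B.corner s.face s.tgt).flip <;> simp

theorem bot_le_top {f : ℕ} (hf : f < B.faces.length) (i : Fin 3) :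
    (B.corner f i).bot ≤ (B.corner f i).top := (hB.corner_fits f hf i).2.1

/-- At a branch edge two ranges of layers are stacked to make up the range of `whole`. Each is
contained in it because the other is nonempty, which is where `bot_le_top` enters. -/
theorem range_le {e : Edge} (he : e ∈ B.edges) {end_ : Side → Fin 3}
    (hend : end_ = Side.src ∨ end_ = Side.tgt) {s : Side} (hs : s ∈ e.small) :
    (B.corner e.whole.face (end_ e.whole)).bot ≤ (B.corner s.face (end_ s)).bot ∧
      (B.corner s.face (end_ s)).top ≤ (B.corner e.whole.face (end_ e.whole)).top := by
  have h := (hB.end_fits he hend).2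
  have hl := hB.bot_le_top (hB.face_lt he (Edge.small_mem_sides (s := e.lower)
    (by simp [Edge.small]))) (end_ e.lower)
  have hs' := hB.bot_le_top (hB.face_lt he (Edge.small_mem_sides hs)) (end_ s)
  rcases e with ⟨w, l, _ | u⟩
  · simp only [Edge.small, Option.toList, List.mem_singleton] at hs
    subst hs
    dsimp only at h hl ⊢
    omega
  · simp only [Edge.small, Option.toList, List.mem_cons, List.not_mem_nil, or_false] at hs
    have hu := hB.bot_le_top (hB.face_lt he (Edge.small_mem_sides (s := u)
      (by simp [Edge.small]))) (end_ u)
    simp only [Stacked] at h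
    rcases hs with rfl | rfl <;> split_ifs at h <;> dsimp only at hl hu ⊢ <;> omega

/-- Every layer of the fibre over an end of an edge continues into one of the sheets opposite to
the triangle `whole`. -/
theorem exists_small {e : Edge} (he : e ∈ B.edges) {end_ : Side → Fin 3}
    (hend : end_ = Side.src ∨ end_ = Side.tgt) {a : ℕ}
    (h1 : (B.corner e.whole.face (end_ e.whole)).bot ≤ a)
    (h2 : a ≤ (B.corner e.whole.face (end_ e.whole)).top) :
    ∃ s ∈ e.small, (B.corner s.face (end_ s)).bot ≤ a ∧ a ≤ (B.corner s.face (end_ s)).top := by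
  have h := (hB.end_fits he hend).2
  rcases e with ⟨w, l, _ | u⟩
  · simp only at h h1 h2
    exact ⟨l, by simp [Edge.small], by omega⟩
  · simp only [Stacked] at h h1 h2
    by_cases hl : (B.corner l.face (end_ l)).bot ≤ a ∧ a ≤ (B.corner l.face (end_ l)).top
    · exact ⟨l, by simp [Edge.small], hl⟩
    · exact ⟨u, by simp [Edge.small], by split_ifs at h <;> omega⟩

/-- Seen from `whole`, the fibres over the sheet `lower` lie below those over `upper`, and the
cusp between them has height at least one. -/
theorem lower_add_one_le {e : Edge} (he : e ∈ B.edges) {end_ : Side → Fin 3}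
    (hend : end_ = Side.src ∨ end_ = Side.tgt) {u : Side} (hu : e.upper = some u) {η θ : ℝ}
    (hη : (B.corner e.lower.face (end_ e.lower)).lo ≤ η ∧
      η ≤ (B.corner e.lower.face (end_ e.lower)).hi)
    (hθ : (B.corner u.face (end_ u)).lo ≤ θ ∧ θ ≤ (B.corner u.face (end_ u)).hi) :
    B.sign e e.lower * η + 1 ≤ B.sign e u * θ := by
  have h := (hB.end_fits he hend).2
  rw [hB.sign_eq_end he hend (Edge.small_mem_sides (s := e.lower) (by simp [Edge.small])),
    hB.sign_eq_end he hend (Edge.small_mem_sides (s := u) (by simp [Edge.small, hu]))]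
  rw [Corner.mem_range_iff] at hη hθ
  rw [hu] at h
  simp only [Stacked] at h
  rw [mul_assoc, mul_assoc]
  set A := (B.corner e.lower.face (end_ e.lower)).eps * η
  set C := (B.corner u.face (end_ u)).eps * θ
  unfold Corner.eps
  split_ifs at h ⊢ with h'
  · have := congrArg (Nat.cast (R := ℝ)) h.2.1
    push_cast at this
    linarith
  · have := congrArg (Nat.cast (R := ℝ)) h.2.1
    push_cast at this
    linarith

theorem range_whole {e : Edge} (he : e ∈ B.edges) {end_ : Side → Fin 3}
    (hend : end_ = Side.src ∨ end_ = Side.tgt) {s : Side} (hs : s ∈ e.sides) {η : ℝ}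
    (hη : (B.corner s.face (end_ s)).lo ≤ η ∧ η ≤ (B.corner s.face (end_ s)).hi) :
    (B.corner e.whole.face (end_ e.whole)).lo ≤ B.sign e s * η ∧
      B.sign e s * η ≤ (B.corner e.whole.face (end_ e.whole)).hi := by
  rw [hB.sign_eq_end he hend hs]
  rw [Corner.mem_range_iff] at hη ⊢
  rw [mul_assoc, Corner.eps_mul_cancel]
  rcases Edge.mem_sides_iff.1 hs with rfl | hs
  · exact hη
  · have h := hB.range_le he hend hs
    have h1 : ((B.corner e.whole.face (end_ e.whole)).bot : ℝ) ≤ (B.corner s.face (end_ s)).bot :=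
      by exact_mod_cast h.1
    have h2 : ((B.corner s.face (end_ s)).top : ℝ) ≤ (B.corner e.whole.face (end_ e.whole)).top :=
      by exact_mod_cast h.2
    constructor <;> linarith

end Code.IsBranchedSurface

theorem Code.IsBranchedSurface.lo_add_one_le {B : Code} (hB : B.IsBranchedSurface) {f : ℕ}
    (hf : f < B.faces.length) (i : Fin 3) : (B.corner f i).lo + 1 ≤ (B.corner f i).hi := by
  have : ((B.corner f i).bot : ℝ) ≤ (B.corner f i).top := by exact_mod_cast hB.bot_le_top hf i
  unfold Corner.lo Corner.hi
  split_ifs <;> linarith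

/-! ### Points of prisms -/

/-- The heights over a point of a triangle which belong to the prism. -/
def Code.InPrism (B : Code) (f : ℕ) (y : stdSimplex ℝ (Fin 3)) (η : ℝ) : Prop :=
  ∑ i, y i * (B.corner f i).lo ≤ η ∧ η ≤ ∑ i, y i * (B.corner f i).hi

/-- A point of a prism. -/
def Code.pt {B : Code} {f : Fin B.faces.length} {y : stdSimplex ℝ (Fin 3)} {η : ℝ}
    (h : B.InPrism f y η) : B.Prisms := ⟨f, ⟨(y, η), h⟩⟩

theorem Code.inPrism (B : Code) (p : B.Prisms) :
    B.InPrism (B.foot p).1 (B.foot p).2 (B.height p) := p.2.2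

theorem Code.Prisms.ext {B : Code} {p q : B.Prisms} (h1 : B.foot p = B.foot q)
    (h2 : B.height p = B.height q) : p = q := by
  rcases p with ⟨f, ⟨⟨y, η⟩, hp⟩⟩
  rcases q with ⟨g, ⟨⟨z, θ⟩, hq⟩⟩
  simp only [Code.foot, Sigma.mk.injEq] at h1
  obtain ⟨rfl, h1⟩ := h1
  obtain rfl := eq_of_heq h1
  simp only [Code.height] at h2
  subst h2
  rfl

theorem Code.inPrism_sum {B : Code} {f : ℕ} (y : stdSimplex ℝ (Fin 3)) {g : Fin 3 → ℝ}
    (hg : ∀ i, (B.corner f i).lo ≤ g i ∧ g i ≤ (B.corner f i).hi) :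
    B.InPrism f y (∑ i, y i * g i) :=
  ⟨Finset.sum_le_sum fun i _ => mul_le_mul_of_nonneg_left (hg i).1 (barycentric_nonneg y i),
    Finset.sum_le_sum fun i _ => mul_le_mul_of_nonneg_left (hg i).2 (barycentric_nonneg y i)⟩

/-- A height in a prism is the affine interpolation of heights over the three corners. -/
theorem Code.IsBranchedSurface.inPrism_iff {B : Code} (hB : B.IsBranchedSurface) {f : ℕ}
    (hf : f < B.faces.length) {y : stdSimplex ℝ (Fin 3)} {η : ℝ} :
    B.InPrism f y η ↔ ∃ g : Fin 3 → ℝ,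
      (∀ i, (B.corner f i).lo ≤ g i ∧ g i ≤ (B.corner f i).hi) ∧ η = ∑ i, y i * g i := by
  constructor
  · rintro ⟨h1, h2⟩
    have hd : ∑ i, y i * (B.corner f i).lo < ∑ i, y i * (B.corner f i).hi := by
      have : ∑ i, y i * (B.corner f i).lo + 1 ≤ ∑ i, y i * (B.corner f i).hi := by
        have hy : (1 : ℝ) = ∑ i, y i * 1 := by simp
        conv_lhs => rw [hy, ← Finset.sum_add_distrib]
        refine Finset.sum_le_sum fun i _ => ?_
        rw [← mul_add]
        exact mul_le_mul_of_nonneg_left (hB.lo_add_one_le hf i) (barycentric_nonneg y i)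
      linarith
    set L := ∑ i, y i * (B.corner f i).lo
    set H := ∑ i, y i * (B.corner f i).hi
    -- The height divides the fibre in the ratio `r`; dividing the fibres over all three corners in
    -- the same ratio gives the interpolation.
    set r := (η - L) / (H - L)
    have hr0 : 0 ≤ r := div_nonneg (by linarith) (by linarith)
    have hr1 : r ≤ 1 := (div_le_one (by linarith)).2 (by linarith)
    refine ⟨fun i => (B.corner f i).lo + r * ((B.corner f i).hi - (B.corner f i).lo),
      fun i => ?_, ?_⟩
    · have := hB.lo_add_one_le hf i
      constructor <;> nlinarith
    · have : ∑ i, y i * ((B.corner f i).lo + r * ((B.corner f i).hi - (B.corner f i).lo)) =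
          L + r * (H - L) := by
        simp only [L, H, ← Finset.sum_sub_distrib, Finset.mul_sum, ← Finset.sum_add_distrib]
        exact Finset.sum_congr rfl fun i _ => by ring
      rw [this, div_mul_cancel₀ _ (by linarith)]
      ring
  · rintro ⟨g, hg, rfl⟩
    exact Code.inPrism_sum y hg

theorem Code.OnSide.sum_eq {B : Code} {s : Side} {t : ℝ} {y : B.Triangles} (h : B.OnSide s t y)
    (g : Fin 3 → ℝ) : ∑ i, y.2 i * g i = (1 - t) * g s.src + t * g s.tgt := by
  rw [s.sum_eq, h.2.1, h.2.2.1, h.2.2.2]; ring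

theorem Code.OnSide.nonneg {B : Code} {s : Side} {t : ℝ} {y : B.Triangles} (h : B.OnSide s t y) :
    0 ≤ t := h.2.2.2 ▸ barycentric_nonneg _ _

theorem Code.OnSide.le_one {B : Code} {s : Side} {t : ℝ} {y : B.Triangles} (h : B.OnSide s t y) :
    t ≤ 1 := by
  have := h.2.2.1 ▸ barycentric_nonneg y.2 s.src
  linarith

/-- The point with a given parameter on a side. -/
theorem Code.exists_onSide {B : Code} {s : Side} (hs : s.face < B.faces.length) {t : ℝ}
    (h0 : 0 ≤ t) (h1 : t ≤ 1) : ∃ y : B.Triangles, B.OnSide s t y := by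
  refine ⟨⟨⟨s.face, hs⟩, ⟨fun i => if i = s.src then 1 - t else if i = s.tgt then t else 0,
    fun i => ?_, ?_⟩⟩, rfl, ?_, ?_, ?_⟩
  · dsimp only
    split_ifs <;> linarith
  · rw [s.sum_eq]
    simp [s.opp_ne_src, s.opp_ne_tgt, s.src_ne_tgt.symm]
  · change (if s.opp = s.src then 1 - t else if s.opp = s.tgt then t else 0) = 0
    simp [s.opp_ne_src, s.opp_ne_tgt]
  · change (if s.src = s.src then 1 - t else if s.src = s.tgt then t else 0) = 1 - t
    simp
  · change (if s.tgt = s.src then 1 - t else if s.tgt = s.tgt then t else 0) = t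
    simp [s.src_ne_tgt.symm]

theorem Code.OnSide.ext {B : Code} {s : Side} {t : ℝ} {y z : B.Triangles} (hy : B.OnSide s t y)
    (hz : B.OnSide s t z) : y = z := by
  rcases y with ⟨f, y⟩
  rcases z with ⟨g, z⟩
  obtain rfl : f = g := Fin.ext (hy.1.trans hz.1.symm)
  congr 1
  ext i
  rcases s.eq_opp_or i with rfl | rfl | rfl
  · exact hy.2.1.trans hz.2.1.symm
  · exact hy.2.2.1.trans hz.2.2.1.symm
  · exact hy.2.2.2.trans hz.2.2.2.symm

theorem Code.onSide_of_opp_eq_zero {B : Code} {s : Side} {y : B.Triangles} (hf : (y.1 : ℕ) = s.face)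
    (h : y.2 s.opp = 0) : B.OnSide s (y.2 s.tgt) y := by
  refine ⟨hf, h, ?_, rfl⟩
  have := s.barycentric_sum y.2
  linarith

/-- A point of the prism over `s` has a counterpart in the prism over `whole`. -/
theorem Code.IsBranchedSurface.inPrism_whole {B : Code} (hB : B.IsBranchedSurface) {e : Edge}
    (he : e ∈ B.edges) {s : Side} (hs : s ∈ e.sides) {t : ℝ} {y z : B.Triangles}
    (hy : B.OnSide e.whole t y) (hz : B.OnSide s t z) {η : ℝ} (hη : B.InPrism z.1 z.2 η) :
    B.InPrism y.1 y.2 (B.sign e s * η) := by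
  rw [hz.1, hB.inPrism_iff (hB.face_lt he hs)] at hη
  obtain ⟨g, hg, rfl⟩ := hη
  rw [hy.1, hB.inPrism_iff (hB.face_lt he e.whole_mem_sides)]
  -- The height at the corner off the side has weight zero, so any admissible value serves there.
  refine ⟨fun i => if i = e.whole.src then B.sign e s * g s.src else
    if i = e.whole.tgt then B.sign e s * g s.tgt else (B.corner e.whole.face i).lo,
    fun i => ?_, ?_⟩
  · dsimp only
    split_ifs with h1 h2
    · rw [h1]; exact hB.range_whole he (Or.inl rfl) hs (hg s.src)
    · rw [h2]; exact hB.range_whole he (Or.inr rfl) hs (hg s.tgt)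
    · exact ⟨le_rfl, by linarith [hB.lo_add_one_le (hB.face_lt he e.whole_mem_sides) i]⟩
  · rw [hz.sum_eq, hy.sum_eq]
    simp only [if_true, e.whole.src_ne_tgt.symm, if_false]
    ring

/-! ### Glued points -/

theorem Code.sign_whole {B : Code} (e : Edge) : B.sign e e.whole = 1 := by
  rw [Code.sign_eq, Corner.eps_mul_eps]

theorem Code.sign_mul_sign (B : Code) (e : Edge) (s : Side) : B.sign e s * B.sign e s = 1 := by
  unfold Code.sign; split_ifs <;> norm_num

theorem Code.toNbhd_eq_of_glue {B : Code} {e : Edge} (he : e ∈ B.edges) {s : Side}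
    (hs : s ∈ e.small) {p q : B.Prisms} (h : B.Glue e s p q) : B.toNbhd p = B.toNbhd q :=
  Quot.sound ⟨e, he, s, hs, h⟩

theorem Code.toSurface_eq_of_glueBase {B : Code} {e : Edge} (he : e ∈ B.edges) {s : Side}
    (hs : s ∈ e.small) {y z : B.Triangles} (h : B.GlueBase e s y z) :
    B.toSurface y = B.toSurface z :=
  Quot.sound ⟨e, he, s, hs, h⟩

@[simp] theorem Code.proj_toNbhd (B : Code) (p : B.Prisms) :
    B.proj (B.toNbhd p) = B.toSurface (B.foot p) := rfl

theorem Code.toNbhd_eq_of_whole {B : Code} {e : Edge}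
    (he : e ∈ B.edges) {s : Side} (hs : s ∈ e.sides) {t : ℝ} {p q : B.Prisms}
    (hp : B.OnSide e.whole t (B.foot p)) (hq : B.OnSide s t (B.foot q))
    (h : B.height p = B.sign e s * B.height q) : B.toNbhd p = B.toNbhd q := by
  rcases Edge.mem_sides_iff.1 hs with rfl | hs
  · rw [Code.sign_whole, one_mul] at h
    rw [Code.Prisms.ext (hp.ext hq) h]
  · refine Code.toNbhd_eq_of_glue he hs ⟨⟨t, hp, hq⟩, ?_⟩
    rw [h, ← mul_assoc, Code.sign_mul_sign, one_mul]

/-- Points over the same point of an edge and at the same height coincide. -/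
theorem Code.IsBranchedSurface.toNbhd_eq_of_sides {B : Code} (hB : B.IsBranchedSurface) {e : Edge}
    (he : e ∈ B.edges) {s s' : Side} (hs : s ∈ e.sides) (hs' : s' ∈ e.sides) {t : ℝ}
    {p q : B.Prisms} (hp : B.OnSide s t (B.foot p)) (hq : B.OnSide s' t (B.foot q))
    (h : B.sign e s * B.height p = B.sign e s' * B.height q) : B.toNbhd p = B.toNbhd q := by
  -- The opposite sheets are glued to each other only through `whole`, so both points are compared
  -- with their counterpart there.
  obtain ⟨y, hy⟩ := Code.exists_onSide (hB.face_lt he e.whole_mem_sides) hp.nonneg hp.le_one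
  have hm := hB.inPrism_whole he hs hy hp (B.inPrism p)
  have hm' : B.InPrism y.1 y.2 (B.sign e s * B.height p) := hm
  exact (Code.toNbhd_eq_of_whole he hs (p := Code.pt hm') hy hp rfl).symm.trans
    (Code.toNbhd_eq_of_whole he hs' (p := Code.pt hm') hy hq h)

/-! ### Points over a vertex -/

theorem Code.sum_eq_of_eq_one {y : stdSimplex ℝ (Fin 3)} {i : Fin 3} (h : y i = 1)
    (g : Fin 3 → ℝ) : ∑ j, y j * g j = g i := by
  have h0 : ∀ j, j ≠ i → y j = 0 := by
    intro j hj
    have h1 : ∑ k, y k = 1 := y.2.2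
    rw [← Finset.add_sum_erase _ _ (Finset.mem_univ i), h] at h1
    have h2 : ∑ k ∈ Finset.univ.erase i, y k = 0 := by linarith
    exact (Finset.sum_eq_zero_iff_of_nonneg fun k _ => barycentric_nonneg y k).1 h2 j (by simp [hj])
  rw [Finset.sum_eq_single i (fun j _ hj => by rw [h0 j hj, zero_mul]) (by simp), h, one_mul]

theorem Code.eq_of_eq_one {y z : stdSimplex ℝ (Fin 3)} {i : Fin 3} (hy : y i = 1) (hz : z i = 1) :
    y = z := by
  ext j
  have h1 := Code.sum_eq_of_eq_one hy (fun k => if k = j then 1 else 0)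
  have h2 := Code.sum_eq_of_eq_one hz (fun k => if k = j then 1 else 0)
  simp only [mul_ite, mul_one, mul_zero, Finset.sum_ite_eq', Finset.mem_univ, if_true] at h1 h2
  change y j = z j
  rw [h1, h2]

theorem Code.exists_eq_one (i : Fin 3) : ∃ y : stdSimplex ℝ (Fin 3), y i = 1 := by
  refine ⟨⟨Pi.single i 1, single_mem_stdSimplex ℝ i⟩, ?_⟩
  change (Pi.single i 1 : Fin 3 → ℝ) i = 1
  simp

/-- The point of the prism at the corner `k`, at height `h` over the vertex. -/
def Code.AtCorner (B : Code) (k : ℕ × Fin 3) (h : ℝ) (p : B.Prisms) : Prop :=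
  (p.1 : ℕ) = k.1 ∧ (B.foot p).2 k.2 = 1 ∧ (B.corner k.1 k.2).eps * B.height p = h

theorem Code.AtCorner.ext {B : Code} {k : ℕ × Fin 3} {h : ℝ} {p q : B.Prisms}
    (hp : B.AtCorner k h p) (hq : B.AtCorner k h q) : p = q := by
  refine Code.Prisms.ext ?_ ?_
  · exact Sigma.ext (Fin.ext (hp.1.trans hq.1.symm)) (heq_of_eq (Code.eq_of_eq_one hp.2.1 hq.2.1))
  · have := hp.2.2.trans hq.2.2.symm
    exact mul_left_cancel₀ (Corner.eps_ne_zero _) this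

theorem Code.AtCorner.mem_range {B : Code} {k : ℕ × Fin 3} {h : ℝ} {p : B.Prisms}
    (hp : B.AtCorner k h p) :
    2 * ((B.corner k.1 k.2).bot : ℝ) ≤ h ∧ h ≤ 2 * ((B.corner k.1 k.2).top : ℝ) + 1 := by
  have := B.inPrism p
  unfold Code.InPrism at this
  rw [Code.sum_eq_of_eq_one hp.2.1 (fun i => (B.corner (B.foot p).1 i).lo),
    Code.sum_eq_of_eq_one hp.2.1 (fun i => (B.corner (B.foot p).1 i).hi),
    Corner.mem_range_iff] at this
  rw [show ((B.foot p).1 : ℕ) = k.1 from hp.1, hp.2.2] at this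
  exact this

theorem Code.exists_atCorner {B : Code} {k : ℕ × Fin 3} (hk : k.1 < B.faces.length) {h : ℝ}
    (hh : 2 * ((B.corner k.1 k.2).bot : ℝ) ≤ h ∧ h ≤ 2 * ((B.corner k.1 k.2).top : ℝ) + 1) :
    ∃ p : B.Prisms, B.AtCorner k h p := by
  obtain ⟨y, hy⟩ := Code.exists_eq_one k.2
  have hm : B.InPrism (⟨k.1, hk⟩ : Fin B.faces.length) y ((B.corner k.1 k.2).eps * h) := by
    unfold Code.InPrism
    rw [Code.sum_eq_of_eq_one hy (fun i => (B.corner _ i).lo),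
      Code.sum_eq_of_eq_one hy (fun i => (B.corner _ i).hi), Corner.mem_range_iff,
      Corner.eps_mul_cancel]
    exact hh
  exact ⟨Code.pt hm, rfl, hy, Corner.eps_mul_cancel _ _⟩

theorem Code.onSide_src {B : Code} {s : Side} {p : B.Triangles} (hf : (p.1 : ℕ) = s.face)
    (h : p.2 s.src = 1) : B.OnSide s 0 p := by
  have h0 := Code.sum_eq_of_eq_one h (fun j => if j = s.opp then 1 else 0)
  have h1 := Code.sum_eq_of_eq_one h (fun j => if j = s.tgt then 1 else 0)
  simp only [mul_ite, mul_one, mul_zero, Finset.sum_ite_eq', Finset.mem_univ, if_true,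
    s.opp_ne_src.symm, s.src_ne_tgt, if_false] at h0 h1
  exact ⟨hf, h0, by rw [h, sub_zero], h1⟩

theorem Code.onSide_tgt {B : Code} {s : Side} {p : B.Triangles} (hf : (p.1 : ℕ) = s.face)
    (h : p.2 s.tgt = 1) : B.OnSide s 1 p := by
  have h0 := Code.sum_eq_of_eq_one h (fun j => if j = s.opp then 1 else 0)
  have h1 := Code.sum_eq_of_eq_one h (fun j => if j = s.src then 1 else 0)
  simp only [mul_ite, mul_one, mul_zero, Finset.sum_ite_eq', Finset.mem_univ, if_true,
    s.opp_ne_tgt.symm, s.src_ne_tgt.symm, if_false] at h0 h1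
  exact ⟨hf, h0, by rw [h1, sub_self], h⟩

theorem Code.IsBranchedSurface.toNbhd_eq_of_end {B : Code} (hB : B.IsBranchedSurface) {e : Edge}
    (he : e ∈ B.edges) {s s' : Side} (hs : s ∈ e.sides) (hs' : s' ∈ e.sides)
    {end_ : Side → Fin 3} (hend : end_ = Side.src ∨ end_ = Side.tgt) {h : ℝ} {p q : B.Prisms}
    (hp : B.AtCorner (s.face, end_ s) h p) (hq : B.AtCorner (s'.face, end_ s') h q) :
    B.toNbhd p = B.toNbhd q := by
  have hh : B.sign e s * B.height p = B.sign e s' * B.height q := by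
    rw [hB.sign_eq_end he hend hs, hB.sign_eq_end he hend hs', mul_assoc, mul_assoc]
    exact congrArg _ (hp.2.2.trans hq.2.2.symm)
  rcases hend with rfl | rfl
  · exact hB.toNbhd_eq_of_sides he hs hs' (Code.onSide_src hp.1 hp.2.1)
      (Code.onSide_src hq.1 hq.2.1) hh
  · exact hB.toNbhd_eq_of_sides he hs hs' (Code.onSide_tgt hp.1 hp.2.1)
      (Code.onSide_tgt hq.1 hq.2.1) hh

/-- Along a chain of adjacent corners the set of points of `N(B)` seen at height `h` does not
change, provided that every corner of the chain has a point at this height. -/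
theorem Code.IsBranchedSurface.toNbhd_eq_of_connected {B : Code} (hB : B.IsBranchedSurface)
    {K : Set (ℕ × Fin 3)} (hK : B.ConnectedCorners K) {h : ℝ}
    (hh : ∀ k ∈ K, k.1 < B.faces.length ∧ 2 * ((B.corner k.1 k.2).bot : ℝ) ≤ h ∧
      h ≤ 2 * ((B.corner k.1 k.2).top : ℝ) + 1)
    {k l : ℕ × Fin 3} (hk : k ∈ K) (hl : l ∈ K) {p q : B.Prisms} (hp : B.AtCorner k h p)
    (hq : B.AtCorner l h q) : B.toNbhd p = B.toNbhd q := by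
  have key : ∀ e ∈ B.edges, ∀ s ∈ e.small, ∀ end_ : Side → Fin 3,
      (end_ = Side.src ∨ end_ = Side.tgt) →
      (e.whole.face, end_ e.whole) ∈ K → (s.face, end_ s) ∈ K →
      {n | ∃ p, B.AtCorner (e.whole.face, end_ e.whole) h p ∧ B.toNbhd p = n} =
        {n | ∃ p, B.AtCorner (s.face, end_ s) h p ∧ B.toNbhd p = n} := by
    intro e he s hs end_ hend h1 h2
    ext n
    constructor
    · rintro ⟨p, hp, rfl⟩
      obtain ⟨q, hq⟩ := Code.exists_atCorner (hh _ h2).1 (hh _ h2).2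
      exact ⟨q, hq, (hB.toNbhd_eq_of_end he e.whole_mem_sides (Edge.small_mem_sides hs) hend
        hp hq).symm⟩
    · rintro ⟨p, hp, rfl⟩
      obtain ⟨q, hq⟩ := Code.exists_atCorner (hh _ h1).1 (hh _ h1).2
      exact ⟨q, hq, hB.toNbhd_eq_of_end he e.whole_mem_sides (Edge.small_mem_sides hs) hend
        hq hp⟩
  have step : ∀ a b, Relation.EqvGen (fun p q => p ∈ K ∧ q ∈ K ∧ B.AdjCorner p q) a b →
      {n | ∃ p, B.AtCorner a h p ∧ B.toNbhd p = n} =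
        {n | ∃ p, B.AtCorner b h p ∧ B.toNbhd p = n} := by
    intro a b hab
    induction hab with
    | rel a b hab =>
      obtain ⟨ha, hb, e, he, s, hs, ⟨rfl, rfl⟩ | ⟨rfl, rfl⟩⟩ := hab
      · exact key e he s hs Side.src (Or.inl rfl) ha hb
      · exact key e he s hs Side.tgt (Or.inr rfl) ha hb
    | refl => rfl
    | symm a b _ ih => exact ih.symm
    | trans a b c _ _ ih1 ih2 => exact ih1.trans ih2
  have hmem : B.toNbhd p ∈ {n | ∃ p, B.AtCorner l h p ∧ B.toNbhd p = n} :=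
    step k l (hK.2 k hk l hl) ▸ ⟨p, hp, rfl⟩
  obtain ⟨q', hq', hpq⟩ := hmem
  rw [← hpq, hq'.ext hq]

/-- Different layers are at distance at least one, so a height in layer `a` belongs to the range of
the layers `b` to `t` only if layer `a` is one of them. -/
theorem layer_of_nat_height {h : ℝ} {b t : ℕ} (h1 : 2 * (b : ℝ) ≤ h) (h2 : h ≤ 2 * (t : ℝ) + 1)
    {a : ℕ} (ha : 2 * (a : ℝ) ≤ h ∧ h ≤ 2 * (a : ℝ) + 1) : b ≤ a ∧ a ≤ t := by
  constructor
  · by_contra hlt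
    have : (a : ℝ) + 1 ≤ b := by exact_mod_cast not_le.1 hlt
    linarith
  · by_contra hlt
    have : (t : ℝ) + 1 ≤ a := by exact_mod_cast not_le.1 hlt
    linarith

/-- The range of a corner begins and ends with a layer, so it contains a gap height only together
with both neighbouring layers. -/
theorem layer_of_gap_height {h : ℝ} {b t : ℕ} (h1 : 2 * (b : ℝ) ≤ h) (h2 : h ≤ 2 * (t : ℝ) + 1)
    {a : ℕ} (ha : 2 * (a : ℝ) + 1 < h ∧ h < 2 * (a : ℝ) + 2) : b ≤ a ∧ a + 1 ≤ t := by
  constructor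
  · by_contra hlt
    have : (a : ℝ) + 1 ≤ b := by exact_mod_cast not_le.1 hlt
    linarith
  · by_contra hlt
    have : (t : ℝ) ≤ a := by exact_mod_cast Nat.lt_succ_iff.1 (not_le.1 hlt)
    linarith

theorem exists_layer_or_gap {h : ℝ} (h0 : 0 ≤ h) :
    ∃ a : ℕ, (2 * (a : ℝ) ≤ h ∧ h ≤ 2 * (a : ℝ) + 1) ∨
      (2 * (a : ℝ) + 1 < h ∧ h < 2 * (a : ℝ) + 2) := by
  refine ⟨⌊h / 2⌋₊, ?_⟩
  have h1 := Nat.floor_le (a := h / 2) (by positivity)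
  have h2 := Nat.lt_floor_add_one (h / 2)
  by_cases h3 : h ≤ 2 * (⌊h / 2⌋₊ : ℝ) + 1
  · exact Or.inl ⟨by linarith, h3⟩
  · exact Or.inr ⟨by linarith, by linarith⟩

/-- Points over the same vertex and at the same height coincide. -/
theorem Code.IsBranchedSurface.toNbhd_eq_of_atCorner {B : Code} (hB : B.IsBranchedSurface) {h : ℝ}
    {k l : ℕ × Fin 3} (hv : (B.corner k.1 k.2).vertex = (B.corner l.1 l.2).vertex)
    {p q : B.Prisms} (hp : B.AtCorner k h p) (hq : B.AtCorner l h q) :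
    B.toNbhd p = B.toNbhd q := by
  have hk : k.1 < B.faces.length := hp.1 ▸ p.1.2
  have hl : l.1 < B.faces.length := hq.1 ▸ q.1.2
  have hpr := hp.mem_range
  have hqr := hq.mem_range
  have h0 : 0 ≤ h := le_trans (by positivity) hpr.1
  have hfk := hB.corner_fits k.1 hk k.2
  obtain ⟨a, ha | ha⟩ := exists_layer_or_gap h0
  · have h1 := layer_of_nat_height hpr.1 hpr.2 ha
    have h2 := layer_of_nat_height hqr.1 hqr.2 ha
    refine hB.toNbhd_eq_of_connected (hB.layer_disc _ hfk.1 a (lt_of_le_of_lt h1.2 hfk.2.2))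
      (h := h) ?_ (k := k) (l := l) ⟨hk, rfl, h1⟩ ⟨hl, hv.symm, h2⟩ hp hq
    rintro m ⟨hm, -, h3, h4⟩
    have h3' : ((B.corner m.1 m.2).bot : ℝ) ≤ a := by exact_mod_cast h3
    have h4' : (a : ℝ) ≤ (B.corner m.1 m.2).top := by exact_mod_cast h4
    exact ⟨hm, by linarith, by linarith⟩
  -- In a gap only the corners containing both neighbouring layers have a point at this height; it
  -- is these that `cusp` connects.
  · have h1 := layer_of_gap_height hpr.1 hpr.2 ha
    have h2 := layer_of_gap_height hqr.1 hqr.2 ha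
    refine hB.toNbhd_eq_of_connected (hB.cusp _ hfk.1 a (lt_of_le_of_lt h1.2 hfk.2.2)).1
      (h := h) ?_ (k := k) (l := l)
      ⟨⟨hk, rfl, h1.1, by omega⟩, ⟨hk, rfl, by omega, h1.2⟩⟩
      ⟨⟨hl, hv.symm, h2.1, by omega⟩, ⟨hl, hv.symm, by omega, h2.2⟩⟩ hp hq
    rintro m ⟨⟨hm, -, h3, -⟩, -, -, -, h4⟩
    have h3' : ((B.corner m.1 m.2).bot : ℝ) ≤ a := by exact_mod_cast h3
    have h4' : (a : ℝ) + 1 ≤ (B.corner m.1 m.2).top := by exact_mod_cast h4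
    exact ⟨hm, by linarith, by linarith⟩

/-! ### Invariants of glued points -/

/-- An invariant which determines the interior points of the prism number `g`. -/
def Code.faceInv (B : Code) (g : ℕ) (Y : B.Triangles) (η : ℝ) : ℝ × (Fin 3 → ℝ) × ℝ :=
  if (Y.1 : ℕ) = g then
    (Y.2 0 * Y.2 1 * Y.2 2, fun i => Y.2 0 * Y.2 1 * Y.2 2 * Y.2 i, Y.2 0 * Y.2 1 * Y.2 2 * η)
  else 0

/-- The contribution of one side to `Code.edgeInv`. -/
def Code.sideInv (B : Code) (e : Edge) (Y : B.Triangles) (η : ℝ) (s : Side) : ℝ × ℝ × ℝ :=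
  if (Y.1 : ℕ) = s.face then
    (Y.2 s.src * Y.2 s.tgt, Y.2 s.src * Y.2 s.tgt * Y.2 s.tgt,
      Y.2 s.src * Y.2 s.tgt * (B.sign e s * η))
  else 0

/-- An invariant which determines the points over the interior of the edge `e`. -/
def Code.edgeInv (B : Code) (e : Edge) (Y : B.Triangles) (η : ℝ) : ℝ × ℝ × ℝ :=
  (e.sides.map (B.sideInv e Y η)).sum

/-- An invariant which determines the points over the vertex `v`. -/
def Code.vertexInv (B : Code) (v : ℕ) (Y : B.Triangles) (η : ℝ) : ℝ × ℝ :=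
  ∑ i, if (B.corner Y.1 i).vertex = v then (Y.2 i, Y.2 i * ((B.corner Y.1 i).eps * η)) else 0

/-- The weight is the product of the three barycentric coordinates, which vanishes on the sides.
This makes the extension by zero to the other triangles compatible with the gluing. -/
theorem Code.OnSide.faceInv {B : Code} {s : Side} {t : ℝ} {Y : B.Triangles} (h : B.OnSide s t Y)
    (g : ℕ) (η : ℝ) : B.faceInv g Y η = 0 := by
  have h0 : Y.2 0 * Y.2 1 * Y.2 2 = 0 := by
    have := h.2.1
    generalize s.opp = i at this
    fin_cases i
    · change Y.2 0 = 0 at this; rw [this]; ring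
    · change Y.2 1 = 0 at this; rw [this]; ring
    · change Y.2 2 = 0 at this; rw [this]; ring
  unfold Code.faceInv
  rw [h0]
  simp only [zero_mul]
  split_ifs <;> rfl

open Classical in
-- Only one summand survives: the weight of any other side of the same triangle contains the
-- coordinate which vanishes on `s`. The remaining value depends only on the parameter and on the
-- height as seen from `whole`, so it agrees for all sides glued at the edge.
theorem Code.IsBranchedSurface.edgeInv_of_onSide {B : Code} (hB : B.IsBranchedSurface) {e e' : Edge}
    (he : e ∈ B.edges) (he' : e' ∈ B.edges) {s : Side} (hs : s ∈ e.sides) {t : ℝ}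
    {Y : B.Triangles} (h : B.OnSide s t Y) (η : ℝ) :
    B.edgeInv e' Y η = if e = e' then
      ((1 - t) * t, (1 - t) * t * t, (1 - t) * t * (B.sign e s * η)) else 0 := by
  have hzero : ∀ s' ∈ e'.sides, s' ≠ s → B.sideInv e' Y η s' = 0 := by
    intro s' hs' hne
    unfold Code.sideInv
    split_ifs with hf
    · have ho : s'.opp ≠ s.opp := by
        intro ho
        exact hne (hB.side_unique he' he hs' hs (hf.symm.trans h.1) ho).2
      have : Y.2 s'.src * Y.2 s'.tgt = 0 := by
        rcases Side.opp_eq_src_or_tgt ho with h' | h'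
        · rw [← h', h.2.1, zero_mul]
        · rw [← h', h.2.1, mul_zero]
      rw [this]
      simp
    · rfl
  unfold Code.edgeInv
  split_ifs with hee
  · subst hee
    rw [List.sum_map_eq_nsmul_single s _ fun s' h1 h2 => hzero s' h2 h1,
      List.count_eq_one_of_mem (hB.sides_nodup' he) hs, one_smul]
    unfold Code.sideInv
    rw [if_pos h.1, h.2.2.1, h.2.2.2]
  · refine List.sum_eq_zero fun x hx => ?_
    obtain ⟨s', hs', rfl⟩ := List.mem_map.1 hx
    refine hzero s' hs' ?_
    rintro rfl
    exact hee (hB.side_unique he he' hs hs' rfl rfl).1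

/-- The opposite corner has weight zero. At the two ends the flips compare in the same way, so the
value can be written in terms of `whole` and of the height as seen from there. -/
theorem Code.IsBranchedSurface.vertexInv_of_onSide {B : Code} (hB : B.IsBranchedSurface) {e : Edge}
    (he : e ∈ B.edges) {s : Side} (hs : s ∈ e.sides) {t : ℝ}
    {Y : B.Triangles} (h : B.OnSide s t Y) (v : ℕ) (η : ℝ) :
    B.vertexInv v Y η =
      (if (B.corner e.whole.face e.whole.src).vertex = v then
        (1 - t, (1 - t) * ((B.corner e.whole.face e.whole.src).eps * (B.sign e s * η))) else 0) +
      (if (B.corner e.whole.face e.whole.tgt).vertex = v then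
        (t, t * ((B.corner e.whole.face e.whole.tgt).eps * (B.sign e s * η))) else 0) := by
  unfold Code.vertexInv
  rw [s.sum_eq, h.2.1, h.2.2.1, h.2.2.2, h.1, hB.vertex_end he (Or.inl rfl) hs,
    hB.vertex_end he (Or.inr rfl) hs]
  conv_rhs => rw [hB.sign_eq_end he (Or.inl rfl) hs]
  have := hB.sign_eq_end he (Or.inl rfl) hs
  rw [hB.sign_eq_end he (Or.inr rfl) hs] at this
  rw [← mul_assoc (B.corner e.whole.face e.whole.src).eps,
    ← mul_assoc (B.corner e.whole.face e.whole.src).eps, Corner.eps_mul_eps, one_mul,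
    ← this, ← mul_assoc (B.corner e.whole.face e.whole.tgt).eps,
    ← mul_assoc (B.corner e.whole.face e.whole.tgt).eps, Corner.eps_mul_eps, one_mul]
  have hz : (if (B.corner s.face s.opp).vertex = v then
      ((0 : ℝ), 0 * ((B.corner s.face s.opp).eps * η)) else 0) = 0 := by
    rw [zero_mul]; split_ifs <;> rfl
  rw [hz, zero_add]

/-- The invariants together. -/
def Code.inv (B : Code) (Y : B.Triangles) (η : ℝ) :
    (ℕ → ℝ × (Fin 3 → ℝ) × ℝ) × ({e // e ∈ B.edges} → ℝ × ℝ × ℝ) × (ℕ → ℝ × ℝ) :=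
  (fun g => B.faceInv g Y η, fun e => B.edgeInv e Y η, fun v => B.vertexInv v Y η)

theorem Code.IsBranchedSurface.inv_eq {B : Code} (hB : B.IsBranchedSurface) {e : Edge}
    (he : e ∈ B.edges) {s s' : Side} (hs : s ∈ e.sides) (hs' : s' ∈ e.sides) {t : ℝ}
    {Y Z : B.Triangles} (hY : B.OnSide s t Y) (hZ : B.OnSide s' t Z) {η θ : ℝ}
    (h : B.sign e s * η = B.sign e s' * θ) : B.inv Y η = B.inv Z θ := by
  unfold Code.inv
  refine Prod.ext ?_ (Prod.ext ?_ ?_)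
  · funext g
    simp only [hY.faceInv, hZ.faceInv]
  · funext e'
    simp only [hB.edgeInv_of_onSide he e'.2 hs hY, hB.edgeInv_of_onSide he e'.2 hs' hZ, h]
  · funext v
    simp only [hB.vertexInv_of_onSide he hs hY, hB.vertexInv_of_onSide he hs' hZ, h]

/-- Points of the disjoint union of the triangles with the same invariants: they are equal, or they
lie at the same point of an edge, or at corners at the same vertex. -/
theorem Code.IsBranchedSurface.cases_of_inv_eq {B : Code} (hB : B.IsBranchedSurface)
    {Y Z : B.Triangles} {η θ : ℝ} (h : B.inv Y η = B.inv Z θ) :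
    (Y = Z ∧ η = θ) ∨
    (∃ e ∈ B.edges, ∃ s ∈ e.sides, ∃ s' ∈ e.sides, ∃ t : ℝ, 0 < t ∧ t < 1 ∧ B.OnSide s t Y ∧
      B.OnSide s' t Z ∧ B.sign e s * η = B.sign e s' * θ) ∨
    (∃ i j, Y.2 i = 1 ∧ Z.2 j = 1 ∧ (B.corner Y.1 i).vertex = (B.corner Z.1 j).vertex ∧
      (B.corner Y.1 i).eps * η = (B.corner Z.1 j).eps * θ) := by
  have hF : ∀ g, B.faceInv g Y η = B.faceInv g Z θ := fun g => congrFun (congrArg Prod.fst h) g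
  have hE : ∀ e ∈ B.edges, B.edgeInv e Y η = B.edgeInv e Z θ := fun e he =>
    congrFun (congrArg (fun x => x.2.1) h) ⟨e, he⟩
  have hV : ∀ v, B.vertexInv v Y η = B.vertexInv v Z θ := fun v =>
    congrFun (congrArg (fun x => x.2.2) h) v
  have hside : ∀ W : B.Triangles, W.2 0 * W.2 1 * W.2 2 = 0 →
      ∃ e ∈ B.edges, ∃ s ∈ e.sides, ∃ t, B.OnSide s t W := by
    intro W hW
    have : ∃ i, W.2 i = 0 := by
      rcases mul_eq_zero.1 hW with hW | hW
      · rcases mul_eq_zero.1 hW with hW | hW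
        · exact ⟨0, hW⟩
        · exact ⟨1, hW⟩
      · exact ⟨2, hW⟩
    obtain ⟨i, hi⟩ := this
    obtain ⟨e, he, s, hs, hsf, rfl⟩ := hB.exists_side W.1.2 i
    exact ⟨e, he, s, hs, _, Code.onSide_of_opp_eq_zero hsf.symm hi⟩
  -- In the interior of a triangle the weight is nonzero, and dividing by it recovers the point and
  -- the height.
  have hint : ∀ (W W' : B.Triangles) (η θ : ℝ), (∀ g, B.faceInv g W η = B.faceInv g W' θ) →
      W.2 0 * W.2 1 * W.2 2 ≠ 0 → W = W' ∧ η = θ := by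
    intro W W' η θ hF hW
    have h1 := hF W.1
    unfold Code.faceInv at h1
    rw [if_pos rfl] at h1
    split_ifs at h1 with hf
    · obtain ⟨h2, h3, h4⟩ := Prod.mk.inj h1 |>.imp id Prod.mk.inj
      rw [← h2] at h3 h4
      have hη := mul_left_cancel₀ hW h4
      refine ⟨?_, hη⟩
      refine Sigma.ext (Fin.ext hf.symm) (heq_of_eq ?_)
      ext i
      exact mul_left_cancel₀ hW (congrFun h3 i)
    · exact absurd (congrArg Prod.fst h1) hW
  by_cases hY : Y.2 0 * Y.2 1 * Y.2 2 = 0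
  swap
  · exact Or.inl (hint Y Z η θ hF hY)
  by_cases hZ : Z.2 0 * Z.2 1 * Z.2 2 = 0
  swap
  · have := hint Z Y θ η (fun g => (hF g).symm) hZ
    exact Or.inl ⟨this.1.symm, this.2.symm⟩
  right
  obtain ⟨e, he, s, hs, t, ht⟩ := hside Y hY
  obtain ⟨e', he', s', hs', t', ht'⟩ := hside Z hZ
  by_cases h0 : (1 - t) * t = 0
  · right
    have h0' : (1 - t') * t' = 0 := by
      have := hE e' he'
      rw [hB.edgeInv_of_onSide he he' hs ht, hB.edgeInv_of_onSide he' he' hs' ht', if_pos rfl,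
        h0] at this
      have := congrArg Prod.fst this
      simp only at this
      rw [← this]
      split_ifs <;> rfl
    have hcor : ∀ (s : Side) (t : ℝ) (W : B.Triangles), B.OnSide s t W → (1 - t) * t = 0 →
        ∃ i, W.2 i = 1 := by
      intro s t W hW h0
      rcases mul_eq_zero.1 h0 with h | h
      · exact ⟨s.tgt, by rw [hW.2.2.2]; linarith⟩
      · exact ⟨s.src, by rw [hW.2.2.1]; linarith⟩
    obtain ⟨i, hi⟩ := hcor s t Y ht h0
    obtain ⟨j, hj⟩ := hcor s' t' Z ht' h0'
    -- At a corner the vertex invariant has a single term, and its first component is `1` exactly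
    -- for the vertex of that corner.
    have hval : ∀ (W : B.Triangles) (i : Fin 3) (η : ℝ) (v : ℕ), W.2 i = 1 → B.vertexInv v W η =
        if (B.corner W.1 i).vertex = v then (1, (B.corner W.1 i).eps * η) else 0 := by
      intro W i η v hi
      have h1 := Code.sum_eq_of_eq_one hi
        (fun i => if (B.corner W.1 i).vertex = v then (1 : ℝ) else 0)
      have h2 := Code.sum_eq_of_eq_one hi
        (fun i => if (B.corner W.1 i).vertex = v then (B.corner W.1 i).eps * η else 0)
      simp only [mul_ite, mul_one, mul_zero] at h1 h2
      have hdist : ∀ (c : Prop) [Decidable c] (a b : ℝ), (if c then (a, b) else 0) =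
          ((if c then a else 0), (if c then b else 0)) := by
        intro c _ a b; split_ifs <;> rfl
      unfold Code.vertexInv
      simp only [hdist]
      refine Prod.ext ?_ ?_
      · rw [Prod.fst_sum]; exact h1
      · rw [Prod.snd_sum]; exact h2
    refine ⟨i, j, hi, hj, ?_⟩
    have := hV (B.corner Y.1 i).vertex
    rw [hval Y i η _ hi, hval Z j θ _ hj, if_pos rfl] at this
    split_ifs at this with hv
    · exact ⟨hv.symm, (Prod.mk.inj this).2⟩
    · exact absurd (congrArg Prod.fst this) one_ne_zero
  · left
    have h1 := hE e he
    rw [hB.edgeInv_of_onSide he he hs ht, hB.edgeInv_of_onSide he' he hs' ht', if_pos rfl] at h1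
    split_ifs at h1 with hee
    · subst hee
      obtain ⟨h2, h3, h4⟩ := Prod.mk.inj h1 |>.imp id Prod.mk.inj
      rw [← h2] at h3 h4
      have htt := mul_left_cancel₀ h0 h3
      subst htt
      have hη := mul_left_cancel₀ h0 h4
      have hn := ht.nonneg
      have hl := ht.le_one
      refine ⟨e', he, s, hs, s', hs', t, lt_of_le_of_ne hn ?_, lt_of_le_of_ne hl ?_, ht, ht', hη⟩
      · rintro rfl; simp at h0
      · rintro rfl; simp at h0
    · exact absurd (congrArg Prod.fst h1) h0

/-- Continuity is proved for arbitrary heights, so that restriction to the prisms serves `N(B)` and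
the height zero serves the branched surface itself. -/
theorem Code.continuous_inv (B : Code) :
    Continuous fun x : Σ _ : Fin B.faces.length, stdSimplex ℝ (Fin 3) × ℝ =>
      B.inv ⟨x.1, x.2.1⟩ x.2.2 := by
  have hb : ∀ i : Fin 3, Continuous fun z : stdSimplex ℝ (Fin 3) × ℝ => z.1 i := fun i =>
    (continuous_barycentric i).comp continuous_fst
  refine continuous_sigma fun f => ?_
  unfold Code.inv
  refine Continuous.prodMk ?_ (Continuous.prodMk ?_ ?_)
  · refine continuous_pi fun g => ?_
    unfold Code.faceInv
    dsimp only
    split_ifs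
    · have h0 := hb 0
      have h1 := hb 1
      have h2 := hb 2
      have hc : Continuous fun z : stdSimplex ℝ (Fin 3) × ℝ => z.1 0 * z.1 1 * z.1 2 :=
        (h0.mul h1).mul h2
      exact hc.prodMk ((continuous_pi fun i => hc.mul (hb i)).prodMk (hc.mul continuous_snd))
    · exact continuous_const
  · refine continuous_pi fun e => ?_
    unfold Code.edgeInv
    refine continuous_list_sum (f := fun s (z : stdSimplex ℝ (Fin 3) × ℝ) => B.sideInv e.1 ⟨f, z.1⟩ z.2 s) _ fun s _ => ?_
    unfold Code.sideInv
    dsimp only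
    split_ifs
    · have hc : Continuous fun z : stdSimplex ℝ (Fin 3) × ℝ => z.1 s.src * z.1 s.tgt :=
        (hb _).mul (hb _)
      exact hc.prodMk ((hc.mul (hb _)).prodMk (hc.mul (continuous_const.mul continuous_snd)))
    · exact continuous_const
  · refine continuous_pi fun v => ?_
    unfold Code.vertexInv
    refine continuous_finsetSum _ fun i _ => ?_
    dsimp only
    split_ifs
    · exact (hb i).prodMk ((hb i).mul (continuous_const.mul continuous_snd))
    · exact continuous_const

/-! ### Separation -/

namespace Code.IsBranchedSurface

variable {B : Code} (hB : B.IsBranchedSurface)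
include hB

theorem inv_eq_of_toNbhd {p q : B.Prisms} (h : B.toNbhd p = B.toNbhd q) :
    B.inv (B.foot p) (B.height p) = B.inv (B.foot q) (B.height q) := by
  refine congrArg (Quot.lift (fun p : B.Prisms => B.inv (B.foot p) (B.height p)) ?_) h
  rintro p q ⟨e, he, s, hs, ⟨t, hp, hq⟩, hh⟩
  refine hB.inv_eq he e.whole_mem_sides (Edge.small_mem_sides hs) hp hq ?_
  rw [Code.sign_whole, one_mul, hh, ← mul_assoc, Code.sign_mul_sign, one_mul]

/-- The invariants are constant on gluing classes and separate them. This replaces any analysis of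
chains of gluings, and it also yields the Hausdorff property. -/
theorem toNbhd_eq_iff {p q : B.Prisms} : B.toNbhd p = B.toNbhd q ↔
    B.inv (B.foot p) (B.height p) = B.inv (B.foot q) (B.height q) := by
  refine ⟨hB.inv_eq_of_toNbhd, fun h => ?_⟩
  rcases hB.cases_of_inv_eq h with h | ⟨e, he, s, hs, s', hs', t, -, -, hp, hq, hh⟩ |
    ⟨i, j, hi, hj, hv, hh⟩
  · rw [Code.Prisms.ext h.1 h.2]
  · exact hB.toNbhd_eq_of_sides he hs hs' hp hq hh
  · exact hB.toNbhd_eq_of_atCorner (k := (p.1, i)) (l := (q.1, j)) hv ⟨rfl, hi, rfl⟩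
      ⟨rfl, hj, hh.symm⟩

theorem inv_eq_of_toSurface {Y Z : B.Triangles} (h : B.toSurface Y = B.toSurface Z) :
    B.inv Y 0 = B.inv Z 0 := by
  refine congrArg (Quot.lift (fun Y : B.Triangles => B.inv Y 0) ?_) h
  rintro p q ⟨e, he, s, hs, ⟨t, hp, hq⟩⟩
  exact hB.inv_eq he e.whole_mem_sides (Edge.small_mem_sides hs) hp hq (by simp)

/-- When two points of triangles are glued. -/
theorem cases_of_toSurface_eq {Y Z : B.Triangles} (h : B.toSurface Y = B.toSurface Z) :
    Y = Z ∨
    (∃ e ∈ B.edges, ∃ s ∈ e.sides, ∃ s' ∈ e.sides, ∃ t : ℝ, 0 < t ∧ t < 1 ∧ B.OnSide s t Y ∧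
      B.OnSide s' t Z) ∨
    (∃ i j, Y.2 i = 1 ∧ Z.2 j = 1 ∧ (B.corner Y.1 i).vertex = (B.corner Z.1 j).vertex) := by
  rcases hB.cases_of_inv_eq (hB.inv_eq_of_toSurface h) with h | ⟨e, he, s, hs, s', hs', t, h0, h1,
    hp, hq, -⟩ | ⟨i, j, hi, hj, hv, -⟩
  · exact Or.inl h.1
  · exact Or.inr (Or.inl ⟨e, he, s, hs, s', hs', t, h0, h1, hp, hq⟩)
  · exact Or.inr (Or.inr ⟨i, j, hi, hj, hv⟩)

theorem toSurface_eq_of_sides {e : Edge} (he : e ∈ B.edges) {s s' : Side} (hs : s ∈ e.sides)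
    (hs' : s' ∈ e.sides) {t : ℝ} {Y Z : B.Triangles} (hY : B.OnSide s t Y) (hZ : B.OnSide s' t Z) :
    B.toSurface Y = B.toSurface Z := by
  obtain ⟨X, hX⟩ := Code.exists_onSide (hB.face_lt he e.whole_mem_sides) hY.nonneg hY.le_one
  have key : ∀ s ∈ e.sides, ∀ Y, B.OnSide s t Y → B.toSurface X = B.toSurface Y := by
    intro s hs Y hY
    rcases Edge.mem_sides_iff.1 hs with rfl | hs
    · rw [hX.ext hY]
    · exact Code.toSurface_eq_of_glueBase he hs ⟨t, hX, hY⟩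
  exact (key s hs Y hY).symm.trans (key s' hs' Z hZ)

/-- Over a point of a triangle, a point of `N(B)` occurs at most once. -/
theorem height_eq_of_toNbhd_eq {p q : B.Prisms} (h : B.toNbhd p = B.toNbhd q)
    (hf : B.foot p = B.foot q) : B.height p = B.height q := by
  rcases hB.cases_of_inv_eq (hB.inv_eq_of_toNbhd h) with h | ⟨e, he, s, hs, s', hs', t, h0, h1, hp,
    hq, hh⟩ | ⟨i, j, hi, hj, hv, hh⟩
  · exact h.2
  · have hss : s = s' := by
      rw [hf] at hp
      by_contra hne
      have ho : s'.opp ≠ s.opp := by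
        intro ho
        exact hne (hB.side_unique he he hs hs' (hp.1.symm.trans hq.1) ho.symm).2
      rcases Side.opp_eq_src_or_tgt ho with h' | h'
      · have := hq.2.2.1
        rw [← h', hp.2.1] at this
        linarith
      · have := hq.2.2.2
        rw [← h', hp.2.1] at this
        linarith
    subst hss
    have hne : B.sign e s ≠ 0 := by
      intro h0
      have := B.sign_mul_sign e s
      rw [h0] at this
      simp at this
    exact mul_left_cancel₀ hne hh
  · rw [hf] at hi hh
    have hij : i = j := by
      by_contra hne
      have := Code.sum_eq_of_eq_one hi (fun k => if k = j then 1 else 0)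
      simp only [mul_ite, mul_one, mul_zero, Finset.sum_ite_eq', Finset.mem_univ, if_true,
        hne, if_false] at this
      rw [hj] at this
      exact one_ne_zero this
    subst hij
    exact mul_left_cancel₀ (Corner.eps_ne_zero _) hh

omit hB in
theorem continuous_toNbhd : Continuous B.toNbhd := continuous_quot_mk

omit hB in
theorem continuous_toSurface : Continuous B.toSurface := continuous_quot_mk

/-- All corners at one vertex are glued together in the branched surface. -/
theorem toSurface_eq_of_vertex {Y Z : B.Triangles} {i j : Fin 3} (hi : Y.2 i = 1) (hj : Z.2 j = 1)
    (hv : (B.corner Y.1 i).vertex = (B.corner Z.1 j).vertex) :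
    B.toSurface Y = B.toSurface Z := by
  have same : ∀ (a : ℕ) (Y Z : B.Triangles) (i j : Fin 3), Y.2 i = 1 → Z.2 j = 1 → ∀ v,
      B.HasLayer v a (Y.1, i) → B.HasLayer v a (Z.1, j) → B.toSurface Y = B.toSurface Z := by
    rintro a Y Z i j hi hj v ⟨h1, h2, h3, h4⟩ ⟨h5, h6, h7, h8⟩
    have c3 : ((B.corner Y.1 i).bot : ℝ) ≤ a := by exact_mod_cast h3
    have c4 : (a : ℝ) ≤ (B.corner Y.1 i).top := by exact_mod_cast h4
    have c7 : ((B.corner Z.1 j).bot : ℝ) ≤ a := by exact_mod_cast h7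
    have c8 : (a : ℝ) ≤ (B.corner Z.1 j).top := by exact_mod_cast h8
    obtain ⟨p, hp⟩ := Code.exists_atCorner (k := (Y.1, i)) h1 (h := 2 * a)
      ⟨by dsimp only; linarith, by dsimp only; linarith⟩
    obtain ⟨q, hq⟩ := Code.exists_atCorner (k := (Z.1, j)) h5 (h := 2 * a)
      ⟨by dsimp only; linarith, by dsimp only; linarith⟩
    have hpY : B.foot p = Y :=
      Sigma.ext (Fin.ext hp.1) (heq_of_eq (Code.eq_of_eq_one hp.2.1 hi))
    have hqZ : B.foot q = Z :=
      Sigma.ext (Fin.ext hq.1) (heq_of_eq (Code.eq_of_eq_one hq.2.1 hj))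
    have := congrArg B.proj (hB.toNbhd_eq_of_atCorner (h2.trans h6.symm) hp hq)
    rwa [Code.proj_toNbhd, Code.proj_toNbhd, hpY, hqZ] at this
  -- Corners without a common layer are joined by climbing one layer at a time: by `cusp` some
  -- corner contains both of two consecutive layers.
  have up : ∀ (d a : ℕ) (Y Z : B.Triangles) (i j : Fin 3), Y.2 i = 1 → Z.2 j = 1 → ∀ v,
      B.HasLayer v a (Y.1, i) → B.HasLayer v (a + d) (Z.1, j) →
        B.toSurface Y = B.toSurface Z := by
    intro d
    induction d with
    | zero => exact same
    | succ d ih =>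
      intro a Y Z i j hi hj v hY hZ
      have hf := hB.corner_fits Z.1 Z.1.2 j
      rw [hZ.2.1] at hf
      obtain ⟨m, hm1, hm2⟩ := (hB.cusp v hf.1 a (lt_of_le_of_lt
        (le_trans (by omega) hZ.2.2.2) hf.2.2)).1.1
      obtain ⟨y, hy⟩ := Code.exists_eq_one m.2
      refine (same a Y ⟨⟨m.1, hm1.1⟩, y⟩ i m.2 hi hy v hY hm1).trans
        (ih (a + 1) ⟨⟨m.1, hm1.1⟩, y⟩ Z m.2 j hy hj v hm2 ?_)
      rwa [show a + 1 + d = a + (d + 1) by omega]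
  have hY := hB.corner_fits Y.1 Y.1.2 i
  have hZ := hB.corner_fits Z.1 Z.1.2 j
  rcases le_total (B.corner Y.1 i).bot (B.corner Z.1 j).bot with h | h
  · obtain ⟨d, hd⟩ := Nat.exists_eq_add_of_le h
    exact up d _ Y Z i j hi hj _ ⟨Y.1.2, rfl, le_rfl, hY.2.1⟩
      ⟨Z.1.2, hv.symm, hd.le, hd ▸ hZ.2.1⟩
  · obtain ⟨d, hd⟩ := Nat.exists_eq_add_of_le h
    exact (up d _ Z Y j i hj hi _ ⟨Z.1.2, rfl, le_rfl, hZ.2.1⟩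
      ⟨Y.1.2, hv, hd.le, hd ▸ hY.2.1⟩).symm

theorem t2Space_nbhd : T2Space B.Nbhd := by
  let F : B.Nbhd → _ := Quot.lift (fun p : B.Prisms => B.inv (B.foot p) (B.height p))
    fun p q hpq => hB.inv_eq_of_toNbhd (Quot.sound hpq)
  refine T2Space.of_injective_continuous (f := F) ?_ ?_
  · intro m n
    obtain ⟨p, rfl⟩ := Quot.exists_rep m
    obtain ⟨q, rfl⟩ := Quot.exists_rep n
    exact fun h => hB.toNbhd_eq_iff.2 h
  · refine continuous_quot_lift _ (continuous_sigma fun f => ?_)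
    exact B.continuous_inv.comp (continuous_sigmaMk (i := f).comp continuous_subtype_val)

theorem t2Space_surface : T2Space B.Surface := by
  let F : B.Surface → _ := Quot.lift (fun Y : B.Triangles => B.inv Y 0)
    fun p q hpq => hB.inv_eq_of_toSurface (Quot.sound hpq)
  refine T2Space.of_injective_continuous (f := F) ?_ ?_
  · intro m n
    obtain ⟨Y, rfl⟩ := Quot.exists_rep m
    obtain ⟨Z, rfl⟩ := Quot.exists_rep n
    intro h
    change B.toSurface Y = B.toSurface Z
    rcases hB.cases_of_inv_eq h with h | ⟨e, he, s, hs, s', hs', t, -, -, hp, hq, hh⟩ |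
      ⟨i, j, hi, hj, hv, -⟩
    · rw [h.1]
    · exact hB.toSurface_eq_of_sides he hs hs' hp hq
    · exact hB.toSurface_eq_of_vertex hi hj hv
  · refine continuous_quot_lift _ (continuous_sigma fun f => ?_)
    exact B.continuous_inv.comp (continuous_sigmaMk (i := f).comp
      (continuous_id.prodMk continuous_const))

end Code.IsBranchedSurface

/-! ### Plaque systems -/

/-- A lamination whose plaques over the triangles are affine, given by the heights of its plaques
over the corners (measured upwards with respect to the triangle) and by the heights of its points
over the vertices. -/
structure PlaqueSystem (B : Code) where
  pts : ℕ → Set ℝ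
  plaques : ℕ → Set (Fin 3 → ℝ)
  isCompact_plaques : ∀ f < B.faces.length, IsCompact (plaques f)
  -- No point lies in a gap; this will keep the plaques out of the cusps.
  exists_layer : ∀ v, ∀ h ∈ pts v, ∃ a : ℕ, 2 * (a : ℝ) ≤ h ∧ h ≤ 2 * (a : ℝ) + 1
  lt_of_lt : ∀ f < B.faces.length, ∀ g ∈ plaques f, ∀ g' ∈ plaques f, ∀ i j, g i < g' i → g j < g' j
  -- Together with the order condition this puts the plaques over a triangle in bijection with the
  -- points over each of its corners.
  exists_plaque_iff : ∀ f < B.faces.length, ∀ i h,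
    (∃ g ∈ plaques f, (B.corner f i).eps * g i = h) ↔ h ∈ pts (B.corner f i).vertex ∧
      2 * ((B.corner f i).bot : ℝ) ≤ h ∧ h ≤ 2 * ((B.corner f i).top : ℝ) + 1
  -- Only continuation from a sheet into `whole` is demanded; continuation the other way follows.
  exists_whole : ∀ e ∈ B.edges, ∀ s ∈ e.small, ∀ g ∈ plaques s.face, ∃ g' ∈ plaques e.whole.face,
    g' e.whole.src = B.sign e s * g s.src ∧ g' e.whole.tgt = B.sign e s * g s.tgt

namespace PlaqueSystem

variable {B : Code} (P : PlaqueSystem B) {f : ℕ} (hf : f < B.faces.length) {g g' : Fin 3 → ℝ}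
include hf

theorem mem_pts (hg : g ∈ P.plaques f) (i : Fin 3) :
    (B.corner f i).eps * g i ∈ P.pts (B.corner f i).vertex :=
  ((P.exists_plaque_iff f hf i _).1 ⟨g, hg, rfl⟩).1

theorem mem_range (hg : g ∈ P.plaques f) (i : Fin 3) :
    (B.corner f i).lo ≤ g i ∧ g i ≤ (B.corner f i).hi :=
  (Corner.mem_range_iff _ _).2 ((P.exists_plaque_iff f hf i _).1 ⟨g, hg, rfl⟩).2

theorem lt_iff_lt (hg : g ∈ P.plaques f) (hg' : g' ∈ P.plaques f) (i j : Fin 3) :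
    g i < g' i ↔ g j < g' j :=
  ⟨P.lt_of_lt f hf g hg g' hg' i j, P.lt_of_lt f hf g hg g' hg' j i⟩

theorem ext_corner (hg : g ∈ P.plaques f) (hg' : g' ∈ P.plaques f) {i : Fin 3} (h : g i = g' i) :
    g = g' := by
  funext j
  rcases lt_trichotomy (g j) (g' j) with h1 | h1 | h1
  · exact absurd h (P.lt_of_lt f hf g hg g' hg' j i h1).ne
  · exact h1
  · exact absurd h (P.lt_of_lt f hf g' hg' g hg j i h1).ne'

theorem sum_lt_sum (hg : g ∈ P.plaques f) (hg' : g' ∈ P.plaques f) (y : stdSimplex ℝ (Fin 3))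
    {i : Fin 3} (h : g i < g' i) : ∑ j, y j * g j < ∑ j, y j * g' j := by
  have hlt : ∀ j, g j < g' j := fun j => P.lt_of_lt f hf g hg g' hg' i j h
  refine Finset.sum_lt_sum (fun j _ => mul_le_mul_of_nonneg_left (hlt j).le
    (barycentric_nonneg y j)) ?_
  by_contra hcon
  push Not at hcon
  have hz : ∀ j, y j = 0 := by
    intro j
    by_contra hne
    have hpos : 0 < y j := lt_of_le_of_ne (barycentric_nonneg y j) (Ne.symm hne)
    exact absurd (hcon j (Finset.mem_univ j)) (not_le.2 (mul_lt_mul_of_pos_left (hlt j) hpos))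
  have := barycentric_sum y
  rw [hz, hz, hz] at this
  norm_num at this

theorem ext_sum (hg : g ∈ P.plaques f) (hg' : g' ∈ P.plaques f) {y : stdSimplex ℝ (Fin 3)}
    (h : ∑ j, y j * g j = ∑ j, y j * g' j) : g = g' := by
  rcases lt_trichotomy (g 0) (g' 0) with h1 | h1 | h1
  · exact absurd h (P.sum_lt_sum hf hg hg' y h1).ne
  · exact P.ext_corner hf hg hg' h1
  · exact absurd h (P.sum_lt_sum hf hg' hg y h1).ne'

omit hf

theorem exists_whole' {e : Edge} (he : e ∈ B.edges) {s : Side} (hs : s ∈ e.sides)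
    (hg : g ∈ P.plaques s.face) : ∃ g' ∈ P.plaques e.whole.face,
    g' e.whole.src = B.sign e s * g s.src ∧ g' e.whole.tgt = B.sign e s * g s.tgt := by
  rcases Edge.mem_sides_iff.1 hs with rfl | hs
  · exact ⟨g, hg, by rw [Code.sign_whole, one_mul], by rw [Code.sign_whole, one_mul]⟩
  · exact P.exists_whole e he s hs g hg

/-- Over the first end of the edge the plaque passes through a layer, not through a gap, and this
layer belongs to one of the sheets. The plaque of that sheet through the point continues into
`whole`, where it coincides with `g` because a plaque is determined by one corner. -/
theorem exists_small (hB : B.IsBranchedSurface) {e : Edge} (he : e ∈ B.edges)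
    (hg : g ∈ P.plaques e.whole.face) : ∃ s ∈ e.small, ∃ g' ∈ P.plaques s.face,
      g e.whole.src = B.sign e s * g' s.src ∧ g e.whole.tgt = B.sign e s * g' s.tgt := by
  have hw := hB.face_lt he e.whole_mem_sides
  have hp := P.mem_pts hw hg e.whole.src
  obtain ⟨a, ha⟩ := P.exists_layer _ _ hp
  have hr := (Corner.mem_range_iff _ _).1 (P.mem_range hw hg e.whole.src)
  have hl := layer_of_nat_height hr.1 hr.2 ha
  obtain ⟨s, hs, h1, h2⟩ := hB.exists_small he (Or.inl rfl) hl.1 hl.2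
  have h1' : ((B.corner s.face s.src).bot : ℝ) ≤ a := by exact_mod_cast h1
  have h2' : (a : ℝ) ≤ (B.corner s.face s.src).top := by exact_mod_cast h2
  have hss := Edge.small_mem_sides hs
  have hsf := hB.face_lt he hss
  obtain ⟨g', hg', hgg⟩ := (P.exists_plaque_iff s.face hsf s.src _).2
    ⟨(hB.vertex_end he (Or.inl rfl) hss).symm ▸ hp, by linarith, by linarith⟩
  obtain ⟨g₁, hg₁, h3, h4⟩ := P.exists_whole e he s hs g' hg'
  have : g₁ = g := by
    refine P.ext_corner hw hg₁ hg (i := e.whole.src) ?_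
    rw [h3, hB.sign_eq_end he (Or.inl rfl) hss, mul_assoc, hgg, Corner.eps_mul_cancel]
  subst this
  exact ⟨s, hs, g', hg', h3, h4⟩

/-- Plaques on two sides of an edge have the same heights over both ends of the edge. -/
def Match (B : Code) (s s' : Side) (g g' : Fin 3 → ℝ) : Prop :=
  ∀ end_ : Side → Fin 3, (end_ = Side.src ∨ end_ = Side.tgt) →
    (B.corner s.face (end_ s)).eps * g (end_ s) = (B.corner s'.face (end_ s')).eps * g' (end_ s')

theorem match_whole (hB : B.IsBranchedSurface) {e : Edge} (he : e ∈ B.edges) {s : Side}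
    (hs : s ∈ e.sides) (h1 : g' e.whole.src = B.sign e s * g s.src)
    (h2 : g' e.whole.tgt = B.sign e s * g s.tgt) : Match B s e.whole g g' := by
  intro end_ hend
  have h : g' (end_ e.whole) = B.sign e s * g (end_ s) := by
    rcases hend with rfl | rfl
    · exact h1
    · exact h2
  rw [h, hB.sign_eq_end he hend hs, mul_assoc, Corner.eps_mul_cancel]

theorem exists_match_whole (hB : B.IsBranchedSurface) {e : Edge} (he : e ∈ B.edges) {s : Side}
    (hs : s ∈ e.sides) (hg : g ∈ P.plaques s.face) :
    ∃ g' ∈ P.plaques e.whole.face, Match B s e.whole g g' := by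
  obtain ⟨g', hg', h1, h2⟩ := P.exists_whole' he hs hg
  exact ⟨g', hg', match_whole hB he hs h1 h2⟩

theorem Match.sum_eq (hB : B.IsBranchedSurface) {e : Edge} (he : e ∈ B.edges) {s s' : Side}
    (hs : s ∈ e.sides) (hs' : s' ∈ e.sides) (hm : Match B s s' g g') {t : ℝ} {Y Z : B.Triangles}
    (hY : B.OnSide s t Y) (hZ : B.OnSide s' t Z) :
    B.sign e s * ∑ i, Y.2 i * g i = B.sign e s' * ∑ i, Z.2 i * g' i := by
  have key : ∀ end_ : Side → Fin 3, (end_ = Side.src ∨ end_ = Side.tgt) →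
      B.sign e s * g (end_ s) = B.sign e s' * g' (end_ s') := by
    intro end_ hend
    rw [hB.sign_eq_end he hend hs, hB.sign_eq_end he hend hs', mul_assoc, mul_assoc,
      hm end_ hend]
  rw [hY.sum_eq, hZ.sum_eq]
  have h1 := key Side.src (Or.inl rfl)
  have h2 := key Side.tgt (Or.inr rfl)
  linear_combination (1 - t) * h1 + t * h2

/-- Both plaques continue into `whole`, and there agreement at one corner forces equality. -/
theorem match_of_end (hB : B.IsBranchedSurface) {e : Edge} (he : e ∈ B.edges) {s s' : Side}
    (hs : s ∈ e.sides) (hs' : s' ∈ e.sides) (hg : g ∈ P.plaques s.face)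
    (hg' : g' ∈ P.plaques s'.face) {end_ : Side → Fin 3}
    (hend : end_ = Side.src ∨ end_ = Side.tgt)
    (h : (B.corner s.face (end_ s)).eps * g (end_ s) =
      (B.corner s'.face (end_ s')).eps * g' (end_ s')) : Match B s s' g g' := by
  obtain ⟨k, hk, hm⟩ := P.exists_match_whole hB he hs hg
  obtain ⟨k', hk', hm'⟩ := P.exists_match_whole hB he hs' hg'
  have : k = k' := by
    refine P.ext_corner (hB.face_lt he e.whole_mem_sides) hk hk' (i := end_ e.whole) ?_
    refine mul_left_cancel₀ (B.corner e.whole.face (end_ e.whole)).eps_ne_zero ?_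
    rw [← hm end_ hend, ← hm' end_ hend, h]
  subst this
  exact fun end_ hend => (hm end_ hend).trans (hm' end_ hend).symm

theorem match_of_sum_eq (hB : B.IsBranchedSurface) {e : Edge} (he : e ∈ B.edges) {s s' : Side}
    (hs : s ∈ e.sides) (hs' : s' ∈ e.sides) (hg : g ∈ P.plaques s.face)
    (hg' : g' ∈ P.plaques s'.face) {t : ℝ} {Y Z : B.Triangles}
    (hY : B.OnSide s t Y) (hZ : B.OnSide s' t Z)
    (h : B.sign e s * ∑ i, Y.2 i * g i = B.sign e s' * ∑ i, Z.2 i * g' i) :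
    Match B s s' g g' := by
  obtain ⟨k, hk, hm⟩ := P.exists_match_whole hB he hs hg
  obtain ⟨k', hk', hm'⟩ := P.exists_match_whole hB he hs' hg'
  obtain ⟨X, hX⟩ := Code.exists_onSide (hB.face_lt he e.whole_mem_sides) hY.nonneg hY.le_one
  have : k = k' := by
    refine P.ext_sum (hB.face_lt he e.whole_mem_sides) hk hk' (y := X.2) ?_
    have h1 := hm.sum_eq hB he hs e.whole_mem_sides hY hX
    have h2 := hm'.sum_eq hB he hs' e.whole_mem_sides hZ hX
    rw [Code.sign_whole, one_mul] at h1 h2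
    rw [← h1, ← h2, h]
  subst this
  exact fun end_ hend => (hm end_ hend).trans (hm' end_ hend).symm

/-- A point of a plaque. -/
def point (f : Fin B.faces.length) (y : stdSimplex ℝ (Fin 3)) {g : Fin 3 → ℝ}
    (hg : g ∈ P.plaques f) : B.Prisms :=
  Code.pt (Code.inPrism_sum y (P.mem_range f.2 hg))

@[simp] theorem foot_point (f : Fin B.faces.length) (y : stdSimplex ℝ (Fin 3)) {g : Fin 3 → ℝ}
    (hg : g ∈ P.plaques f) : B.foot (P.point f y hg) = ⟨f, y⟩ := rfl

@[simp] theorem height_point (f : Fin B.faces.length) (y : stdSimplex ℝ (Fin 3)) {g : Fin 3 → ℝ}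
    (hg : g ∈ P.plaques f) : B.height (P.point f y hg) = ∑ i, y i * g i := rfl

/-- The points of the prisms which lie on plaques. -/
def OnPlaque (p : B.Prisms) : Prop :=
  ∃ g ∈ P.plaques p.1, B.height p = ∑ i, (B.foot p).2 i * g i

theorem onPlaque_point (f : Fin B.faces.length) (y : stdSimplex ℝ (Fin 3)) {g : Fin 3 → ℝ}
    (hg : g ∈ P.plaques f) : P.OnPlaque (P.point f y hg) := ⟨g, hg, rfl⟩

theorem OnPlaque.exists_point {P : PlaqueSystem B} {p : B.Prisms} (h : P.OnPlaque p) :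
    ∃ (g : Fin 3 → ℝ) (hg : g ∈ P.plaques p.1), p = P.point p.1 (B.foot p).2 hg := by
  obtain ⟨g, hg, h⟩ := h
  exact ⟨g, hg, Code.Prisms.ext rfl h⟩

end PlaqueSystem

/-- Over an edge the prisms over the two opposite sheets are disjoint. -/
theorem Code.IsBranchedSurface.inPrism_lower_lt {B : Code} (hB : B.IsBranchedSurface) {e : Edge}
    (he : e ∈ B.edges) {u : Side} (hu : e.upper = some u) {t : ℝ} {Y Z : B.Triangles}
    (hY : B.OnSide e.lower t Y) (hZ : B.OnSide u t Z) {η θ : ℝ} (hη : B.InPrism Y.1 Y.2 η)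
    (hθ : B.InPrism Z.1 Z.2 θ) : B.sign e e.lower * η < B.sign e u * θ := by
  rw [hB.inPrism_iff Y.1.2, hY.1] at hη
  rw [hB.inPrism_iff Z.1.2, hZ.1] at hθ
  obtain ⟨g, hg, rfl⟩ := hη
  obtain ⟨k, hk, rfl⟩ := hθ
  have h1 := hB.lower_add_one_le he (Or.inl rfl) hu (hg e.lower.src) (hk u.src)
  have h2 := hB.lower_add_one_le he (Or.inr rfl) hu (hg e.lower.tgt) (hk u.tgt)
  rw [hY.sum_eq, hZ.sum_eq]
  have := hY.nonneg
  have := hY.le_one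
  nlinarith

theorem Code.IsBranchedSurface.small_unique {B : Code} (hB : B.IsBranchedSurface) {e : Edge}
    (he : e ∈ B.edges) {s s' : Side} (hs : s ∈ e.small) (hs' : s' ∈ e.small) {t : ℝ}
    {Y Z : B.Triangles} (hY : B.OnSide s t Y) (hZ : B.OnSide s' t Z) {η θ : ℝ}
    (hη : B.InPrism Y.1 Y.2 η) (hθ : B.InPrism Z.1 Z.2 θ)
    (h : B.sign e s * η = B.sign e s' * θ) : s = s' := by
  simp only [Edge.small, List.mem_cons, Option.mem_toList] at hs hs'
  rcases hs with rfl | hs <;> rcases hs' with rfl | hs'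
  · rfl
  · exact absurd h (hB.inPrism_lower_lt he hs' hY hZ hη hθ).ne
  · exact absurd h (hB.inPrism_lower_lt he hs hZ hY hθ hη).ne'
  · exact Option.some_injective _ (hs.symm.trans hs')

theorem Code.IsBranchedSurface.small_unique_end {B : Code} (hB : B.IsBranchedSurface) {e : Edge}
    (he : e ∈ B.edges) {s s' : Side} (hs : s ∈ e.small) (hs' : s' ∈ e.small)
    {end_ : Side → Fin 3} (hend : end_ = Side.src ∨ end_ = Side.tgt) {h : ℝ}
    (hη : 2 * ((B.corner s.face (end_ s)).bot : ℝ) ≤ h ∧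
      h ≤ 2 * ((B.corner s.face (end_ s)).top : ℝ) + 1)
    (hθ : 2 * ((B.corner s'.face (end_ s')).bot : ℝ) ≤ h ∧
      h ≤ 2 * ((B.corner s'.face (end_ s')).top : ℝ) + 1) : s = s' := by
  obtain ⟨p, hp⟩ := Code.exists_atCorner (k := (s.face, end_ s))
    (hB.face_lt he (Edge.small_mem_sides hs)) hη
  obtain ⟨q, hq⟩ := Code.exists_atCorner (k := (s'.face, end_ s'))
    (hB.face_lt he (Edge.small_mem_sides hs')) hθ
  have hh : B.sign e s * B.height p = B.sign e s' * B.height q := by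
    rw [hB.sign_eq_end he hend (Edge.small_mem_sides hs),
      hB.sign_eq_end he hend (Edge.small_mem_sides hs'), mul_assoc, mul_assoc]
    exact congrArg _ (hp.2.2.trans hq.2.2.symm)
  rcases hend with rfl | rfl
  · exact hB.small_unique he hs hs' (Code.onSide_src hp.1 hp.2.1) (Code.onSide_src hq.1 hq.2.1)
      (B.inPrism p) (B.inPrism q) hh
  · exact hB.small_unique he hs hs' (Code.onSide_tgt hp.1 hp.2.1) (Code.onSide_tgt hq.1 hq.2.1)
      (B.inPrism p) (B.inPrism q) hh

/-! ### The union of the plaques as a closed set away from the cusps. -/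

namespace PlaqueSystem

variable {B : Code} (P : PlaqueSystem B) (hB : B.IsBranchedSurface)
include hB

/-- This lets the union of the plaques descend to `N(B)`. From `whole` a plaque continues into some
sheet, and this must be the sheet of the glued point because the prisms over the two sheets are
disjoint along the edge. -/
theorem onPlaque_iff_of_glue {e : Edge} (he : e ∈ B.edges) {s : Side} (hs : s ∈ e.small)
    {p q : B.Prisms} (h : B.Glue e s p q) : P.OnPlaque p ↔ P.OnPlaque q := by
  obtain ⟨⟨t, hp, hq⟩, hh⟩ := h
  have hss := Edge.small_mem_sides hs
  have hh' : B.height p = B.sign e s * B.height q := by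
    rw [hh, ← mul_assoc, Code.sign_mul_sign, one_mul]
  constructor
  · rintro ⟨g, hg, hgp⟩
    rw [show (p.1 : ℕ) = e.whole.face from hp.1] at hg
    obtain ⟨s', hs', g', hg', h1, h2⟩ := P.exists_small hB he hg
    have hss' := Edge.small_mem_sides hs'
    have hm := match_whole hB he hss' h1 h2
    obtain ⟨Z, hZ⟩ := Code.exists_onSide (hB.face_lt he hss') hp.nonneg hp.le_one
    have hsum := hm.sum_eq hB he hss' e.whole_mem_sides hZ hp
    rw [Code.sign_whole, one_mul] at hsum
    have : s = s' := by
      refine hB.small_unique he hs hs' hq hZ (B.inPrism q)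
        (Code.inPrism_sum Z.2 (P.mem_range Z.1.2 (hZ.1.symm ▸ hg'))) ?_
      rw [hsum, ← hgp, hh']
    subst this
    obtain rfl := hZ.ext hq
    refine ⟨g', hq.1.symm ▸ hg', ?_⟩
    rw [hh, hgp, ← hsum, ← mul_assoc, Code.sign_mul_sign, one_mul]
  · rintro ⟨g, hg, hgq⟩
    rw [show (q.1 : ℕ) = s.face from hq.1] at hg
    obtain ⟨g', hg', hm⟩ := P.exists_match_whole hB he hss hg
    have hsum := hm.sum_eq hB he hss e.whole_mem_sides hq hp
    rw [Code.sign_whole, one_mul] at hsum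
    refine ⟨g', hp.1.symm ▸ hg', ?_⟩
    rw [hh', hgq, hsum]

/-- The union of the plaques. -/
def support : Set B.Nbhd :=
  {n | Quot.lift P.OnPlaque (fun _ _ ⟨_, he, _, hs, h⟩ =>
    propext (P.onPlaque_iff_of_glue hB he hs h)) n}

theorem mem_support {p : B.Prisms} : B.toNbhd p ∈ P.support hB ↔ P.OnPlaque p := Iff.rfl

/-- The disjoint union of the plaques. -/
abbrev Total : Type := Σ f : Fin B.faces.length, stdSimplex ℝ (Fin 3) × P.plaques f

omit hB in
instance : CompactSpace P.Total := by
  have : ∀ f : Fin B.faces.length, CompactSpace (P.plaques f) := fun f =>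
    isCompact_iff_compactSpace.1 (P.isCompact_plaques f f.2)
  infer_instance

/-- The point of `N(B)` on a plaque over a point of a triangle. -/
def total (x : P.Total) : B.Nbhd := B.toNbhd (P.point x.1 x.2.1 x.2.2.2)

omit hB in
theorem continuous_total : Continuous P.total := by
  refine Code.IsBranchedSurface.continuous_toNbhd.comp (continuous_sigma fun f => ?_)
  have hc : Continuous fun z : stdSimplex ℝ (Fin 3) × P.plaques f =>
      ((z.1, ∑ i, z.1 i * z.2.1 i) : stdSimplex ℝ (Fin 3) × ℝ) := by
    refine continuous_fst.prodMk (continuous_finsetSum _ fun i _ => ?_)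
    exact ((continuous_barycentric i).comp continuous_fst).mul
      ((continuous_apply i).comp (continuous_subtype_val.comp continuous_snd))
  have hc' : Continuous fun z : stdSimplex ℝ (Fin 3) × P.plaques f =>
      (⟨(z.1, ∑ i, z.1 i * z.2.1 i), Code.inPrism_sum z.1 (P.mem_range f.2 z.2.2)⟩ :
        B.Prism f) := hc.subtype_mk _
  exact (continuous_sigmaMk (σ := fun f => B.Prism f) (i := f)).comp hc'

theorem range_total : range P.total = P.support hB := by
  ext n
  constructor
  · rintro ⟨x, rfl⟩
    exact P.onPlaque_point _ _ _
  · obtain ⟨p, rfl⟩ := Quot.exists_rep n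
    intro h
    obtain ⟨g, hg, hp⟩ := OnPlaque.exists_point ((P.mem_support hB).1 h)
    exact ⟨⟨p.1, (B.foot p).2, g, hg⟩, congrArg B.toNbhd hp.symm⟩

/-- The space of all plaque points is compact and `N(B)` is Hausdorff. Open sets and local
statements are transferred from the triangles to the support through this map. -/
theorem isClosedMap_total : IsClosedMap P.total := by
  have := hB.t2Space_nbhd
  exact P.continuous_total.isClosedMap

theorem isClosed_support : IsClosed (P.support hB) := by
  rw [← P.range_total hB]
  exact (P.isClosedMap_total hB).isClosed_range

theorem disjoint_verticalBoundary : Disjoint (P.support hB) B.verticalBoundary := by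
  rw [Set.disjoint_left]
  rintro n hn ⟨e, he, t, p, rfl, hp, hcon⟩
  obtain ⟨g, hg, hgp⟩ := hn
  rw [show (p.1 : ℕ) = e.whole.face from hp.1] at hg
  obtain ⟨s, hs, g', hg', h1, h2⟩ := P.exists_small hB he hg
  have hss := Edge.small_mem_sides hs
  have hm := match_whole hB he hss h1 h2
  obtain ⟨Z, hZ⟩ := Code.exists_onSide (hB.face_lt he hss) hp.nonneg hp.le_one
  have hsum := hm.sum_eq hB he hss e.whole_mem_sides hZ hp
  rw [Code.sign_whole, one_mul] at hsum
  refine hcon s hs (P.point Z.1 Z.2 (g := g') (hZ.1.symm ▸ hg')) ⟨⟨t, hp, hZ⟩, ?_⟩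
  rw [height_point, hgp, ← hsum, ← mul_assoc, Code.sign_mul_sign, one_mul]

end PlaqueSystem

/-! ### Product charts -/

/-- Two maps with the same kernel on a compact space identify the images of any subset. -/
theorem exists_homeomorph_image {Z N M : Type*} [TopologicalSpace Z] [TopologicalSpace N]
    [TopologicalSpace M] [CompactSpace Z] [T2Space N] [T2Space M] {Θ : Z → N} {Ξ : Z → M}
    (hΘ : Continuous Θ) (hΞ : Continuous Ξ) (hker : ∀ z z', Θ z = Θ z' ↔ Ξ z = Ξ z') (A : Set Z) :
    ∃ e : ↥(Θ '' A) ≃ₜ ↥(Ξ '' A),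
      ∀ z (hz : z ∈ A), (e ⟨Θ z, mem_image_of_mem Θ hz⟩ : M) = Ξ z := by
  -- The image of `(Θ, Ξ)` is compact and both of its projections are injective, hence closed
  -- embeddings; the homeomorphism goes from one projection to the other.
  let G : Z → N × M := fun z => (Θ z, Ξ z)
  have hG : Continuous G := hΘ.prodMk hΞ
  have : CompactSpace (range G) := isCompact_iff_compactSpace.1 (isCompact_range hG)
  let K : Set (range G) := {k | ∃ z ∈ A, G z = k}
  have h1 : IsEmbedding (fun k : K => (k.1.1).1) := by
    refine IsEmbedding.comp (g := fun k : range G => k.1.1) ?_ IsEmbedding.subtypeVal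
    refine ((continuous_fst.comp continuous_subtype_val).isClosedEmbedding ?_).isEmbedding
    rintro ⟨_, z, rfl⟩ ⟨_, z', rfl⟩ h
    have h : Θ z = Θ z' := h
    exact Subtype.ext (Prod.ext h ((hker _ _).1 h))
  have h2 : IsEmbedding (fun k : K => (k.1.1).2) := by
    refine IsEmbedding.comp (g := fun k : range G => k.1.2) ?_ IsEmbedding.subtypeVal
    refine ((continuous_snd.comp continuous_subtype_val).isClosedEmbedding ?_).isEmbedding
    rintro ⟨_, z, rfl⟩ ⟨_, z', rfl⟩ h
    have h : Ξ z = Ξ z' := h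
    exact Subtype.ext (Prod.ext ((hker _ _).2 h) h)
  have r1 : range (fun k : K => (k.1.1).1) = Θ '' A := by
    ext n
    constructor
    · rintro ⟨⟨k, z, hz, hk⟩, rfl⟩
      exact ⟨z, hz, congrArg Prod.fst hk⟩
    · rintro ⟨z, hz, rfl⟩
      exact ⟨⟨⟨G z, z, rfl⟩, z, hz, rfl⟩, rfl⟩
  have r2 : range (fun k : K => (k.1.1).2) = Ξ '' A := by
    ext n
    constructor
    · rintro ⟨⟨k, z, hz, hk⟩, rfl⟩
      exact ⟨z, hz, congrArg Prod.snd hk⟩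
    · rintro ⟨z, hz, rfl⟩
      exact ⟨⟨⟨G z, z, rfl⟩, z, hz, rfl⟩, rfl⟩
  let e1 := h1.toHomeomorph.trans (Homeomorph.setCongr r1)
  let e2 := h2.toHomeomorph.trans (Homeomorph.setCongr r2)
  refine ⟨e1.symm.trans e2, fun z hz => ?_⟩
  have : e1 ⟨⟨G z, z, rfl⟩, z, hz, rfl⟩ = ⟨Θ z, mem_image_of_mem Θ hz⟩ := rfl
  rw [← this]
  change (e2 (e1.symm (e1 _)) : M) = _
  rw [e1.symm_apply_apply]
  rfl
-- Patches of surface and the flow boxes over them.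
namespace PlaqueSystem

variable {B : Code} (P : PlaqueSystem B)

/-- Parts of triangles which fit together to a part of a disc in the branched surface, along which
the plaques through a range of layers over one vertex form a product. -/
structure Patch where
  ι : Type
  [fin : Finite ι]
  [nonempty : Nonempty ι]
  face : ι → Fin B.faces.length
  corner : ι → Fin 3
  -- Compactness arguments take place over the closed sets `outer`; the flow box itself lies over
  -- the open sets `inner`.
  inner : ι → Set (stdSimplex ℝ (Fin 3))
  outer : ι → Set (stdSimplex ℝ (Fin 3))
  vertex : ℕ
  bot : ℕ
  top : ℕ
  isOpen_inner : ∀ j, IsOpen (inner j)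
  isClosed_outer : ∀ j, IsClosed (outer j)
  inner_subset : ∀ j, inner j ⊆ outer j
  vertex_eq : ∀ j, (B.corner (face j) (corner j)).vertex = vertex
  bot_le : ∀ j, (B.corner (face j) (corner j)).bot ≤ bot
  le_top : ∀ j, top ≤ (B.corner (face j) (corner j)).top
  -- Position in the surface and height over the common vertex determine the point of `N(B)`: these
  -- will be the product coordinates.
  glue : ∀ j j' y y', y ∈ outer j → y' ∈ outer j' →
    B.toSurface ⟨face j, y⟩ = B.toSurface ⟨face j', y'⟩ →
    ∀ g g' (hg : g ∈ P.plaques (face j)) (hg' : g' ∈ P.plaques (face j')),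
      (B.corner (face j) (corner j)).eps * g (corner j) =
        (B.corner (face j') (corner j')).eps * g' (corner j') →
      (B.corner (face j) (corner j)).eps * g (corner j) ∈ Icc (2 * (bot : ℝ)) (2 * (top : ℝ) + 1) →
      B.toNbhd (P.point (face j) y hg) = B.toNbhd (P.point (face j') y' hg')
  -- A plaque point glued to a point of the patch is again in the patch, so the patch is open in the
  -- support.
  saturated : ∀ j y, y ∈ inner j → ∀ g (hg : g ∈ P.plaques (face j)),
    (B.corner (face j) (corner j)).eps * g (corner j) ∈ Icc (2 * (bot : ℝ)) (2 * (top : ℝ) + 1) →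
    ∀ (f' : Fin B.faces.length) y' g' (hg' : g' ∈ P.plaques f'),
      B.toNbhd (P.point (face j) y hg) = B.toNbhd (P.point f' y' hg') →
      ∃ j', face j' = f' ∧ y' ∈ inner j' ∧
        (B.corner f' (corner j')).eps * g' (corner j') ∈ Icc (2 * (bot : ℝ)) (2 * (top : ℝ) + 1)

namespace Patch

attribute [instance] Patch.fin Patch.nonempty

variable {P} (Q : Patch P)

/-- The heights of the plaques of a patch over its vertex. -/
def heights : Set ℝ := P.pts Q.vertex ∩ Icc (2 * (Q.bot : ℝ)) (2 * (Q.top : ℝ) + 1)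

/-- The plaques of a patch over one of its triangles. -/
def plaques (j : Q.ι) : Set (Fin 3 → ℝ) :=
  {g | g ∈ P.plaques (Q.face j) ∧ (B.corner (Q.face j) (Q.corner j)).eps * g (Q.corner j) ∈
    Icc (2 * (Q.bot : ℝ)) (2 * (Q.top : ℝ) + 1)}

theorem continuous_height (j : Q.ι) : Continuous fun g : Fin 3 → ℝ =>
    (B.corner (Q.face j) (Q.corner j)).eps * g (Q.corner j) :=
  continuous_const.mul (continuous_apply _)

theorem isCompact_plaques (j : Q.ι) : IsCompact (Q.plaques j) :=
  (P.isCompact_plaques _ (Q.face j).2).inter_right (isClosed_Icc.preimage (Q.continuous_height j))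

/-- The layers of the patch belong to all of its corners, so every triangle of the patch sees the
same heights. This is what makes the patch a product. -/
theorem image_plaques (j : Q.ι) :
    (fun g : Fin 3 → ℝ => (B.corner (Q.face j) (Q.corner j)).eps * g (Q.corner j)) '' Q.plaques j =
      Q.heights := by
  have hb : ((B.corner (Q.face j) (Q.corner j)).bot : ℝ) ≤ Q.bot := by exact_mod_cast Q.bot_le j
  have ht : (Q.top : ℝ) ≤ (B.corner (Q.face j) (Q.corner j)).top := by exact_mod_cast Q.le_top j
  ext h
  constructor
  · rintro ⟨g, ⟨hg, hr⟩, rfl⟩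
    exact ⟨Q.vertex_eq j ▸ P.mem_pts (Q.face j).2 hg _, hr⟩
  · rintro ⟨h1, h2⟩
    obtain ⟨g, hg, rfl⟩ := (P.exists_plaque_iff _ (Q.face j).2 (Q.corner j) h).2
      ⟨(Q.vertex_eq j).symm ▸ h1, by linarith [h2.1], by linarith [h2.2]⟩
    exact ⟨g, ⟨hg, h2⟩, rfl⟩

theorem isClosed_heights : IsClosed Q.heights := by
  obtain ⟨j⟩ := Q.nonempty
  rw [← Q.image_plaques j]
  exact ((Q.isCompact_plaques j).image (Q.continuous_height j)).isClosed

/-- The compact space of points of the plaques of a patch. -/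
abbrev Space : Type := Σ j : Q.ι, ↥(Q.outer j) × ↥(Q.plaques j)

instance : CompactSpace Q.Space := by
  have h1 : ∀ j, CompactSpace (Q.plaques j) := fun j =>
    isCompact_iff_compactSpace.1 (Q.isCompact_plaques j)
  have h2 : ∀ j, CompactSpace (Q.outer j) := fun j =>
    isCompact_iff_compactSpace.1 (Q.isClosed_outer j).isCompact
  infer_instance

/-- The point of `N(B)`. -/
def toTotal (z : Q.Space) : P.Total := ⟨Q.face z.1, z.2.1.1, ⟨z.2.2.1, z.2.2.2.1⟩⟩

/-- The point of the branched surface and the height over the vertex. -/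
def coord (z : Q.Space) : B.Surface × ℝ := (B.toSurface ⟨Q.face z.1, z.2.1.1⟩,
  (B.corner (Q.face z.1) (Q.corner z.1)).eps * z.2.2.1 (Q.corner z.1))

theorem continuous_toTotal : Continuous Q.toTotal := by
  refine continuous_sigma fun j => ?_
  have hc : Continuous fun z : ↥(Q.outer j) × ↥(Q.plaques j) =>
      ((z.1.1, ⟨z.2.1, z.2.2.1⟩) : stdSimplex ℝ (Fin 3) × P.plaques (Q.face j)) :=
    (continuous_subtype_val.comp continuous_fst).prodMk
      ((continuous_subtype_val.comp continuous_snd).subtype_mk _)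
  exact (continuous_sigmaMk (σ := fun f : Fin B.faces.length =>
    stdSimplex ℝ (Fin 3) × P.plaques f) (i := Q.face j)).comp hc

theorem continuous_coord : Continuous Q.coord := by
  refine Continuous.prodMk ?_ ?_
  · refine Code.IsBranchedSurface.continuous_toSurface.comp (continuous_sigma fun j => ?_)
    exact (continuous_sigmaMk (σ := fun _ : Fin B.faces.length => stdSimplex ℝ (Fin 3))
      (i := Q.face j)).comp (continuous_subtype_val.comp continuous_fst)
  · exact continuous_sigma fun j =>
      (Q.continuous_height j).comp (continuous_subtype_val.comp continuous_snd)

/-- If two plaque points coincide in `N(B)`, consider over the first triangle the plaque `k` with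
the height of the second one. By `glue` it passes through the same point, and over a given foot a
point of `N(B)` has only one height; so `k` is the first plaque and the heights over the vertex
agree. -/
theorem total_eq_iff (hB : B.IsBranchedSurface) (z z' : Q.Space) :
    P.total (Q.toTotal z) = P.total (Q.toTotal z') ↔ Q.coord z = Q.coord z' := by
  constructor
  · intro h
    have hs : B.toSurface ⟨Q.face z.1, z.2.1.1⟩ = B.toSurface ⟨Q.face z'.1, z'.2.1.1⟩ :=
      congrArg B.proj h
    refine Prod.ext hs ?_
    have hm : (B.corner (Q.face z'.1) (Q.corner z'.1)).eps * z'.2.2.1 (Q.corner z'.1) ∈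
        Q.heights := by
      rw [← Q.image_plaques z'.1]
      exact ⟨_, z'.2.2.2, rfl⟩
    have hm' := hm
    rw [← Q.image_plaques z.1] at hm'
    obtain ⟨k, hk, hk'⟩ := hm'
    simp only at hk'
    have h2 := Q.glue z.1 z'.1 _ _ z.2.1.2 z'.2.1.2 hs k z'.2.2.1 hk.1 z'.2.2.2.1 hk' (by
      rw [hk']; exact hm.2)
    have h3 := hB.height_eq_of_toNbhd_eq (h2.trans h.symm) rfl
    have : k = z.2.2.1 := P.ext_sum (Q.face z.1).2 hk.1 z.2.2.2.1 h3
    subst this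
    exact hk'
  · intro h
    exact Q.glue z.1 z'.1 _ _ z.2.1.2 z'.2.1.2 (congrArg Prod.fst h) _ _ z.2.2.2.1 z'.2.2.2.1
      (congrArg Prod.snd h) z.2.2.2.2

/-- The part of the branched surface covered by a patch. -/
def base : Set B.Surface := {b | ∃ j, ∃ y ∈ Q.inner j, B.toSurface ⟨Q.face j, y⟩ = b}

/-- The points in the interior of a patch. -/
def innerSpace : Set Q.Space := {z | z.2.1.1 ∈ Q.inner z.1}

theorem image_coord : Q.coord '' Q.innerSpace = Q.base ×ˢ Q.heights := by
  ext ⟨b, h⟩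
  constructor
  · rintro ⟨z, hz, hzb⟩
    obtain ⟨rfl, rfl⟩ := Prod.mk.inj hzb
    refine ⟨⟨z.1, _, hz, rfl⟩, ?_⟩
    rw [← Q.image_plaques z.1]
    exact ⟨_, z.2.2.2, rfl⟩
  · rintro ⟨⟨j, y, hy, hb⟩, hh⟩
    simp only at hb hh
    rw [← Q.image_plaques j] at hh
    obtain ⟨g, hg, rfl⟩ := hh
    exact ⟨⟨j, ⟨y, Q.inner_subset j hy⟩, ⟨g, hg⟩⟩, hy, by rw [← hb]; rfl⟩

/-- The points of the lamination in a patch. -/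
def points : Set B.Nbhd := (fun z => P.total (Q.toTotal z)) '' Q.innerSpace

theorem mem_points {j : Q.ι} {y : stdSimplex ℝ (Fin 3)} (hy : y ∈ Q.inner j) {g : Fin 3 → ℝ}
    (hg : g ∈ Q.plaques j) : B.toNbhd (P.point (Q.face j) y hg.1) ∈ Q.points :=
  ⟨⟨j, ⟨y, Q.inner_subset j hy⟩, ⟨g, hg⟩⟩, hy, rfl⟩

theorem exists_of_mem_points {f : Fin B.faces.length} {y : stdSimplex ℝ (Fin 3)} {g : Fin 3 → ℝ}
    {hg : g ∈ P.plaques f} (h : B.toNbhd (P.point f y hg) ∈ Q.points) :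
    ∃ j, Q.face j = f ∧ y ∈ Q.inner j ∧ (B.corner f (Q.corner j)).eps * g (Q.corner j) ∈
      Icc (2 * (Q.bot : ℝ)) (2 * (Q.top : ℝ) + 1) := by
  obtain ⟨z, hz, h⟩ := h
  exact Q.saturated z.1 _ hz _ z.2.2.2.1 z.2.2.2.2 f y g hg h

theorem points_subset (hB : B.IsBranchedSurface) : Q.points ⊆ P.support hB := by
  rintro _ ⟨z, -, rfl⟩
  rw [← P.range_total hB]
  exact mem_range_self _

/-- The points of the plaques in one of the triangles of a patch. -/
def cell (j : Q.ι) : Set P.Total :=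
  {x | Q.face j = x.1 ∧ x.2.1 ∈ Q.inner j ∧ (B.corner x.1 (Q.corner j)).eps * x.2.2.1 (Q.corner j) ∈
    Icc (2 * (Q.bot : ℝ)) (2 * (Q.top : ℝ) + 1)}

theorem preimage_points : P.total ⁻¹' Q.points = ⋃ j, Q.cell j := by
  ext ⟨f, y, g, hg⟩
  simp only [mem_preimage, mem_iUnion]
  constructor
  · exact fun h => Q.exists_of_mem_points h
  · rintro ⟨j, h1, hy, hh⟩
    simp only at h1
    subst h1
    exact Q.mem_points hy ⟨hg, hh⟩

theorem isOpen_cell (j : Q.ι) : IsOpen (Q.cell j) := by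
  have : Q.cell j = Sigma.mk (Q.face j) ''
      {w : stdSimplex ℝ (Fin 3) × P.plaques (Q.face j) | w.1 ∈ Q.inner j ∧ w.2.1 ∈ Q.plaques j} := by
    ext ⟨f, y, g, hg⟩
    constructor
    · rintro ⟨h1, hy, hh⟩
      simp only at h1
      subst h1
      exact ⟨(y, ⟨g, hg⟩), ⟨hy, hg, hh⟩, rfl⟩
    · rintro ⟨⟨y', g', hg'⟩, ⟨hy, hgj⟩, h⟩
      rw [← h]
      exact ⟨rfl, hy, hgj.2⟩
  rw [this]
  refine isOpenMap_sigmaMk _ ?_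
  refine IsOpen.inter ((Q.isOpen_inner j).preimage continuous_fst) ?_
  -- No plaque has a height in a gap, so widening the closed interval to an open one that ends
  -- inside or at the far side of the gaps adds nothing.
  have hset : {w : stdSimplex ℝ (Fin 3) × P.plaques (Q.face j) | w.2.1 ∈ Q.plaques j} =
      {w | (B.corner (Q.face j) (Q.corner j)).eps * w.2.1 (Q.corner j) ∈
        Ioo (2 * (Q.bot : ℝ) - 1) (2 * (Q.top : ℝ) + 2)} := by
    ext ⟨y, g, hg⟩
    simp only [mem_ofPred_eq]
    constructor
    · rintro ⟨-, h1, h2⟩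
      exact ⟨by linarith, by linarith⟩
    · rintro ⟨h1, h2⟩
      obtain ⟨a, h3, h4⟩ := P.exists_layer _ _ (P.mem_pts (Q.face j).2 hg (Q.corner j))
      refine ⟨hg, ?_, ?_⟩
      · have : Q.bot ≤ a := by
          have h5 : 2 * (Q.bot : ℝ) - 1 < 2 * a + 1 := by linarith
          have h6 : (Q.bot : ℝ) < a + 1 := by linarith
          have h7 : Q.bot < a + 1 := by exact_mod_cast h6
          omega
        have : (Q.bot : ℝ) ≤ a := by exact_mod_cast this
        linarith
      · have : a ≤ Q.top := by
          have h5 : 2 * (a : ℝ) < 2 * Q.top + 2 := by linarith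
          have h6 : (a : ℝ) < Q.top + 1 := by linarith
          have h7 : a < Q.top + 1 := by exact_mod_cast h6
          omega
        have : (a : ℝ) ≤ Q.top := by exact_mod_cast this
        linarith
  change IsOpen {w : stdSimplex ℝ (Fin 3) × P.plaques (Q.face j) | w.2.1 ∈ Q.plaques j}
  rw [hset]
  exact isOpen_Ioo.preimage
    ((Q.continuous_height j).comp (continuous_subtype_val.comp continuous_snd))

theorem isOpen_preimage_points : IsOpen (P.total ⁻¹' Q.points) := by
  rw [Q.preimage_points]
  exact isOpen_iUnion Q.isOpen_cell

/-- A flow box on the points of a patch, with the heights over the vertex as transversal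
coordinate. -/
def IsChart {hB : B.IsBranchedSurface} (α : FlowBox B (P.support hB)) : Prop :=
  P.support hB ∩ α.dom = Q.points ∧
    ∀ (j : Q.ι), ∀ x ∈ Q.cell j, ∀ h : P.total x ∈ P.support hB ∩ α.dom,
      ((α.chart ⟨_, h⟩).2 : ℝ) = (B.corner x.1 (Q.corner j)).eps * x.2.2.1 (Q.corner j)

theorem exists_isChart (hB : B.IsBranchedSurface) :
    ∃ α : FlowBox B (P.support hB), Q.IsChart α := by
  have := hB.t2Space_nbhd
  have := hB.t2Space_surface
  obtain ⟨e, he⟩ := exists_homeomorph_image (P.continuous_total.comp Q.continuous_toTotal)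
    Q.continuous_coord (Q.total_eq_iff hB) Q.innerSpace
  -- The map is closed and the patch is saturated, so removing the image of the complement leaves an
  -- open set which meets the support in exactly the patch.
  have hopen : IsOpen (P.total '' (P.total ⁻¹' Q.points)ᶜ)ᶜ :=
    (P.isClosedMap_total hB _ Q.isOpen_preimage_points.isClosed_compl).isOpen_compl
  have hdom : P.support hB ∩ (P.total '' (P.total ⁻¹' Q.points)ᶜ)ᶜ = Q.points := by
    ext n
    constructor
    · rintro ⟨h1, h2⟩
      rw [← P.range_total hB] at h1
      obtain ⟨x, rfl⟩ := h1
      by_contra h3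
      exact h2 ⟨x, h3, rfl⟩
    · intro h
      refine ⟨Q.points_subset hB h, ?_⟩
      rintro ⟨x, hx, rfl⟩
      exact hx h
  let chart : ↥(P.support hB ∩ (P.total '' (P.total ⁻¹' Q.points)ᶜ)ᶜ) ≃ₜ Q.base × Q.heights :=
    (Homeomorph.setCongr hdom).trans (e.trans ((Homeomorph.setCongr Q.image_coord).trans
      (Homeomorph.Set.prod _ _)))
  have hchart : ∀ z (hz : z ∈ Q.innerSpace) (h : P.total (Q.toTotal z) ∈ P.support hB ∩
      (P.total '' (P.total ⁻¹' Q.points)ᶜ)ᶜ),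
      ((chart ⟨_, h⟩).1 : B.Surface) = (Q.coord z).1 ∧ ((chart ⟨_, h⟩).2 : ℝ) = (Q.coord z).2 := by
    intro z hz h
    exact ⟨congrArg Prod.fst (he z hz), congrArg Prod.snd (he z hz)⟩
  refine ⟨⟨_, hopen, Q.base, Q.heights, Q.isClosed_heights, chart, ?_, ?_⟩, hdom, ?_⟩
  · rintro ⟨n, hn⟩
    have hn' := hdom ▸ hn
    obtain ⟨z, hz, rfl⟩ := hn'
    exact (hchart z hz hn).1
  · intro p hp
    have hp' := hdom ▸ hp
    obtain ⟨g, hg, hpg⟩ := OnPlaque.exists_point ((P.mem_support hB).1 hp.1)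
    rw [hpg] at hp'
    obtain ⟨j, hj, hy, -⟩ := Q.exists_of_mem_points hp'
    have : Sigma.mk p.1 '' Q.inner j ∈ 𝓝 (B.foot p) :=
      (isOpenMap_sigmaMk (σ := fun _ : Fin B.faces.length => stdSimplex ℝ (Fin 3)) (i := p.1) _
        (Q.isOpen_inner j)).mem_nhds ⟨_, hy, rfl⟩
    filter_upwards [this]
    rintro _ ⟨y, hy, rfl⟩
    exact ⟨j, y, hy, by rw [hj]⟩
  · rintro j ⟨f, y, g, hg⟩ ⟨h1, hy, hh⟩ h
    simp only at h1
    subst h1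
    exact (hchart ⟨j, ⟨y, Q.inner_subset j hy⟩, ⟨g, hg, hh⟩⟩ hy h).2

end Patch

/-- If every point of a plaque lies in a patch, the plaques form a lamination. -/
theorem isCarriedLamination_of_patches (hB : B.IsBranchedSurface)
    (h : ∀ x : P.Total, ∃ (Q : Patch P) (j : Q.ι), x ∈ Q.cell j) :
    B.IsCarriedLamination (P.support hB) := by
  refine ⟨P.isClosed_support hB, P.disjoint_verticalBoundary hB,
    {α | ∃ Q : Patch P, Q.IsChart α}, ?_, ?_⟩
  · intro n hn
    rw [← P.range_total hB] at hn
    obtain ⟨x, rfl⟩ := hn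
    obtain ⟨Q, j, hx⟩ := h x
    obtain ⟨α, hα⟩ := Q.exists_isChart hB
    refine ⟨α, ⟨Q, hα⟩, ?_⟩
    have : x ∈ P.total ⁻¹' Q.points := by
      rw [Q.preimage_points]
      exact mem_iUnion.2 ⟨j, hx⟩
    rw [mem_preimage, ← hα.1] at this
    exact this.2
  · rintro α ⟨Q, hα, hαc⟩ β ⟨R, hβ, hβc⟩ n hna hnb
    -- For a closed map it suffices to verify the statement near each preimage of the point. Within
    -- one triangle both transversal coordinates are injective functions of the plaque, so each
    -- being constant means that the plaque is constant.
    have key := (P.isClosedMap_total hB).eventually_nhds_fiber (p := fun x =>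
      ∀ (qa : P.total x ∈ P.support hB ∩ α.dom) (qb : P.total x ∈ P.support hB ∩ β.dom),
      (α.chart ⟨_, qa⟩).2 = (α.chart ⟨n, hna⟩).2 ↔ (β.chart ⟨_, qb⟩).2 = (β.chart ⟨n, hnb⟩).2) n ?_
    · filter_upwards [key] with q hq qa qb
      have h3 := qa.1
      rw [← P.range_total hB] at h3
      obtain ⟨x, rfl⟩ := h3
      exact hq x rfl qa qb
    · rintro x₀ rfl
      have hna' : x₀ ∈ P.total ⁻¹' Q.points := hα ▸ hna
      have hnb' : x₀ ∈ P.total ⁻¹' R.points := hβ ▸ hnb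
      rw [Patch.preimage_points] at hna' hnb'
      obtain ⟨i, hi⟩ := mem_iUnion.1 hna'
      obtain ⟨j, hj⟩ := mem_iUnion.1 hnb'
      filter_upwards [(Q.isOpen_cell i).mem_nhds hi, (R.isOpen_cell j).mem_nhds hj]
        with x hxi hxj qa qb
      rw [Subtype.ext_iff, Subtype.ext_iff, hαc i x hxi, hαc i x₀ hi, hβc j x hxj, hβc j x₀ hj]
      obtain ⟨f, y, g, hg⟩ := x
      obtain ⟨f₀, y₀, g₀, hg₀⟩ := x₀
      obtain rfl : f₀ = f := hi.1.symm.trans hxi.1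
      constructor
      · intro h
        obtain rfl := P.ext_corner f₀.2 hg hg₀ (mul_left_cancel₀ (Corner.eps_ne_zero _) h)
        rfl
      · intro h
        obtain rfl := P.ext_corner f₀.2 hg hg₀ (mul_left_cancel₀ (Corner.eps_ne_zero _) h)
        rfl

end PlaqueSystem
-- Patches around vertices, edges and interiors of triangles.
namespace PlaqueSystem

variable {B : Code} (P : PlaqueSystem B) (hB : B.IsBranchedSurface)

include hB in
/-- When two points of plaques coincide in `N(B)`. -/
theorem cases_of_point_eq {f f' : Fin B.faces.length} {y y' : stdSimplex ℝ (Fin 3)}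
    {g g' : Fin 3 → ℝ} {hg : g ∈ P.plaques f} {hg' : g' ∈ P.plaques f'}
    (h : B.toNbhd (P.point f y hg) = B.toNbhd (P.point f' y' hg')) :
    (f = f' ∧ y = y' ∧ g = g') ∨
    (∃ e ∈ B.edges, ∃ s ∈ e.sides, ∃ s' ∈ e.sides, ∃ t : ℝ, 0 < t ∧ t < 1 ∧ B.OnSide s t ⟨f, y⟩ ∧
      B.OnSide s' t ⟨f', y'⟩ ∧ Match B s s' g g') ∨
    (∃ i j, y i = 1 ∧ y' j = 1 ∧ (B.corner f i).vertex = (B.corner f' j).vertex ∧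
      (B.corner f i).eps * g i = (B.corner f' j).eps * g' j) := by
  rcases hB.cases_of_inv_eq (hB.inv_eq_of_toNbhd h) with ⟨h1, h2⟩ |
    ⟨e, he, s, hs, s', hs', t, h0, h1, hp, hq, hh⟩ | ⟨i, j, hi, hj, hv, hh⟩
  · left
    simp only [foot_point, Sigma.mk.injEq] at h1
    obtain ⟨rfl, h1⟩ := h1
    obtain rfl := eq_of_heq h1
    exact ⟨rfl, rfl, P.ext_sum f.2 hg hg' h2⟩
  · right; left
    refine ⟨e, he, s, hs, s', hs', t, h0, h1, hp, hq, ?_⟩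
    exact P.match_of_sum_eq hB he hs hs' (hp.1 ▸ hg) (hq.1 ▸ hg') hp hq hh
  · right; right
    refine ⟨i, j, hi, hj, hv, ?_⟩
    simp only [foot_point, height_point] at hi hj hh
    rwa [Code.sum_eq_of_eq_one hi, Code.sum_eq_of_eq_one hj] at hh

include hB in
theorem point_eq_of_match {e : Edge} (he : e ∈ B.edges) {s s' : Side} (hs : s ∈ e.sides)
    (hs' : s' ∈ e.sides) {f f' : Fin B.faces.length} {y y' : stdSimplex ℝ (Fin 3)}
    {g g' : Fin 3 → ℝ} (hg : g ∈ P.plaques f) (hg' : g' ∈ P.plaques f') {t : ℝ}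
    (hY : B.OnSide s t ⟨f, y⟩) (hZ : B.OnSide s' t ⟨f', y'⟩) (hm : Match B s s' g g') :
    B.toNbhd (P.point f y hg) = B.toNbhd (P.point f' y' hg') :=
  hB.toNbhd_eq_of_sides he hs hs' hY hZ (hm.sum_eq hB he hs hs' hY hZ)

theorem eq_of_gt_half {y : stdSimplex ℝ (Fin 3)} {i j : Fin 3} (hi : 1 / 2 < y i)
    (hj : 1 / 2 < y j) : i = j := by
  by_contra hne
  have h1 : ∑ k, y k = 1 := y.2.2
  have h2 : y i + y j ≤ ∑ k, y k := by
    rw [← Finset.sum_pair hne]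
    exact Finset.sum_le_sum_of_subset_of_nonneg (Finset.subset_univ _)
      fun k _ _ => barycentric_nonneg y k
  linarith

theorem isOpen_gt (c : ℝ) (i : Fin 3) : IsOpen {y : stdSimplex ℝ (Fin 3) | c < y i} :=
  isOpen_Ioi.preimage (continuous_barycentric i)

theorem isOpen_lt (c : ℝ) (i : Fin 3) : IsOpen {y : stdSimplex ℝ (Fin 3) | y i < c} :=
  isOpen_Iio.preimage (continuous_barycentric i)

theorem isClosed_ge (c : ℝ) (i : Fin 3) : IsClosed {y : stdSimplex ℝ (Fin 3) | c ≤ y i} :=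
  isClosed_Ici.preimage (continuous_barycentric i)

theorem isClosed_le (c : ℝ) (i : Fin 3) : IsClosed {y : stdSimplex ℝ (Fin 3) | y i ≤ c} :=
  isClosed_Iic.preimage (continuous_barycentric i)

/-- The corner of a triangle at which a point with a large coordinate lies, for points on a side. -/
theorem exists_end {s : Side} {i : Fin 3} (h : i ≠ s.opp) :
    ∃ end_ : Side → Fin 3, (end_ = Side.src ∨ end_ = Side.tgt) ∧ end_ s = i := by
  rcases s.eq_opp_or i with h' | h' | h'
  · exact absurd h' h
  · exact ⟨Side.src, Or.inl rfl, h'.symm⟩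
  · exact ⟨Side.tgt, Or.inr rfl, h'.symm⟩

theorem onSide_end {s s' : Side} {t : ℝ} {Y Z : B.Triangles} (hY : B.OnSide s t Y)
    (hZ : B.OnSide s' t Z) {end_ : Side → Fin 3} (hend : end_ = Side.src ∨ end_ = Side.tgt) :
    Y.2 (end_ s) = Z.2 (end_ s') := by
  rcases hend with rfl | rfl
  · rw [hY.2.2.1, hZ.2.2.1]
  · rw [hY.2.2.2, hZ.2.2.2]

/-- Neighbourhoods of the points over a vertex, in the direction of one layer. -/
def vertexPatch (v a : ℕ) (hne : ∃ k : Fin B.faces.length × Fin 3, B.HasLayer v a (k.1, k.2)) :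
    Patch P where
  ι := {k : Fin B.faces.length × Fin 3 // B.HasLayer v a (k.1, k.2)}
  nonempty := ⟨⟨hne.choose, hne.choose_spec⟩⟩
  face k := k.1.1
  corner k := k.1.2
  -- A coordinate above one half determines its corner, so the pieces at different corners of one
  -- triangle are disjoint.
  inner k := {y | 2 / 3 < y k.1.2}
  outer k := {y | 2 / 3 ≤ y k.1.2}
  vertex := v
  bot := a
  top := a
  isOpen_inner k := isOpen_gt _ _
  isClosed_outer k := isClosed_ge _ _
  inner_subset k := fun y (hy : 2 / 3 < y k.1.2) => hy.le
  vertex_eq k := k.2.2.1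
  bot_le k := k.2.2.2.1
  le_top k := k.2.2.2.2
  glue := by
    rintro ⟨⟨f, i⟩, hk⟩ ⟨⟨f', i'⟩, hk'⟩ y y' hy hy' h g g' hg hg' hgg hr
    simp only [mem_ofPred_eq] at *
    rcases hB.cases_of_toSurface_eq h with h | ⟨e, he, s, hs, s', hs', t, h0, h1, hp, hq⟩ |
      ⟨j, j', hj, hj', hv⟩
    · simp only [Sigma.mk.injEq] at h
      obtain ⟨rfl, h'⟩ := h
      obtain rfl := eq_of_heq h'
      obtain rfl : i = i' := eq_of_gt_half (by linarith) (lt_of_lt_of_le (by norm_num) hy')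
      obtain rfl := P.ext_corner f.2 hg hg' (mul_left_cancel₀ (Corner.eps_ne_zero _) hgg)
      rfl
    · have hi : i ≠ s.opp := by
        rintro rfl
        have h2 : y s.opp = 0 := hp.2.1
        rw [h2] at hy
        norm_num at hy
      obtain ⟨end_, hend, rfl⟩ := exists_end hi
      obtain rfl : end_ s' = i' := by
        have := onSide_end hp hq hend
        simp only at this
        exact eq_of_gt_half (y := y') (by linarith) (by linarith)
      refine P.point_eq_of_match hB he hs hs' hg hg' hp hq ?_
      refine P.match_of_end hB he hs hs' (hp.1 ▸ hg) (hq.1 ▸ hg') hend ?_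
      rw [← hp.1, ← hq.1]
      exact hgg
    · simp only at hj hj' hv
      obtain rfl : j = i := eq_of_gt_half (y := y) (by linarith) (by linarith)
      obtain rfl : j' = i' := eq_of_gt_half (y := y') (by linarith) (by linarith)
      refine hB.toNbhd_eq_of_atCorner (k := (f, j)) (l := (f', j')) hv ⟨rfl, hj, rfl⟩
        ⟨rfl, hj', ?_⟩
      rw [height_point, height_point, Code.sum_eq_of_eq_one hj, Code.sum_eq_of_eq_one hj']
      exact hgg.symm
  saturated := by
    rintro ⟨⟨f, i⟩, hk⟩ y hy g hg hr f' y' g' hg' h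
    simp only [mem_ofPred_eq] at *
    have fin : ∀ i', (B.corner f' i').vertex = (B.corner f i).vertex → 2 / 3 < y' i' →
        (B.corner f' i').eps * g' i' = (B.corner f i).eps * g i →
        ∃ j : {k : Fin B.faces.length × Fin 3 // B.HasLayer v a (k.1, k.2)}, j.1.1 = f' ∧
          2 / 3 < y' j.1.2 ∧ (B.corner f' j.1.2).eps * g' j.1.2 ∈
            Icc (2 * (a : ℝ)) (2 * (a : ℝ) + 1) := by
      intro i' hv hy' hgg
      have hrange := (Corner.mem_range_iff _ _).1 (P.mem_range f'.2 hg' i')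
      rw [hgg] at hrange
      have hl := layer_of_nat_height hrange.1 hrange.2 hr
      refine ⟨⟨(f', i'), f'.2, hv.trans hk.2.1, hl⟩, rfl, hy', ?_⟩
      simp only
      rw [hgg]
      exact hr
    rcases P.cases_of_point_eq hB h with ⟨rfl, rfl, rfl⟩ |
      ⟨e, he, s, hs, s', hs', t, h0, h1, hp, hq, hm⟩ | ⟨j, j', hj, hj', hv, hgg⟩
    · exact fin i rfl hy rfl
    · have hi : i ≠ s.opp := by
        rintro rfl
        have h2 : y s.opp = 0 := hp.2.1
        rw [h2] at hy
        norm_num at hy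
      obtain ⟨end_, hend, rfl⟩ := exists_end hi
      have hpf : (f : ℕ) = s.face := hp.1
      have hqf : (f' : ℕ) = s'.face := hq.1
      refine fin (end_ s') ?_ ?_ ?_
      · rw [hpf, hqf, hB.vertex_end he hend hs', hB.vertex_end he hend hs]
      · have := onSide_end hp hq hend
        simp only at this
        linarith
      · rw [hpf, hqf]
        exact (hm end_ hend).symm
    · obtain rfl : j = i := eq_of_gt_half (y := y) (by linarith) (by linarith)
      exact fin j' hv.symm (by linarith) hgg.symm

/-- Neighbourhoods of the points over the interior of an edge, in the direction of one of the
sheets opposite to `whole`. -/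
def edgePatch {e : Edge} (he : e ∈ B.edges) {s₀ : Side} (hs₀ : s₀ ∈ e.small) : Patch P where
  ι := {s : Side // s = e.whole ∨ s = s₀}
  fin := ((Set.finite_singleton s₀).insert e.whole).to_subtype
  nonempty := ⟨⟨s₀, Or.inr rfl⟩⟩
  face s := ⟨s.1.face, hB.face_lt he (by
    rcases s.2 with h | h
    · rw [h]; exact e.whole_mem_sides
    · rw [h]; exact Edge.small_mem_sides hs₀)⟩
  corner s := s.1.src
  -- As `1/10 < 1/5`, the small coordinate tells which side of the triangle is meant, and vertices
  -- are excluded.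
  inner s := {y | y s.1.opp < 1 / 10} ∩ ({y | 1 / 5 < y s.1.src} ∩ {y | 1 / 5 < y s.1.tgt})
  outer s := {y | y s.1.opp ≤ 1 / 10} ∩ ({y | 1 / 5 ≤ y s.1.src} ∩ {y | 1 / 5 ≤ y s.1.tgt})
  vertex := (B.corner e.whole.face e.whole.src).vertex
  bot := (B.corner s₀.face s₀.src).bot
  top := (B.corner s₀.face s₀.src).top
  isOpen_inner s := (isOpen_lt _ _).inter ((isOpen_gt _ _).inter (isOpen_gt _ _))
  isClosed_outer s := (isClosed_le _ _).inter ((isClosed_ge _ _).inter (isClosed_ge _ _))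
  inner_subset s := fun y hy => ⟨(mem_ofPred.1 hy.1).le, (mem_ofPred.1 hy.2.1).le,
    (mem_ofPred.1 hy.2.2).le⟩
  vertex_eq := by
    rintro ⟨s, rfl | rfl⟩
    · rfl
    · exact hB.vertex_end he (Or.inl rfl) (Edge.small_mem_sides hs₀)
  bot_le := by
    rintro ⟨s, rfl | rfl⟩
    · exact (hB.range_le he (Or.inl rfl) hs₀).1
    · exact le_rfl
  le_top := by
    rintro ⟨s, rfl | rfl⟩
    · exact (hB.range_le he (Or.inl rfl) hs₀).2
    · exact le_rfl
  glue := by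
    rintro ⟨s₁, h₁⟩ ⟨s₂, h₂⟩ y y' ⟨hy1, hy2, hy3⟩ ⟨hy1', hy2', hy3'⟩ h g g' hg hg' hgg hr
    simp only [mem_ofPred_eq] at *
    have m₁ : s₁ ∈ e.sides := by
      rcases h₁ with rfl | rfl
      · exact e.whole_mem_sides
      · exact Edge.small_mem_sides hs₀
    have m₂ : s₂ ∈ e.sides := by
      rcases h₂ with rfl | rfl
      · exact e.whole_mem_sides
      · exact Edge.small_mem_sides hs₀
    have opp : ∀ {s s' : Side} {y : stdSimplex ℝ (Fin 3)}, 1 / 5 ≤ y s.src → 1 / 5 ≤ y s.tgt →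
        y s'.opp ≤ 1 / 10 → s'.opp = s.opp := by
      intro s s' y h1 h2 h3
      rcases s.eq_opp_or s'.opp with h | h | h
      · exact h
      · rw [h] at h3; linarith
      · rw [h] at h3; linarith
    rcases hB.cases_of_toSurface_eq h with h | ⟨e', he', s, hs, s', hs', t, h0, h1, hp, hq⟩ |
      ⟨j, j', hj, hj', hv⟩
    · simp only [Sigma.mk.injEq] at h
      obtain ⟨hf, h⟩ := h
      obtain rfl := eq_of_heq h
      have hf' : s₁.face = s₂.face := congrArg Fin.val hf
      obtain ⟨-, rfl⟩ := hB.side_unique he he m₁ m₂ hf' (opp hy2' hy3' hy1)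
      obtain rfl := P.ext_corner (hB.face_lt he m₁) hg hg'
        (mul_left_cancel₀ (Corner.eps_ne_zero _) hgg)
      rfl
    · have hpo : y s.opp = 0 := hp.2.1
      have hqo : y' s'.opp = 0 := hq.2.1
      obtain ⟨rfl, rfl⟩ := hB.side_unique he' he hs m₁ hp.1.symm
        (opp hy2 hy3 (by rw [hpo]; norm_num))
      obtain ⟨-, rfl⟩ := hB.side_unique he' he' hs' m₂ hq.1.symm
        (opp hy2' hy3' (by rw [hqo]; norm_num))
      exact P.point_eq_of_match hB he hs hs' hg hg' hp hq
        (P.match_of_end hB he hs hs' hg hg' (Or.inl rfl) hgg)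
    · exfalso
      have h1 := Code.sum_eq_of_eq_one hj (fun k => if k = s₁.src then 1 else 0)
      have h2 := Code.sum_eq_of_eq_one hj (fun k => if k = s₁.tgt then 1 else 0)
      simp only [mul_ite, mul_one, mul_zero, Finset.sum_ite_eq', Finset.mem_univ, if_true] at h1 h2
      split_ifs at h1 h2 with c1 c2
      · exact s₁.src_ne_tgt (c1.symm.trans c2)
      all_goals linarith
  saturated := by
    rintro ⟨s₁, h₁⟩ y ⟨hy1, hy2, hy3⟩ g hg hr f' y' g' hg' h
    simp only [mem_ofPred_eq] at *
    have m₁ : s₁ ∈ e.sides := by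
      rcases h₁ with rfl | rfl
      · exact e.whole_mem_sides
      · exact Edge.small_mem_sides hs₀
    rcases P.cases_of_point_eq hB h with ⟨rfl, rfl, rfl⟩ |
      ⟨e', he', s, hs, s', hs', t, h0, h1, hp, hq, hm⟩ | ⟨j, j', hj, hj', hv, hgg⟩
    · exact ⟨⟨s₁, h₁⟩, rfl, ⟨hy1, hy2, hy3⟩, hr⟩
    · have hpo : y s.opp = 0 := hp.2.1
      have hopp : s.opp = s₁.opp := by
        rcases s₁.eq_opp_or s.opp with h | h | h
        · exact h
        · rw [h] at hpo; linarith
        · rw [h] at hpo; linarith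
      obtain ⟨rfl, rfl⟩ := hB.side_unique he' he hs m₁ hp.1.symm hopp
      have hqf : (f' : ℕ) = s'.face := hq.1
      have hr' : (B.corner s'.face s'.src).eps * g' s'.src ∈
          Icc (2 * ((B.corner s₀.face s₀.src).bot : ℝ))
            (2 * ((B.corner s₀.face s₀.src).top : ℝ) + 1) := by
        rw [← hm Side.src (Or.inl rfl)]
        exact hr
      -- The height lies in the range of `s₀`, which is disjoint from that of the other sheet.
      have hs₂ : s' = e'.whole ∨ s' = s₀ := by
        rcases Edge.mem_sides_iff.1 hs' with h | h
        · exact Or.inl h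
        · right
          exact hB.small_unique_end he h hs₀ (Or.inl rfl) ((Corner.mem_range_iff _ _).1
            (P.mem_range (hB.face_lt he hs') (hqf ▸ hg') s'.src)) hr'
      refine ⟨⟨s', hs₂⟩, Fin.ext hqf.symm, ⟨?_, ?_, ?_⟩, ?_⟩
      · have : y' s'.opp = 0 := hq.2.1
        simp only [mem_ofPred_eq]
        rw [this]; norm_num
      · have := onSide_end hp hq (Or.inl rfl)
        simp only [mem_ofPred_eq] at this ⊢
        linarith
      · have := onSide_end hp hq (Or.inr rfl)
        simp only [mem_ofPred_eq] at this ⊢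
        linarith
      · simp only
        rw [hqf]
        exact hr'
    · exfalso
      have h1 := Code.sum_eq_of_eq_one hj (fun k => if k = s₁.src then 1 else 0)
      have h2 := Code.sum_eq_of_eq_one hj (fun k => if k = s₁.tgt then 1 else 0)
      simp only [mul_ite, mul_one, mul_zero, Finset.sum_ite_eq', Finset.mem_univ, if_true] at h1 h2
      split_ifs at h1 h2 with c1 c2
      · exact s₁.src_ne_tgt (c1.symm.trans c2)
      all_goals linarith

theorem pos_of_interior {f : Fin B.faces.length} {y : stdSimplex ℝ (Fin 3)}
    (hy : ∀ i, 0 < y i) {Z : B.Triangles} (hB : B.IsBranchedSurface)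
    (h : B.toSurface ⟨f, y⟩ = B.toSurface Z) : Z = ⟨f, y⟩ := by
  rcases hB.cases_of_toSurface_eq h with h | ⟨e', he', s, hs, s', hs', t, h0, h1, hp, hq⟩ |
    ⟨j, j', hj, hj', hv⟩
  · exact h.symm
  · exact absurd hp.2.1 (hy _).ne'
  · exfalso
    have h1 := Code.sum_eq_of_eq_one hj (fun k => if k = j + 1 then 1 else 0)
    simp only [mul_ite, mul_one, mul_zero, Finset.sum_ite_eq', Finset.mem_univ, if_true] at h1
    have hne : ∀ j : Fin 3, j ≠ j + 1 := by decide
    rw [if_neg (hne j)] at h1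
    exact absurd h1 (hy _).ne'

/-- The points over the interior of a triangle. -/
def facePatch (f : Fin B.faces.length) : Patch P where
  ι := Unit
  face _ := f
  corner _ := 0
  inner _ := {y | 1 / 12 < y 0} ∩ ({y | 1 / 12 < y 1} ∩ {y | 1 / 12 < y 2})
  outer _ := {y | 1 / 12 ≤ y 0} ∩ ({y | 1 / 12 ≤ y 1} ∩ {y | 1 / 12 ≤ y 2})
  vertex := (B.corner f 0).vertex
  bot := (B.corner f 0).bot
  top := (B.corner f 0).top
  isOpen_inner s := (isOpen_gt _ _).inter ((isOpen_gt _ _).inter (isOpen_gt _ _))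
  isClosed_outer s := (isClosed_ge _ _).inter ((isClosed_ge _ _).inter (isClosed_ge _ _))
  inner_subset s := fun y hy => ⟨(mem_ofPred.1 hy.1).le, (mem_ofPred.1 hy.2.1).le,
    (mem_ofPred.1 hy.2.2).le⟩
  vertex_eq _ := rfl
  bot_le _ := le_rfl
  le_top _ := le_rfl
  glue := by
    rintro - - y y' ⟨h0, h1, h2⟩ - h g g' hg hg' hgg hr
    simp only [mem_ofPred_eq] at *
    have hpos : ∀ i, 0 < y i := fun i => by
      fin_cases i
      · exact lt_of_lt_of_le (by norm_num : (0 : ℝ) < 1 / 12) h0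
      · exact lt_of_lt_of_le (by norm_num : (0 : ℝ) < 1 / 12) h1
      · exact lt_of_lt_of_le (by norm_num : (0 : ℝ) < 1 / 12) h2
    have := pos_of_interior hpos hB h
    simp only [Sigma.mk.injEq, heq_eq_eq, true_and] at this
    subst this
    obtain rfl := P.ext_corner f.2 hg hg' (mul_left_cancel₀ (Corner.eps_ne_zero _) hgg)
    rfl
  saturated := by
    rintro - y ⟨h0, h1, h2⟩ g hg hr f' y' g' hg' h
    simp only [mem_ofPred_eq] at *
    have hpos : ∀ i, 0 < y i := fun i => by
      fin_cases i
      · exact lt_trans (by norm_num) h0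
      · exact lt_trans (by norm_num) h1
      · exact lt_trans (by norm_num) h2
    have := pos_of_interior hpos hB
      (congrArg B.proj h)
    simp only [foot_point, Sigma.mk.injEq] at this
    obtain ⟨rfl, h'⟩ := this
    obtain rfl := eq_of_heq h'
    exact ⟨(), rfl, ⟨h0, h1, h2⟩, (Corner.mem_range_iff _ _).1 (P.mem_range f'.2 hg' 0)⟩

include hB in
theorem exists_patch (x : P.Total) : ∃ (Q : Patch P) (j : Q.ι), x ∈ Q.cell j := by
  obtain ⟨f, y, g, hg⟩ := x
  by_cases hv : ∃ i, 2 / 3 < y i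
  · obtain ⟨i, hi⟩ := hv
    obtain ⟨a, ha⟩ := P.exists_layer _ _ (P.mem_pts f.2 hg i)
    have hrange := (Corner.mem_range_iff _ _).1 (P.mem_range f.2 hg i)
    have hl := layer_of_nat_height hrange.1 hrange.2 ha
    have hk : B.HasLayer (B.corner f i).vertex a (f, i) := ⟨f.2, rfl, hl⟩
    exact ⟨P.vertexPatch hB (B.corner f i).vertex a ⟨(f, i), hk⟩, ⟨(f, i), hk⟩, rfl, hi, ha⟩
  push Not at hv
  by_cases hf : ∀ i, 1 / 12 < y i
  · exact ⟨P.facePatch hB f, (), rfl, ⟨hf 0, hf 1, hf 2⟩,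
      (Corner.mem_range_iff _ _).1 (P.mem_range f.2 hg 0)⟩
  push Not at hf
  obtain ⟨i, hi⟩ := hf
  obtain ⟨e, he, s, hs, hsf, rfl⟩ := hB.exists_side f.2 i
  have hsum := s.barycentric_sum y
  have h1 := hv s.src
  have h2 := hv s.tgt
  -- The opposite coordinate is at most `1/12 < 1/10`, and the other two are at most `2/3`, hence at
  -- least `1 - 1/12 - 2/3 = 1/4 > 1/5`. So the three kinds of patches cover everything.
  have hin : y ∈ {y : stdSimplex ℝ (Fin 3) | y s.opp < 1 / 10} ∩
      ({y | 1 / 5 < y s.src} ∩ {y | 1 / 5 < y s.tgt}) :=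
    ⟨mem_ofPred.2 (by linarith), mem_ofPred.2 (by linarith), mem_ofPred.2 (by linarith)⟩
  rcases Edge.mem_sides_iff.1 hs with rfl | hs'
  · obtain ⟨s₀, hs₀, g', hg', h3, h4⟩ := P.exists_small hB he (g := g) (hsf.symm ▸ hg)
    have hss := Edge.small_mem_sides hs₀
    have hm := match_whole hB he hss h3 h4 Side.src (Or.inl rfl)
    refine ⟨P.edgePatch hB he hs₀, ⟨e.whole, Or.inl rfl⟩, Fin.ext hsf, hin, ?_⟩
    have := (Corner.mem_range_iff _ _).1 (P.mem_range (hB.face_lt he hss) hg' s₀.src)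
    rw [hm, hsf] at this
    exact this
  · refine ⟨P.edgePatch hB he hs', ⟨s, Or.inr rfl⟩, Fin.ext hsf, hin, ?_⟩
    have := (Corner.mem_range_iff _ _).1 (P.mem_range f.2 hg s.src)
    rw [← hsf] at this
    change (B.corner f s.src).eps * g s.src ∈ _
    rw [← hsf]
    exact this

theorem isCarriedLamination_support : B.IsCarriedLamination (P.support hB) :=
  P.isCarriedLamination_of_patches hB (P.exists_patch hB)

include hB in
theorem carriesLamination {f : ℕ} (hf : f < B.faces.length) (hne : (P.plaques f).Nonempty) :
    B.CarriesLamination := by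
  obtain ⟨g, hg⟩ := hne
  obtain ⟨y, -⟩ := Code.exists_eq_one 0
  exact ⟨_, P.isCarriedLamination_support hB, B.toNbhd (P.point ⟨f, hf⟩ y hg),
    P.onPlaque_point _ _ _⟩

include hB in
theorem fullyCarriesLamination (hne : ∀ f < B.faces.length, (P.plaques f).Nonempty) :
    B.FullyCarriesLamination := by
  refine ⟨_, P.isCarriedLamination_support hB, fun b => ?_⟩
  obtain ⟨⟨f, y⟩, rfl⟩ := Quot.exists_rep b
  obtain ⟨g, hg⟩ := hne f f.2
  exact ⟨B.toNbhd (P.point f y hg), P.onPlaque_point _ _ _, rfl⟩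

end PlaqueSystem

/-! ### Continuation of plaques -/

/-- A family of local product structures on the total space of `π : K → Y`, with plaques which are
sections of `π` over balls of a fixed radius. -/
structure LocalProduct {K Y : Type*} [TopologicalSpace K] [PseudoMetricSpace Y] (π : K → Y)
    (ι : Type*) (δ : ℝ) where
  dom : ι → Set K
  c : ι → K → ℝ
  isOpen_dom : ∀ i, IsOpen (dom i)
  inj : ∀ i, ∀ p ∈ dom i, ∀ q ∈ dom i, π p = π q → c i p = c i q → p = q
  compat : ∀ i j, ∀ p ∈ dom i, p ∈ dom j → ∀ᶠ q in 𝓝 p, (c i q = c i p ↔ c j q = c j p)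
  exists_section : ∀ p, ∃ i, p ∈ dom i ∧ ∃ σ : Y → K, ContinuousOn σ (Metric.ball (π p) δ) ∧
    ∀ y ∈ Metric.ball (π p) δ, π (σ y) = y ∧ σ y ∈ dom i ∧ c i (σ y) = c i p

namespace LocalProduct

variable {K Y : Type*} [TopologicalSpace K] [PseudoMetricSpace Y] {π : K → Y}
    {ι : Type*} {δ : ℝ} (A : LocalProduct π ι δ) {Z : Type*} [TopologicalSpace Z]

/-- A lift of `φ` along the plaques. -/
structure IsLift (φ : Z → Y) (G : Z → K) : Prop where
  continuous : Continuous G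
  lifts : ∀ z, π (G z) = φ z
  eventually_eq : ∀ z i, G z ∈ A.dom i → ∀ᶠ z' in 𝓝 z, A.c i (G z') = A.c i (G z)

variable {A}

/-- By compatibility of the charts, local constancy of the transversal coordinate needs to be
checked in one chart only. -/
theorem IsLift.of_exists {φ : Z → Y} {G : Z → K} (hG : Continuous G) (hl : ∀ z, π (G z) = φ z)
    (h : ∀ z, ∃ i, G z ∈ A.dom i ∧ ∀ᶠ z' in 𝓝 z, A.c i (G z') = A.c i (G z)) : A.IsLift φ G := by
  refine ⟨hG, hl, fun z j hj => ?_⟩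
  obtain ⟨i, hi, hc⟩ := h z
  filter_upwards [hc, hG.continuousAt.eventually (A.compat i j _ hi hj)] with z' h1 h2
  exact h2.1 h1

theorem IsLift.comp {φ : Z → Y} {G : Z → K} (h : A.IsLift φ G) {Z' : Type*} [TopologicalSpace Z']
    {k : Z' → Z} (hk : Continuous k) : A.IsLift (φ ∘ k) (G ∘ k) :=
  ⟨h.continuous.comp hk, fun _ => h.lifts _,
    fun z i hi => hk.continuousAt.eventually (h.eventually_eq (k z) i hi)⟩

/-- The set of agreement is closed, and it is open because near a common value both lifts keep the
same transversal coordinate in one chart, which is injective on the fibres of `π`. -/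
theorem IsLift.unique [T2Space K] [PreconnectedSpace Z] {φ : Z → Y} {G G' : Z → K}
    (h : A.IsLift φ G) (h' : A.IsLift φ G') {z₀ : Z} (h₀ : G z₀ = G' z₀) : G = G' := by
  have hclosed : IsClosed {z | G z = G' z} := isClosed_eq h.continuous h'.continuous
  have hopen : IsOpen {z | G z = G' z} := by
    rw [isOpen_iff_mem_nhds]
    intro z (hz : G z = G' z)
    obtain ⟨i, hi, -⟩ := A.exists_section (G z)
    filter_upwards [h.eventually_eq z i hi, h'.eventually_eq z i (hz ▸ hi),
      h.continuous.continuousAt.eventually ((A.isOpen_dom i).mem_nhds hi),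
      h'.continuous.continuousAt.eventually ((A.isOpen_dom i).mem_nhds (hz ▸ hi))]
      with z' h1 h2 h3 h4
    exact A.inj i _ h3 _ h4 ((h.lifts z').trans (h'.lifts z').symm) (by rw [h1, h2, hz])
  have := IsClopen.eq_univ ⟨hclosed, hopen⟩ ⟨z₀, h₀⟩
  funext z
  have h : z ∈ {z | G z = G' z} := by rw [this]; exact mem_univ z
  exact h

/-- Continuation of a lift along a small homotopy. -/
theorem IsLift.exists_of_dist_lt [T2Space K] (hδ : 0 < δ) (hπ : Continuous π)
    (hball : ∀ a b : Y, IsPreconnected (Metric.ball a δ ∩ Metric.ball b δ)) {φ ψ : Z → Y}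
    (hψ : Continuous ψ) (hd : ∀ z, dist (ψ z) (φ z) < δ) {G : Z → K} (h : A.IsLift φ G) :
    ∃ G' : Z → K, A.IsLift ψ G' ∧ ∀ z, ψ z = φ z → G' z = G z := by
  have hφ : Continuous φ := by
    have : φ = π ∘ G := funext fun z => (h.lifts z).symm
    rw [this]; exact hπ.comp h.continuous
  choose i hi σ hσc hσ using A.exists_section
  have hself : ∀ p, σ p (π p) = p := by
    intro p
    have := hσ p (π p) (Metric.mem_ball_self hδ)
    exact A.inj (i p) _ this.2.1 _ (hi p) this.1 this.2.2
  have hlift : ∀ p, A.IsLift (fun y : Metric.ball (π p) δ => (y : Y)) (fun y => σ p y) := by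
    intro p
    refine IsLift.of_exists (continuousOn_iff_continuous_domRestrict.1 (hσc p))
      (fun y => (hσ p y y.2).1) fun y => ⟨i p, (hσ p y y.2).2.1, Filter.Eventually.of_forall
      fun y' => ?_⟩
    rw [(hσ p y y.2).2.2, (hσ p y' y'.2).2.2]
  have hmem : ∀ z, ψ z ∈ Metric.ball (π (G z)) δ := by
    intro z
    rw [h.lifts z]
    exact hd z
  -- The sections through `G z` and through the nearby `G z'` agree over `φ z'`, hence by uniqueness
  -- of lifts on the connected intersection of their balls, which contains `ψ z'`.
  have key : ∀ z, ∀ᶠ z' in 𝓝 z, ψ z' ∈ Metric.ball (π (G z)) δ ∧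
      σ (G z') (ψ z') = σ (G z) (ψ z') := by
    intro z
    have hi' := hi (G z)
    filter_upwards [h.eventually_eq z (i (G z)) hi',
      h.continuous.continuousAt.eventually ((A.isOpen_dom _).mem_nhds hi'),
      hφ.continuousAt.eventually (Metric.ball_mem_nhds (φ z) hδ),
      hψ.continuousAt.eventually (Metric.isOpen_ball.mem_nhds (hmem z))] with z' h1 h2 h3 h4
    refine ⟨h4, ?_⟩
    rw [← h.lifts z] at h3
    have e1 : σ (G z) (φ z') = G z' := by
      have := hσ (G z) (φ z') h3
      exact A.inj _ _ this.2.1 _ h2 (this.1.trans (h.lifts z').symm) (this.2.2.trans h1.symm)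
    have e2 : σ (G z') (φ z') = G z' := by
      rw [← h.lifts z', hself]
    set V := Metric.ball (π (G z)) δ ∩ Metric.ball (π (G z')) δ
    have : PreconnectedSpace V := isPreconnected_iff_preconnectedSpace.1 (hball _ _)
    have l1 : A.IsLift (fun y : V => (y : Y)) (fun y => σ (G z) y) :=
      (hlift (G z)).comp (k := fun y : V => ⟨y.1, y.2.1⟩) (by fun_prop)
    have l2 : A.IsLift (fun y : V => (y : Y)) (fun y => σ (G z') y) :=
      (hlift (G z')).comp (k := fun y : V => ⟨y.1, y.2.2⟩) (by fun_prop)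
    have m1 : φ z' ∈ V := ⟨h3, by rw [h.lifts]; exact Metric.mem_ball_self hδ⟩
    have m2 : ψ z' ∈ V := ⟨h4, hmem z'⟩
    have := l1.unique l2 (z₀ := ⟨φ z', m1⟩) (e1.trans e2.symm)
    exact (congrFun this ⟨ψ z', m2⟩).symm
  refine ⟨fun z => σ (G z) (ψ z), IsLift.of_exists ?_ ?_ ?_, ?_⟩
  · rw [continuous_iff_continuousAt]
    intro z
    have hc : ContinuousAt (fun z' => σ (G z) (ψ z')) z :=
      ContinuousAt.comp (f := ψ) ((hσc (G z)).continuousAt (Metric.isOpen_ball.mem_nhds (hmem z)))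
        hψ.continuousAt
    exact hc.congr ((key z).mono fun z' hz' => hz'.2.symm)
  · exact fun z => (hσ (G z) _ (hmem z)).1
  · intro z
    refine ⟨i (G z), (hσ (G z) _ (hmem z)).2.1, (key z).mono fun z' hz' => ?_⟩
    rw [hz'.2, (hσ (G z) _ hz'.1).2.2, (hσ (G z) _ (hmem z)).2.2]
  · intro z hz
    simp only
    rw [hz, ← h.lifts z, hself]

/-- Continuation of a lift along a sequence of small homotopies. -/
theorem IsLift.exists_of_chain [T2Space K] (hδ : 0 < δ) (hπ : Continuous π)
    (hball : ∀ a b : Y, IsPreconnected (Metric.ball a δ ∩ Metric.ball b δ)) (φ : ℕ → Z → Y)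
    (hφ : ∀ n, Continuous (φ n)) {G : Z → K} (h : A.IsLift (φ 0) G) {z₀ : Z} (N : ℕ)
    (hd : ∀ n < N, ∀ z, dist (φ (n + 1) z) (φ n z) < δ) (h₀ : ∀ n, φ n z₀ = φ 0 z₀) :
    ∃ G' : Z → K, A.IsLift (φ N) G' ∧ G' z₀ = G z₀ := by
  induction N with
  | zero => exact ⟨G, h, rfl⟩
  | succ N ih =>
    obtain ⟨G₁, h1, h2⟩ := ih fun n hn => hd n (by omega)
    obtain ⟨G₂, h3, h4⟩ := h1.exists_of_dist_lt hδ hπ hball (hφ (N + 1)) (hd N (by omega))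
    exact ⟨G₂, h3, by rw [h4 z₀ (by rw [h₀ (N + 1), h₀ N]), h2]⟩

end LocalProduct

/-! ### The standard simplex -/

theorem isPreconnected_inter_ball (a b : stdSimplex ℝ (Fin 3)) (δ : ℝ) :
    IsPreconnected (Metric.ball a δ ∩ Metric.ball b δ) := by
  have hind : IsInducing (Subtype.val : stdSimplex ℝ (Fin 3) → Fin 3 → ℝ) := IsInducing.subtypeVal
  rw [← hind.isPreconnected_image]
  have : Subtype.val '' (Metric.ball a δ ∩ Metric.ball b δ) =
      stdSimplex ℝ (Fin 3) ∩ (Metric.ball a.1 δ ∩ Metric.ball b.1 δ) := by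
    ext x
    constructor
    · rintro ⟨y, hy, rfl⟩
      exact ⟨y.2, hy⟩
    · rintro ⟨hx, hx'⟩
      exact ⟨⟨x, hx⟩, hx', rfl⟩
  rw [this]
  exact ((convex_stdSimplex ℝ (Fin 3)).inter
    ((convex_ball a.1 δ).inter (convex_ball b.1 δ))).isPreconnected

instance : PreconnectedSpace (stdSimplex ℝ (Fin 3)) :=
  isPreconnected_iff_preconnectedSpace.1 (convex_stdSimplex ℝ (Fin 3)).isPreconnected

/-- The homothety of the simplex with centre `a`. -/
def homothety (a : stdSimplex ℝ (Fin 3)) (t : unitInterval) (y : stdSimplex ℝ (Fin 3)) :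
    stdSimplex ℝ (Fin 3) :=
  ⟨(1 - (t : ℝ)) • a.1 + (t : ℝ) • y.1,
    convex_stdSimplex ℝ (Fin 3) a.2 y.2 (by linarith [t.2.2]) t.2.1 (by ring)⟩

theorem continuous_homothety (a : stdSimplex ℝ (Fin 3)) (t : unitInterval) :
    Continuous (homothety a t) := by
  have : Continuous fun y : stdSimplex ℝ (Fin 3) => (1 - (t : ℝ)) • a.1 + (t : ℝ) • y.1 := by
    fun_prop
  exact this.subtype_mk _

theorem dist_homothety (a y : stdSimplex ℝ (Fin 3)) (s t : unitInterval) :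
    dist (homothety a s y) (homothety a t y) = |(s : ℝ) - t| * dist y a := by
  rw [Subtype.dist_eq, Subtype.dist_eq, dist_eq_norm, dist_eq_norm, ← Real.norm_eq_abs,
    ← norm_smul]
  congr 1
  unfold homothety
  simp only
  module

theorem homothety_self (a : stdSimplex ℝ (Fin 3)) (t : unitInterval) : homothety a t a = a := by
  apply Subtype.ext
  unfold homothety
  simp only
  module

theorem dense_interior : Dense {y : stdSimplex ℝ (Fin 3) | ∀ i, 0 < y i} := by
  intro y
  rw [Metric.mem_closure_iff]
  intro ε hε
  let a : stdSimplex ℝ (Fin 3) := ⟨fun _ => 1 / 3, fun _ => by norm_num, by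
    rw [Fin.sum_univ_three]; norm_num⟩
  set r : ℝ := min 1 (ε / (2 * (dist y a + 1))) with hr
  have hd : 0 < dist y a + 1 := by positivity
  have hr0 : 0 < r := lt_min one_pos (by positivity)
  have hr1 : r ≤ 1 := min_le_left _ _
  have hr2 : r ≤ ε / (2 * (dist y a + 1)) := min_le_right _ _
  let t : unitInterval := ⟨1 - r, by constructor <;> linarith⟩
  refine ⟨homothety a t y, fun i => ?_, ?_⟩
  · change 0 < (1 - (1 - r)) * (1 / 3) + (1 - r) * y i
    have := mul_nonneg (sub_nonneg.2 hr1) (barycentric_nonneg y i)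
    linarith
  · have h1 : homothety a 1 y = y := by
      apply Subtype.ext
      unfold homothety
      simp
    have h2 := dist_homothety a y 1 t
    rw [h1] at h2
    rw [h2]
    change |1 - (1 - r)| * dist y a < ε
    rw [sub_sub_cancel, abs_of_pos hr0]
    rw [le_div_iff₀ (by positivity)] at hr2
    nlinarith [dist_nonneg (x := y) (y := a)]

namespace LocalProduct

/-- The simplex is contracted to `π p` by homotheties. Over the constant map the constant `p` is a
lift, and `N > D / δ` equal steps, each moving points by less than `δ`, lead to the identity. All
the homotheties fix `π p`, so the value there remains `p`. -/
theorem exists_global {K : Type*} [TopologicalSpace K] [T2Space K]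
    {π : K → stdSimplex ℝ (Fin 3)} {ι : Type*} {δ : ℝ} (A : LocalProduct π ι δ) (hδ : 0 < δ)
    (hπ : Continuous π) (p : K) :
    ∃ G : stdSimplex ℝ (Fin 3) → K, A.IsLift id G ∧ G (π p) = p := by
  obtain ⟨D, hD⟩ := Metric.isBounded_iff.1 (Metric.isBounded_of_compactSpace
    (s := (univ : Set (stdSimplex ℝ (Fin 3)))))
  have hD' : ∀ y : stdSimplex ℝ (Fin 3), dist y (π p) ≤ D := fun y => hD (mem_univ _) (mem_univ _)
  have hD0 : 0 ≤ D := dist_nonneg.trans (hD' (π p))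
  obtain ⟨N, hN⟩ := exists_nat_gt (D / δ)
  have hN0 : (0 : ℝ) < N := lt_of_le_of_lt (by positivity) hN
  let τ : ℕ → unitInterval := fun n => projIcc 0 1 zero_le_one ((n : ℝ) / N)
  have hτ : ∀ n ≤ N, (τ n : ℝ) = n / N := by
    intro n hn
    have h1 : (n : ℝ) ≤ N := by exact_mod_cast hn
    have h2 : (n : ℝ) / N ∈ Icc (0 : ℝ) 1 := ⟨by positivity, (div_le_one hN0).2 h1⟩
    change ((projIcc (0 : ℝ) 1 zero_le_one ((n : ℝ) / N) : unitInterval) : ℝ) = _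
    rw [projIcc_of_mem zero_le_one h2]
  have h0 : A.IsLift (homothety (π p) (τ 0)) (fun _ => p) := by
    refine ⟨continuous_const, fun z => ?_, fun z i hi => Filter.Eventually.of_forall fun _ => rfl⟩
    apply Subtype.ext
    unfold homothety
    simp [hτ 0 (Nat.zero_le _)]
  obtain ⟨G, hG, hGp⟩ := h0.exists_of_chain hδ hπ (fun a b => isPreconnected_inter_ball a b δ)
    (fun n => homothety (π p) (τ n)) (fun n => continuous_homothety _ _) (z₀ := π p) N
    (fun n hn z => by
      rw [dist_homothety, hτ _ hn, hτ _ hn.le]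
      have : ((n + 1 : ℕ) : ℝ) / N - n / N = 1 / N := by push_cast; ring
      rw [this, abs_of_pos (by positivity)]
      calc 1 / (N : ℝ) * dist z (π p) ≤ 1 / N * D := by gcongr; exact hD' z
        _ < δ := by
          rw [div_lt_iff₀ hδ] at hN
          rw [one_div, inv_mul_lt_iff₀ hN0]
          linarith)
    (fun n => by rw [homothety_self, homothety_self])
  refine ⟨G, ?_, hGp⟩
  have : homothety (π p) (τ N) = id := by
    funext y
    apply Subtype.ext
    unfold homothety
    simp [hτ N le_rfl, div_self hN0.ne']
  rwa [this] at hG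

end LocalProduct

/-! ### The plaques of a lamination over a triangle -/

/-- The part of a subset of `N(B)` over a triangle. -/
abbrev Over {B : Code} (S : Set B.Nbhd) (f : Fin B.faces.length) : Type :=
  {q : B.Prism f // B.toNbhd ⟨f, q⟩ ∈ S}

namespace Over

variable {B : Code} {S : Set B.Nbhd} {f : Fin B.faces.length}

def point (k : Over S f) : B.Prisms := ⟨f, k.1⟩

def foot (k : Over S f) : stdSimplex ℝ (Fin 3) := k.1.1.1

def height (k : Over S f) : ℝ := k.1.1.2

theorem continuous_point : Continuous (point : Over S f → B.Prisms) :=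
  (continuous_sigmaMk (σ := fun f : Fin B.faces.length => B.Prism f) (i := f)).comp
    continuous_subtype_val

theorem continuous_foot : Continuous (foot : Over S f → _) :=
  continuous_fst.comp (continuous_subtype_val.comp continuous_subtype_val)

theorem continuous_height : Continuous (height : Over S f → ℝ) :=
  continuous_snd.comp (continuous_subtype_val.comp continuous_subtype_val)

theorem continuous_toNbhd : Continuous fun k : Over S f => B.toNbhd k.point :=
  Code.IsBranchedSurface.continuous_toNbhd.comp continuous_point

theorem ext {k l : Over S f} (h1 : k.foot = l.foot) (h2 : k.height = l.height) : k = l :=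
  Subtype.ext (Subtype.ext (Prod.ext h1 h2))

theorem ext_toNbhd (hB : B.IsBranchedSurface) {k l : Over S f} (h1 : k.foot = l.foot)
    (h2 : B.toNbhd k.point = B.toNbhd l.point) : k = l :=
  ext h1 (hB.height_eq_of_toNbhd_eq h2 (Sigma.ext rfl (heq_of_eq h1)))

theorem inPrism (k : Over S f) : B.InPrism f k.foot k.height := k.1.2

theorem compactSpace (hS : IsClosed S) : CompactSpace (Over S f) := by
  have hprism : CompactSpace (B.Prism f) := by
    refine isCompact_iff_compactSpace.1 ?_
    set M : ℝ := ∑ i, (|(B.corner f i).lo| + |(B.corner f i).hi|) with hM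
    have hcl : IsClosed {z : stdSimplex ℝ (Fin 3) × ℝ |
        ∑ i, z.1 i * (B.corner f i).lo ≤ z.2 ∧ z.2 ≤ ∑ i, z.1 i * (B.corner f i).hi} := by
      have h : ∀ c : Fin 3 → ℝ, Continuous fun z : stdSimplex ℝ (Fin 3) × ℝ => ∑ i, z.1 i * c i :=
        fun c => continuous_finsetSum _ fun i _ =>
          ((continuous_barycentric i).comp continuous_fst).mul continuous_const
      exact (isClosed_le (h _) continuous_snd).inter (isClosed_le continuous_snd (h _))
    refine IsCompact.of_isClosed_subset (isCompact_univ.prod (isCompact_Icc (a := -M) (b := M)))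
      hcl ?_
    rintro ⟨y, η⟩ ⟨h1, h2⟩
    have hy : ∀ i, 0 ≤ y i ∧ y i ≤ 1 := fun i =>
      ⟨barycentric_nonneg y i, by
        have := barycentric_sum y
        have h0 := barycentric_nonneg y 0
        have h1 := barycentric_nonneg y 1
        have h2 := barycentric_nonneg y 2
        fin_cases i <;> simp only [Fin.zero_eta, Fin.mk_one, Fin.reduceFinMk] <;> linarith⟩
    have hb : ∀ c : Fin 3 → ℝ, |∑ i, y i * c i| ≤ ∑ i, |c i| := fun c =>
      (Finset.abs_sum_le_sum_abs _ _).trans (Finset.sum_le_sum fun i _ => by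
        rw [abs_mul, abs_of_nonneg (hy i).1]
        exact mul_le_of_le_one_left (abs_nonneg _) (hy i).2)
    have hlo := abs_le.1 (hb fun i => (B.corner f i).lo)
    have hhi := abs_le.1 (hb fun i => (B.corner f i).hi)
    have hp : ∀ c : Fin 3 → ℝ, 0 ≤ ∑ i, |c i| := fun c => Finset.sum_nonneg fun i _ => abs_nonneg _
    have p1 := hp fun i => (B.corner f i).lo
    have p2 := hp fun i => (B.corner f i).hi
    rw [Finset.sum_add_distrib] at hM
    refine ⟨mem_univ _, ?_, ?_⟩ <;> simp only at h1 h2 ⊢ <;> linarith [hlo.1, hhi.2]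
  have hc : IsClosed {q : B.Prism f | B.toNbhd ⟨f, q⟩ ∈ S} :=
    hS.preimage (Code.IsBranchedSurface.continuous_toNbhd.comp
      (continuous_sigmaMk (σ := fun f : Fin B.faces.length => B.Prism f) (i := f)))
  exact isCompact_iff_compactSpace.1 hc.isCompact

/-- The foot has to be recorded, since sides of the same triangle may be glued and a point of `N(B)`
may then occur several times over it. -/
theorem isClosedEmbedding (hB : B.IsBranchedSurface) (hS : IsClosed S) :
    IsClosedEmbedding fun k : Over S f => (B.toNbhd k.point, k.foot) := by
  have := compactSpace (f := f) hS
  have := hB.t2Space_nbhd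
  exact (continuous_toNbhd.prodMk continuous_foot).isClosedEmbedding fun k l h =>
    ext_toNbhd hB (congrArg Prod.snd h) (congrArg Prod.fst h)

end Over

namespace FlowBox

variable {B : Code} {S : Set B.Nbhd} (α : FlowBox B S)

open Classical in
/-- The transversal coordinate. -/
noncomputable def coord (n : B.Nbhd) : ℝ :=
  if h : n ∈ S ∩ α.dom then ((α.chart ⟨n, h⟩).2 : ℝ) else 0

theorem coord_of_mem {n : B.Nbhd} (h : n ∈ S ∩ α.dom) : α.coord n = (α.chart ⟨n, h⟩).2 := dif_pos h

theorem eq_of_coord_eq {n n' : B.Nbhd} (h : n ∈ S ∩ α.dom) (h' : n' ∈ S ∩ α.dom)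
    (h1 : B.proj n = B.proj n') (h2 : α.coord n = α.coord n') : n = n' := by
  rw [α.coord_of_mem h, α.coord_of_mem h'] at h2
  have h3 : α.chart ⟨n, h⟩ = α.chart ⟨n', h'⟩ := by
    refine Prod.ext (Subtype.ext ?_) (Subtype.ext h2)
    rw [α.chart_fst, α.chart_fst]
    exact h1
  exact congrArg Subtype.val (α.chart.injective h3)

theorem Compatible.eventually {α β : FlowBox B S} (h : α.Compatible β) {p : B.Nbhd}
    (ha : p ∈ S ∩ α.dom) (hb : p ∈ S ∩ β.dom) :
    ∀ᶠ q in 𝓝 p, q ∈ S → (α.coord q = α.coord p ↔ β.coord q = β.coord p) := by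
  filter_upwards [h p ha hb, α.isOpen_dom.mem_nhds ha.2, β.isOpen_dom.mem_nhds hb.2]
    with q hq h1 h2 hS
  rw [α.coord_of_mem ⟨hS, h1⟩, β.coord_of_mem ⟨hS, h2⟩, α.coord_of_mem ha, β.coord_of_mem hb]
  simpa only [Subtype.ext_iff] using hq ⟨hS, h1⟩ ⟨hS, h2⟩

/-- The plaque of a flow box through a point, over a set contained in the base. -/
theorem exists_plaque (hB : B.IsBranchedSurface) (hS : IsClosed S) {f : Fin B.faces.length}
    {U : Set (stdSimplex ℝ (Fin 3))} (hU : IsOpen U) (hUb : ∀ y ∈ U, B.toSurface ⟨f, y⟩ ∈ α.base)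
    (k : Over S f) (hk : B.toNbhd k.point ∈ α.dom) :
    ∃ σ : stdSimplex ℝ (Fin 3) → Over S f, ContinuousOn σ U ∧ ∀ y ∈ U, (σ y).foot = y ∧
      B.toNbhd (σ y).point ∈ α.dom ∧
      α.coord (B.toNbhd (σ y).point) = α.coord (B.toNbhd k.point) := by
  classical
  set c := (α.chart ⟨B.toNbhd k.point, k.2, hk⟩).2 with hc
  let n : U → ↥(S ∩ α.dom) := fun y => α.chart.symm (⟨B.toSurface ⟨f, y.1⟩, hUb y y.2⟩, c)
  have hcont : Continuous n := by
    refine α.chart.symm.continuous.comp ?_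
    refine Continuous.prodMk (Continuous.subtype_mk ?_ _) continuous_const
    exact Code.IsBranchedSurface.continuous_toSurface.comp
      ((continuous_sigmaMk (σ := fun _ : Fin B.faces.length => stdSimplex ℝ (Fin 3))
        (i := f)).comp continuous_subtype_val)
  have hproj : ∀ y, B.proj (n y) = B.toSurface ⟨f, y.1⟩ := fun y => by
    rw [← α.chart_fst, Homeomorph.apply_symm_apply]
  have hcn : ∀ y, α.coord (n y) = c := fun y => by
    rw [α.coord_of_mem (n y).2, Subtype.coe_eta, Homeomorph.apply_symm_apply]
  have hemb := Over.isClosedEmbedding (f := f) hB hS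
  -- The plaque of the chart is a curve of points of `N(B)`, to be lifted to the prism over `f` with
  -- prescribed feet. Over interior points of the triangle the foot is unique and the lift exists;
  -- the set where it exists is closed, so density of the interior gives the rest.
  have hcl : IsClosed {y : U | ((n y : B.Nbhd), (y : stdSimplex ℝ (Fin 3))) ∈
      range fun k : Over S f => (B.toNbhd k.point, k.foot)} :=
    hemb.isClosed_range.preimage
      ((continuous_subtype_val.comp hcont).prodMk continuous_subtype_val)
  have hdense : Dense {y : U | ∀ i, 0 < (y : stdSimplex ℝ (Fin 3)) i} :=
    dense_interior.preimage hU.isOpenMap_subtype_val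
  have hall : ∀ y : U, ∃ l : Over S f, B.toNbhd l.point = n y ∧ l.foot = y := by
    have : {y : U | ∀ i, 0 < (y : stdSimplex ℝ (Fin 3)) i} ⊆
        {y : U | ((n y : B.Nbhd), (y : stdSimplex ℝ (Fin 3))) ∈
          range fun k : Over S f => (B.toNbhd k.point, k.foot)} := by
      intro y hy
      obtain ⟨q, hq⟩ := Quot.exists_rep (n y : B.Nbhd)
      change B.toNbhd q = n y at hq
      have h1 : B.toSurface ⟨f, y.1⟩ = B.toSurface (B.foot q) := by
        rw [← hproj, ← hq]; rfl
      have h2 := PlaqueSystem.pos_of_interior hy hB h1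
      obtain ⟨f', q⟩ := q
      obtain rfl : f' = f := congrArg Sigma.fst h2
      refine ⟨⟨q, hq ▸ (n y).2.1⟩, Prod.ext hq ?_⟩
      exact eq_of_heq (Sigma.mk.inj_iff.1 h2).2
    intro y
    have h2 := hcl.closure_subset_iff.2 this
    rw [hdense.closure_eq] at h2
    obtain ⟨l, hl⟩ := h2 (mem_univ y)
    exact ⟨l, congrArg Prod.fst hl, congrArg Prod.snd hl⟩
  choose l hl1 hl2 using hall
  refine ⟨fun y => if h : y ∈ U then l ⟨y, h⟩ else k, ?_, fun y hy => ?_⟩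
  · rw [continuousOn_iff_continuous_domRestrict]
    have : U.domRestrict (fun y => if h : y ∈ U then l ⟨y, h⟩ else k) = l := by
      funext y
      exact dif_pos y.2
    rw [this, hemb.continuous_iff]
    have h3 : (fun k : Over S f => (B.toNbhd k.point, k.foot)) ∘ l =
        fun y : U => ((n y : B.Nbhd), (y : stdSimplex ℝ (Fin 3))) := by
      funext y
      exact Prod.ext (hl1 y) (hl2 y)
    rw [h3]
    exact (continuous_subtype_val.comp hcont).prodMk continuous_subtype_val
  · simp only [hy, dif_pos]
    refine ⟨hl2 _, ?_, ?_⟩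
    · rw [hl1]; exact (n ⟨y, hy⟩).2.2
    · rw [hl1, hcn]; exact (α.coord_of_mem ⟨k.2, hk⟩).symm

end FlowBox

/-! ### The local product structure of a lamination over one triangle. -/

namespace Over

variable {B : Code} {S : Set B.Nbhd} {A : Set (FlowBox B S)} (hB : B.IsBranchedSurface)
  (hS : IsClosed S) (hA : ∀ p ∈ S, ∃ α ∈ A, p ∈ α.dom)
  (hA' : ∀ α ∈ A, ∀ β ∈ A, α.Compatible β)

include hB hS hA in
-- Near each point a plaque of fixed size is provided by `base_spreads`; compactness of the part of
-- `S` over the triangle makes the size uniform.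
theorem exists_section (f : Fin B.faces.length) : ∃ δ > 0, ∀ k : Over S f, ∃ α : A,
    B.toNbhd k.point ∈ α.1.dom ∧ ∃ σ : stdSimplex ℝ (Fin 3) → Over S f,
      ContinuousOn σ (Metric.ball k.foot δ) ∧ ∀ y ∈ Metric.ball k.foot δ, (σ y).foot = y ∧
        B.toNbhd (σ y).point ∈ α.1.dom ∧
        α.1.coord (B.toNbhd (σ y).point) = α.1.coord (B.toNbhd k.point) := by
  have := compactSpace (f := f) hS
  have key : ∃ δ > 0, ∀ k ∈ (univ : Set (Over S f)), ∃ α : A,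
    B.toNbhd k.point ∈ α.1.dom ∧ ∃ σ : stdSimplex ℝ (Fin 3) → Over S f,
      ContinuousOn σ (Metric.ball k.foot δ) ∧ ∀ y ∈ Metric.ball k.foot δ, (σ y).foot = y ∧
        B.toNbhd (σ y).point ∈ α.1.dom ∧
        α.1.coord (B.toNbhd (σ y).point) = α.1.coord (B.toNbhd k.point) := by
    refine isCompact_univ.induction_on (p := fun s : Set (Over S f) => ∃ δ > 0, ∀ k ∈ s, ∃ α : A,
      B.toNbhd k.point ∈ α.1.dom ∧ ∃ σ : stdSimplex ℝ (Fin 3) → Over S f,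
        ContinuousOn σ (Metric.ball k.foot δ) ∧ ∀ y ∈ Metric.ball k.foot δ, (σ y).foot = y ∧
          B.toNbhd (σ y).point ∈ α.1.dom ∧
          α.1.coord (B.toNbhd (σ y).point) = α.1.coord (B.toNbhd k.point)) ?_ ?_ ?_ ?_
    · exact ⟨1, one_pos, fun k hk => hk.elim⟩
    · rintro s t hst ⟨δ, hδ, h⟩
      exact ⟨δ, hδ, fun k hk => h k (hst hk)⟩
    · rintro s t ⟨δ, hδ, h⟩ ⟨δ', hδ', h'⟩
      refine ⟨min δ δ', lt_min hδ hδ', ?_⟩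
      rintro k (hk | hk)
      · obtain ⟨α, h1, σ, h2, h3⟩ := h k hk
        have hsub := Metric.ball_subset_ball (x := k.foot) (min_le_left δ δ')
        exact ⟨α, h1, σ, h2.mono hsub, fun y hy => h3 y (hsub hy)⟩
      · obtain ⟨α, h1, σ, h2, h3⟩ := h' k hk
        have hsub := Metric.ball_subset_ball (x := k.foot) (min_le_right δ δ')
        exact ⟨α, h1, σ, h2.mono hsub, fun y hy => h3 y (hsub hy)⟩
    · intro k _
      obtain ⟨α, hα, hk⟩ := hA _ k.2
      have hspread : ∀ᶠ y in 𝓝 k.foot, B.toSurface ⟨f, y⟩ ∈ α.base :=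
        (continuous_sigmaMk (σ := fun _ : Fin B.faces.length => stdSimplex ℝ (Fin 3))
          (i := f)).continuousAt.eventually (α.base_spreads k.point ⟨k.2, hk⟩)
      obtain ⟨r, hr, hball⟩ := Metric.mem_nhds_iff.1 hspread
      -- Half of the radius is spent on moving the centre, the other half remains for the ball.
      refine ⟨{l | B.toNbhd l.point ∈ α.dom ∧ l.foot ∈ Metric.ball k.foot (r / 2)},
        mem_nhdsWithin_of_mem_nhds (Filter.inter_mem
          ((α.isOpen_dom.preimage continuous_toNbhd).mem_nhds hk)
          (continuous_foot.continuousAt.preimage_mem_nhds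
            (Metric.ball_mem_nhds _ (by positivity)))), r / 2, by positivity, ?_⟩
      rintro l ⟨hl, hl'⟩
      refine ⟨⟨α, hα⟩, hl, ?_⟩
      refine α.exists_plaque hB hS Metric.isOpen_ball (fun y hy => hball ?_) l hl
      rw [Metric.mem_ball] at hl' hy ⊢
      linarith [dist_triangle y l.foot k.foot]
  obtain ⟨δ, hδ, h⟩ := key
  exact ⟨δ, hδ, fun k => h k (mem_univ k)⟩

/-- The local product structure of a lamination over a triangle. -/
noncomputable def localProduct (f : Fin B.faces.length) :
    LocalProduct (foot : Over S f → _) A (exists_section hB hS hA f).choose where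
  dom α := {k | B.toNbhd k.point ∈ α.1.dom}
  c α k := α.1.coord (B.toNbhd k.point)
  isOpen_dom α := α.1.isOpen_dom.preimage continuous_toNbhd
  inj α k hk l hl h1 h2 := by
    refine ext_toNbhd hB h1 (α.1.eq_of_coord_eq ⟨k.2, hk⟩ ⟨l.2, hl⟩ ?_ h2)
    change B.toSurface ⟨f, k.foot⟩ = B.toSurface ⟨f, l.foot⟩
    rw [h1]
  compat α β k hk hk' := by
    filter_upwards [continuous_toNbhd.continuousAt.eventually
      ((hA' α α.2 β β.2).eventually ⟨k.2, hk⟩ ⟨k.2, hk'⟩)] with l hl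
    exact hl l.2
  exists_section := (exists_section hB hS hA f).choose_spec.2

end Over

/-- A vertex of the standard triangle. -/
noncomputable def vtx (i : Fin 3) : stdSimplex ℝ (Fin 3) :=
  (Code.exists_eq_one i).choose

theorem vtx_self (i : Fin 3) : vtx i i = 1 := (Code.exists_eq_one i).choose_spec

/-- A property which differs at the ends of a chain changes along one of its links. -/
theorem exists_of_eqvGen {X : Type*} {r : X → X → Prop} {p : X → Prop} {x y : X}
    (h : Relation.EqvGen r x y) (hx : p x) (hy : ¬ p y) :
    ∃ u w, r u w ∧ (p u ∧ ¬ p w ∨ ¬ p u ∧ p w) := by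
  by_contra hcon
  push Not at hcon
  have : ∀ x y, Relation.EqvGen r x y → (p x ↔ p y) := by
    intro x y h
    induction h with
    | rel u w huw =>
      have := hcon u w huw
      tauto
    | refl => rfl
    | symm _ _ _ ih => exact ih.symm
    | trans _ _ _ _ _ ih1 ih2 => exact ih1.trans ih2
  exact hy ((this x y h).1 hx)

/-- Over a vertex, a subset of `N(B)` which misses the vertical boundary lies in the layers. -/
theorem exists_layer_of_disjoint {B : Code} (hB : B.IsBranchedSurface) {S : Set B.Nbhd}
    (hd : Disjoint S B.verticalBoundary) {k : ℕ × Fin 3} {h : ℝ} {p : B.Prisms}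
    (hp : B.AtCorner k h p) (hS : B.toNbhd p ∈ S) :
    ∃ a : ℕ, 2 * (a : ℝ) ≤ h ∧ h ≤ 2 * (a : ℝ) + 1 := by
  have hr := hp.mem_range
  have h0 : 0 ≤ h := le_trans (by positivity) hr.1
  obtain ⟨a, ha | ha⟩ := exists_layer_or_gap h0
  · exact ⟨a, ha⟩
  exfalso
  have hbt := layer_of_gap_height hr.1 hr.2 ha
  have hkf : k.1 < B.faces.length := by rw [← hp.1]; exact p.1.2
  obtain ⟨hv, -, htop⟩ := hB.corner_fits k.1 hkf k.2
  set v := (B.corner k.1 k.2).vertex with hvdef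
  have hk0 : B.HasLayer v a k := ⟨hkf, rfl, hbt.1, by omega⟩
  have hk1 : B.HasLayer v (a + 1) k := ⟨hkf, rfl, by omega, hbt.2⟩
  obtain ⟨-, l, hl0, hl1⟩ := hB.cusp v hv a (by omega)
  -- The corners containing layer `a` are connected, and by `cusp` one of them lacks layer `a + 1`.
  -- Where this layer is lost between adjacent corners, the cusp is open; the point seen there will
  -- turn out to be in the vertical boundary.
  obtain ⟨x, y, ⟨hx, hy, hxy⟩, hor⟩ := exists_of_eqvGen
    (p := fun k => B.HasLayer v (a + 1) k) ((hB.layer_disc v hv a (by omega)).2 k hk0 l hl0) hk1 hl1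
  obtain ⟨e, he, s, hs, hends⟩ := hxy
  obtain ⟨end_, hend, t, hxe, hye, hside⟩ : ∃ end_ : Side → Fin 3,
      (end_ = Side.src ∨ end_ = Side.tgt) ∧ ∃ t : ℝ, x = (e.whole.face, end_ e.whole) ∧
        y = (s.face, end_ s) ∧ ∀ (s' : Side) (Y : B.Triangles), (Y.1 : ℕ) = s'.face →
          (B.OnSide s' t Y ↔ Y.2 (end_ s') = 1) := by
    have key : ∀ (s' : Side) (Y : B.Triangles) (t : ℝ), B.OnSide s' t Y →
      Y.2 s'.src = 1 - t ∧ Y.2 s'.tgt = t := fun s' Y t h => ⟨h.2.2.1, h.2.2.2⟩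
    rcases hends with ⟨h1, h2⟩ | ⟨h1, h2⟩
    · exact ⟨Side.src, Or.inl rfl, 0, h1, h2, fun s' Y hY =>
        ⟨fun h => by rw [h.2.2.1, sub_zero], fun h => Code.onSide_src hY h⟩⟩
    · exact ⟨Side.tgt, Or.inr rfl, 1, h1, h2, fun s' Y hY =>
        ⟨fun h => h.2.2.2, fun h => Code.onSide_tgt hY h⟩⟩
  subst hxe hye
  have hrange := hB.range_le he hend hs
  -- The range of a sheet lies within that of `whole`, so the layer is lost in passing from `whole`
  -- to the sheet.
  obtain ⟨hx1, hy1⟩ : B.HasLayer v (a + 1) (e.whole.face, end_ e.whole) ∧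
      ¬ B.HasLayer v (a + 1) (s.face, end_ s) := by
    rcases hor with hor | ⟨hor, hor'⟩
    · exact hor
    · exact absurd ⟨hx.1, hx.2.1, hrange.1.trans hor'.2.2.1, hor'.2.2.2.trans hrange.2⟩ hor
  have hrangeW : 2 * ((B.corner e.whole.face (end_ e.whole)).bot : ℝ) ≤ h ∧
      h ≤ 2 * ((B.corner e.whole.face (end_ e.whole)).top : ℝ) + 1 := by
    have h1 : ((B.corner e.whole.face (end_ e.whole)).bot : ℝ) ≤ a := by exact_mod_cast hx.2.2.1
    have h2 : (a + 1 : ℝ) ≤ (B.corner e.whole.face (end_ e.whole)).top := by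
      exact_mod_cast hx1.2.2.2
    constructor <;> linarith
  obtain ⟨q, hq⟩ := Code.exists_atCorner (B := B) (k := (e.whole.face, end_ e.whole)) hx.1 hrangeW
  have hqS : B.toNbhd q ∈ S := by
    rw [hB.toNbhd_eq_of_atCorner (k := (e.whole.face, end_ e.whole)) (l := k) hx.2.1 hq hp]
    exact hS
  refine hd.notMem_of_mem_left hqS ⟨e, he, t, q, rfl, (hside _ _ hq.1).2 hq.2.1, ?_⟩
  rintro s' hs' r ⟨⟨t', h1, h2⟩, h3⟩
  have ht : t' = t := by
    have := (hside _ _ hq.1).2 hq.2.1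
    rw [← h1.2.2.2, ← this.2.2.2]
  subst ht
  have hr : B.AtCorner (s'.face, end_ s') h r := by
    refine ⟨h2.1, (hside _ _ h2.1).1 h2, ?_⟩
    rw [h3, hB.sign_eq_end he hend (Edge.small_mem_sides hs'), ← hq.2.2]
    have e1 := (B.corner s'.face (end_ s')).eps_mul_eps
    linear_combination (B.corner e.whole.face (end_ e.whole)).eps * B.height q * e1
  have hrr := hr.mem_range
  have hl := layer_of_gap_height hrr.1 hrr.2 ha
  -- A sheet glued to the point would contain both layers `a` and `a + 1`; sharing layer `a` with
  -- `s` it would be `s`, which lacks `a + 1`.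
  have hs's : s = s' := by
    refine hB.small_unique_end he hs hs' hend (h := 2 * (a : ℝ)) ?_ ?_
    · have h1 : ((B.corner s.face (end_ s)).bot : ℝ) ≤ a := by exact_mod_cast hy.2.2.1
      have h2 : (a : ℝ) ≤ (B.corner s.face (end_ s)).top := by exact_mod_cast hy.2.2.2
      constructor <;> linarith
    · have h1 : ((B.corner s'.face (end_ s')).bot : ℝ) ≤ a := by exact_mod_cast hl.1
      have h2 : (a + 1 : ℝ) ≤ (B.corner s'.face (end_ s')).top := by exact_mod_cast hl.2
      constructor <;> linarith
  subst hs's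
  exact hy1 ⟨hy.1, hy.2.1, hl.1.trans (by omega), hl.2⟩

/-- A bounded totally ordered family of triples with closed projections is compact. -/
theorem isCompact_of_lt_of_lt {T : Set (Fin 3 → ℝ)}
    (hlt : ∀ g ∈ T, ∀ g' ∈ T, ∀ i j, g i < g' i → g j < g' j)
    (hT : ∀ i, IsCompact ((fun g : Fin 3 → ℝ => g i) '' T)) : IsCompact T := by
  have hsub : T ⊆ univ.pi fun i => (fun g : Fin 3 → ℝ => g i) '' T :=
    fun g hg i _ => ⟨g, hg, rfl⟩
  refine (isCompact_univ_pi hT).of_isClosed_subset ?_ hsub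
  rw [← closure_subset_iff_isClosed]
  intro g hg
  have hproj : ∀ i, ∃ k ∈ T, k i = g i := fun i =>
    closure_minimal hsub (isClosed_set_pi fun i _ => (hT i).isClosed) hg i (mem_univ i)
  have happ : ∀ U : Set (Fin 3 → ℝ), IsOpen U → g ∈ U → ∃ k ∈ T, k ∈ U := fun U hU hgU => by
    obtain ⟨k, hk, hk'⟩ := mem_closure_iff.1 hg U hU hgU
    exact ⟨k, hk', hk⟩
  have hI : ∀ (i : Fin 3) (c : ℝ), IsOpen {k : Fin 3 → ℝ | c < k i} := fun i c =>
    isOpen_lt continuous_const (continuous_apply i)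
  have hI' : ∀ (i : Fin 3) (c : ℝ), IsOpen {k : Fin 3 → ℝ | k i < c} := fun i c =>
    isOpen_lt (continuous_apply i) continuous_const
  obtain ⟨k, hk, hk0⟩ := hproj 0
  -- If the member `k` agreeing with the limit `g` at corner `0` lay below it at corner `j`, some
  -- member `m` would lie above `g` at `0` and below `g` at `j`. Members close to `g` would then be
  -- on different sides of `m` at the two corners.
  have : k = g := by
    funext j
    obtain ⟨l, hl, hlj⟩ := hproj j
    rcases lt_trichotomy (k j) (g j) with h | h | h
    · have h1 : g 0 < l 0 := hk0 ▸ hlt k hk l hl j 0 (hlj ▸ h)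
      obtain ⟨m, hm, hm1, hm2⟩ := happ _ ((hI j (k j)).inter (hI' 0 (l 0))) ⟨h, h1⟩
      have h2 : g 0 < m 0 := hk0 ▸ hlt k hk m hm j 0 hm1
      have h3 : m j < g j := hlj ▸ hlt m hm l hl 0 j hm2
      obtain ⟨n, hn, hn1, hn2⟩ := happ _ ((hI j (m j)).inter (hI' 0 (m 0))) ⟨h3, h2⟩
      exact absurd (hlt m hm n hn j 0 hn1) (lt_asymm hn2)
    · exact h
    · have h1 : l 0 < g 0 := hk0 ▸ hlt l hl k hk j 0 (hlj ▸ h)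
      obtain ⟨m, hm, hm1, hm2⟩ := happ _ ((hI' j (k j)).inter (hI 0 (l 0))) ⟨h, h1⟩
      have h2 : m 0 < g 0 := hk0 ▸ hlt m hm k hk j 0 hm1
      have h3 : g j < m j := hlj ▸ hlt l hl m hm 0 j hm2
      obtain ⟨n, hn, hn1, hn2⟩ := happ _ ((hI' j (m j)).inter (hI 0 (m 0))) ⟨h3, h2⟩
      exact absurd (hlt n hn m hm j 0 hn1) (lt_asymm hn2)
  exact this ▸ hk

/-! ### Plaques over whole triangles and their continuation across edges. -/

namespace Over

variable {B : Code} {S : Set B.Nbhd} {A : Set (FlowBox B S)} (hB : B.IsBranchedSurface)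
  (hS : IsClosed S) (hA : ∀ p ∈ S, ∃ α ∈ A, p ∈ α.dom)
  (hA' : ∀ α ∈ A, ∀ β ∈ A, α.Compatible β)

/-- The plaques over a triangle. -/
def IsPlaque {f : Fin B.faces.length} (G : stdSimplex ℝ (Fin 3) → Over S f) : Prop :=
  (localProduct hB hS hA hA' f).IsLift id G

variable {hB hS hA hA'}

theorem exists_isPlaque {f : Fin B.faces.length} (k : Over S f) :
    ∃ G : stdSimplex ℝ (Fin 3) → Over S f, IsPlaque hB hS hA hA' G ∧ G k.foot = k := by
  have := hB.t2Space_nbhd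
  exact (localProduct hB hS hA hA' f).exists_global (exists_section hB hS hA f).choose_spec.1
    continuous_foot k

theorem IsPlaque.foot_apply {f : Fin B.faces.length} {G : stdSimplex ℝ (Fin 3) → Over S f}
    (h : IsPlaque hB hS hA hA' G) (y : stdSimplex ℝ (Fin 3)) : (G y).foot = y := h.lifts y

theorem IsPlaque.eq {f : Fin B.faces.length} {G G' : stdSimplex ℝ (Fin 3) → Over S f}
    (h : IsPlaque hB hS hA hA' G) (h' : IsPlaque hB hS hA hA' G') {y : stdSimplex ℝ (Fin 3)}
    (hy : (G y).height = (G' y).height) : G = G' :=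
  LocalProduct.IsLift.unique h h' (z₀ := y)
    (ext ((h.foot_apply y).trans (h'.foot_apply y).symm) hy)

/-- By the intermediate value theorem a change of order would make two plaques meet, and plaques
which meet are equal. -/
theorem IsPlaque.lt {f : Fin B.faces.length} {G G' : stdSimplex ℝ (Fin 3) → Over S f}
    (h : IsPlaque hB hS hA hA' G) (h' : IsPlaque hB hS hA hA' G') {y z : stdSimplex ℝ (Fin 3)}
    (hy : (G y).height < (G' y).height) : (G z).height < (G' z).height := by
  by_contra hz
  push Not at hz
  have c : Continuous fun y => (G y).height := continuous_height.comp h.continuous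
  have c' : Continuous fun y => (G' y).height := continuous_height.comp h'.continuous
  obtain ⟨w, -, hw⟩ := isPreconnected_univ.intermediate_value₂ (mem_univ y) (mem_univ z)
    c.continuousOn c'.continuousOn hy.le hz
  rw [h.eq h' hw] at hy
  exact lt_irrefl _ hy

theorem atCorner {f : Fin B.faces.length} (k : Over S f) {i : Fin 3} (hk : k.foot = vtx i) :
    B.AtCorner (f, i) ((B.corner f i).eps * k.height) k.point := by
  refine ⟨rfl, ?_, rfl⟩
  change k.foot i = 1
  rw [hk, vtx_self]

/-- The lift of a side which is glued to the boundary of a plaque. -/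
theorem IsPlaque.exists_whole {e : Edge} (he : e ∈ B.edges) {s : Side} (hs : s ∈ e.small)
    {f fw : Fin B.faces.length} (hf : (f : ℕ) = s.face) (hfw : (fw : ℕ) = e.whole.face)
    {G : stdSimplex ℝ (Fin 3) → Over S f} (h : IsPlaque hB hS hA hA' G) :
    ∃ G' : stdSimplex ℝ (Fin 3) → Over S fw, IsPlaque hB hS hA hA' G' ∧
      (G' (vtx e.whole.src)).height = B.sign e s * (G (vtx s.src)).height ∧
      (G' (vtx e.whole.tgt)).height = B.sign e s * (G (vtx s.tgt)).height := by
  have := hB.t2Space_nbhd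
  have hss := Edge.small_mem_sides hs
  let γ : Side → unitInterval → stdSimplex ℝ (Fin 3) := fun s t => homothety (vtx s.src) t (vtx s.tgt)
  have hγ : ∀ (s : Side) (f : Fin B.faces.length) (t : unitInterval), (f : ℕ) = s.face →
      B.OnSide s t ⟨f, γ s t⟩ := by
    intro s f t hf
    have key : ∀ i, (γ s t) i = (1 - (t : ℝ)) * vtx s.src i + t * vtx s.tgt i := fun i => rfl
    have hz : ∀ {i j : Fin 3}, j ≠ i → vtx i j = 0 := by
      intro i j hij
      have h1 := barycentric_sum (vtx i)
      have h2 := vtx_self i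
      have hn := fun j => barycentric_nonneg (vtx i) j
      have n0 := hn 0
      have n1 := hn 1
      have n2 := hn 2
      fin_cases i <;> fin_cases j <;>
        simp only [Fin.zero_eta, Fin.mk_one, Fin.reduceFinMk, ne_eq, not_true_eq_false] at * <;>
        linarith
    refine ⟨hf, ?_, ?_, ?_⟩
    · change (γ s t) s.opp = 0
      rw [key, hz s.opp_ne_src, hz s.opp_ne_tgt, mul_zero, mul_zero, add_zero]
    · change (γ s t) s.src = _
      rw [key, vtx_self, hz s.src_ne_tgt, mul_zero, add_zero, mul_one]
    · change (γ s t) s.tgt = _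
      rw [key, vtx_self, hz s.src_ne_tgt.symm, mul_zero, zero_add, mul_one]
  have hγc : ∀ s, Continuous (γ s) := by
    intro s
    have : Continuous fun t : unitInterval =>
        (1 - (t : ℝ)) • (vtx s.src).1 + (t : ℝ) • (vtx s.tgt).1 := by fun_prop
    exact this.subtype_mk _
  have hγ0 : ∀ s, γ s 0 = vtx s.src := by
    intro s
    apply Subtype.ext
    simp only [γ, homothety]
    simp
  have hγ1 : ∀ s, γ s 1 = vtx s.tgt := by
    intro s
    apply Subtype.ext
    simp only [γ, homothety]
    simp
  have hin : ∀ t : unitInterval, B.InPrism fw (γ e.whole t) (B.sign e s * (G (γ s t)).height) := by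
    intro t
    refine hB.inPrism_whole he hss (hγ e.whole fw t hfw) (hγ s f t hf) ?_
    have := (G (γ s t)).inPrism
    rwa [h.foot_apply] at this
  have hnb : ∀ t, B.toNbhd (⟨fw, ⟨(γ e.whole t, B.sign e s * (G (γ s t)).height), hin t⟩⟩ :
      B.Prisms) = B.toNbhd (G (γ s t)).point := by
    intro t
    refine Code.toNbhd_eq_of_whole he hss (hγ e.whole fw t hfw) ?_ rfl
    have := hγ s f t hf
    rw [← h.foot_apply (γ s t)] at this
    exact this
  -- The boundary of the plaque along `s`, transported to the prism over `whole`, is a lift of the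
  -- side. By uniqueness of lifts it is the boundary of the plaque through its initial point.
  let H : unitInterval → Over S fw := fun t =>
    ⟨⟨(γ e.whole t, B.sign e s * (G (γ s t)).height), hin t⟩, by
      rw [hnb]; exact (G (γ s t)).2⟩
  have hH : (localProduct hB hS hA hA' fw).IsLift (γ e.whole) H := by
    refine ⟨?_, fun t => rfl, fun t α hα => ?_⟩
    · refine Continuous.subtype_mk (Continuous.subtype_mk ((hγc _).prodMk ?_) _) _
      exact continuous_const.mul (continuous_height.comp (h.continuous.comp (hγc s)))
    · have hα' : G (γ s t) ∈ (localProduct hB hS hA hA' f).dom α := by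
        have h1 : B.toNbhd (H t).point ∈ α.1.dom := hα
        have h2 : B.toNbhd (G (γ s t)).point ∈ α.1.dom := by
          rw [← hnb]
          exact h1
        exact h2
      filter_upwards [(hγc s).continuousAt.eventually (h.eventually_eq (γ s t) α hα')] with t' ht'
      change α.1.coord (B.toNbhd _) = α.1.coord (B.toNbhd _) at ht' ⊢
      refine (congrArg α.1.coord (hnb t')).trans (ht'.trans (congrArg α.1.coord (hnb t)).symm)
  obtain ⟨G', hG', hG'0⟩ := exists_isPlaque (hB := hB) (hS := hS) (hA := hA) (hA' := hA') (H 0)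
  have hcomp : G' ∘ γ e.whole = H := by
    refine LocalProduct.IsLift.unique (LocalProduct.IsLift.comp hG' (hγc e.whole)) hH (z₀ := 0) ?_
    exact hG'0
  refine ⟨G', hG', ?_, ?_⟩
  · rw [← hγ0 e.whole, ← hγ0 s]
    exact congrArg height (congrFun hcomp 0)
  · rw [← hγ1 e.whole, ← hγ1 s]
    exact congrArg height (congrFun hcomp 1)

end Over

/-- The plaque system of a carried lamination. -/
theorem Code.IsCarriedLamination.exists_plaqueSystem {B : Code} (hB : B.IsBranchedSurface)
    {S : Set B.Nbhd} (h : B.IsCarriedLamination S) : ∃ P : PlaqueSystem B,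
      ∀ p : B.Prisms, B.toNbhd p ∈ S → (P.plaques p.1).Nonempty := by
  obtain ⟨hS, hd, A, hA, hA'⟩ := h
  set pts : ℕ → Set ℝ := fun v => {x | ∃ (k : ℕ × Fin 3) (p : B.Prisms),
    (B.corner k.1 k.2).vertex = v ∧ B.AtCorner k x p ∧ B.toNbhd p ∈ S} with hpts
  set plaques : ℕ → Set (Fin 3 → ℝ) := fun f => {g | ∃ (hf : f < B.faces.length)
    (G : stdSimplex ℝ (Fin 3) → Over S ⟨f, hf⟩), Over.IsPlaque hB hS hA hA' G ∧
      ∀ i, g i = (G (vtx i)).height} with hplaques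
  have hex : ∀ (f : Fin B.faces.length) (k : Over S f), ∃ g ∈ plaques f,
      ∀ i, k.foot = vtx i → g i = k.height := by
    intro f k
    obtain ⟨G, hG, hGk⟩ := Over.exists_isPlaque (hB := hB) (hS := hS) (hA := hA) (hA' := hA') k
    refine ⟨fun i => (G (vtx i)).height, ⟨f.2, G, hG, fun i => rfl⟩, fun i hi => ?_⟩
    simp only
    rw [← hi, hGk]
  have hlt : ∀ f < B.faces.length, ∀ g ∈ plaques f, ∀ g' ∈ plaques f, ∀ i j,
      g i < g' i → g j < g' j := by
    rintro f hf g ⟨_, G, hG, hg⟩ g' ⟨_, G', hG', hg'⟩ i j hij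
    rw [hg, hg'] at hij ⊢
    exact hG.lt hG' hij
  have hiff : ∀ f < B.faces.length, ∀ i x,
      (∃ g ∈ plaques f, (B.corner f i).eps * g i = x) ↔ x ∈ pts (B.corner f i).vertex ∧
      2 * ((B.corner f i).bot : ℝ) ≤ x ∧ x ≤ 2 * ((B.corner f i).top : ℝ) + 1 := by
    intro f hf i x
    constructor
    · rintro ⟨g, ⟨_, G, hG, hg⟩, rfl⟩
      rw [hg]
      have hc := Over.atCorner (G (vtx i)) (hG.foot_apply _)
      exact ⟨⟨_, _, rfl, hc, (G (vtx i)).2⟩, hc.mem_range⟩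
    · rintro ⟨⟨k, p, hv, hp, hpS⟩, hr⟩
      obtain ⟨⟨f', q⟩, hq⟩ := Code.exists_atCorner (B := B) (k := (f, i)) hf hr
      obtain rfl : f' = ⟨f, hf⟩ := Fin.ext hq.1
      have hqS : B.toNbhd ⟨⟨f, hf⟩, q⟩ ∈ S := by
        rw [hB.toNbhd_eq_of_atCorner (k := (f, i)) (l := k) hv.symm hq hp]
        exact hpS
      obtain ⟨g, hg, hgi⟩ := hex ⟨f, hf⟩ ⟨q, hqS⟩
      exact ⟨g, hg, by rw [hgi i (Code.eq_of_eq_one hq.2.1 (vtx_self i))]; exact hq.2.2⟩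
  refine ⟨⟨pts, plaques, ?_, ?_, hlt, hiff, ?_⟩, ?_⟩
  · intro f hf
    refine isCompact_of_lt_of_lt (hlt f hf) fun i => ?_
    have := Over.compactSpace (f := ⟨f, hf⟩) hS
    have hc : IsCompact {k : Over S ⟨f, hf⟩ | k.foot = vtx i} :=
      (isClosed_eq Over.continuous_foot continuous_const).isCompact
    convert hc.image Over.continuous_height using 1
    ext x
    constructor
    · rintro ⟨g, ⟨_, G, hG, hg⟩, rfl⟩
      exact ⟨G (vtx i), hG.foot_apply _, (hg i).symm⟩
    · rintro ⟨k, hk, rfl⟩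
      obtain ⟨g, hg, hgi⟩ := hex ⟨f, hf⟩ k
      exact ⟨g, hg, hgi i hk⟩
  · rintro v x ⟨k, p, -, hp, hpS⟩
    exact exists_layer_of_disjoint hB hd hp hpS
  · rintro e he s hs g ⟨hf, G, hG, hg⟩
    obtain ⟨G', hG', h1, h2⟩ := hG.exists_whole he hs rfl
      (fw := ⟨_, hB.face_lt he e.whole_mem_sides⟩) rfl
    exact ⟨fun i => (G' (vtx i)).height, ⟨_, G', hG', fun i => rfl⟩, h1.trans (by rw [hg]),
      h2.trans (by rw [hg])⟩
  · rintro ⟨f, q⟩ hp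
    obtain ⟨g, hg, -⟩ := hex f ⟨q, hp⟩
    exact ⟨g, hg⟩

theorem Code.IsBranchedSurface.carriesLamination_iff {B : Code} (hB : B.IsBranchedSurface) :
    B.CarriesLamination ↔
      ∃ P : PlaqueSystem B, ∃ f < B.faces.length, (P.plaques f).Nonempty := by
  constructor
  · rintro ⟨S, hS, n, hn⟩
    obtain ⟨P, hP⟩ := hS.exists_plaqueSystem hB
    obtain ⟨p, rfl⟩ := Quot.exists_rep n
    exact ⟨P, p.1, p.1.2, hP p hn⟩
  · rintro ⟨P, f, hf, hne⟩
    exact P.carriesLamination hB hf hne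

theorem Code.IsBranchedSurface.fullyCarriesLamination_iff {B : Code} (hB : B.IsBranchedSurface) :
    B.FullyCarriesLamination ↔
      ∃ P : PlaqueSystem B, ∀ f < B.faces.length, (P.plaques f).Nonempty := by
  constructor
  · rintro ⟨S, hS, hfull⟩
    obtain ⟨P, hP⟩ := hS.exists_plaqueSystem hB
    refine ⟨P, fun f hf => ?_⟩
    -- Over an interior point of a triangle the foot is unique, so meeting the fibre there means
    -- meeting the prism of this triangle.
    obtain ⟨y, hy⟩ := dense_interior.nonempty (X := stdSimplex ℝ (Fin 3))
    obtain ⟨n, hn, hproj⟩ := hfull (B.toSurface ⟨⟨f, hf⟩, y⟩)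
    obtain ⟨p, rfl⟩ := Quot.exists_rep n
    have : B.foot p = ⟨⟨f, hf⟩, y⟩ := PlaqueSystem.pos_of_interior hy hB hproj.symm
    have h1 : p.1 = ⟨f, hf⟩ := congrArg Sigma.fst this
    have := hP p hn
    rwa [h1] at this
  · rintro ⟨P, hP⟩
    exact P.fullyCarriesLamination hB hP

/-! ### Countable total preorders -/

theorem le_of_hasSum_geometric {d : ℕ → ℝ} {s : ℝ}
    (h : HasSum (fun z : ℕ => 1 / 2 * (1 / 2 : ℝ) ^ z * d z) s) (hd : ∀ z, d z ≤ 1) {N : ℕ}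
    (hN : ∀ z < N, d z = 0) : s ≤ (1 / 2) ^ N := by
  have hg : HasSum (fun z : ℕ => (1 / 2 : ℝ) ^ N * (1 / 2 * (1 / 2) ^ z)) ((1 / 2) ^ N) := by
    have := (hasSum_geometric_two.mul_left (1 / 2 : ℝ)).mul_left ((1 / 2 : ℝ) ^ N)
    norm_num at this ⊢
    exact this
  have hs : HasSum (fun z : ℕ => 1 / 2 * (1 / 2 : ℝ) ^ (z + N) * d (z + N)) s := by
    rw [hasSum_nat_add_iff (f := fun z : ℕ => 1 / 2 * (1 / 2 : ℝ) ^ z * d z)]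
    rwa [Finset.sum_eq_zero fun z hz => by rw [hN z (Finset.mem_range.1 hz), mul_zero], add_zero]
  refine hasSum_le (fun z => ?_) hs hg
  have : (0 : ℝ) ≤ (1 / 2) ^ N * (1 / 2 * (1 / 2) ^ z) := by positivity
  calc 1 / 2 * (1 / 2 : ℝ) ^ (z + N) * d (z + N) = (1 / 2) ^ N * (1 / 2 * (1 / 2) ^ z) * d (z + N) := by
        rw [pow_add]; ring
    _ ≤ _ := mul_le_of_le_one_right this (hd _)

/-- A countable total preorder embeds in the unit interval in such a way that its points become
isolated, and different points of the closure are separated by points of the preorder. -/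
theorem exists_embedding (X : Set ℕ) (r : ℕ → ℕ → Prop) (htotal : ∀ x ∈ X, ∀ y ∈ X, r x y ∨ r y x)
    (htrans : ∀ x y z, r x y → r y z → r x z) : ∃ h : ℕ → ℝ, (∀ x, 0 ≤ h x ∧ h x ≤ 1) ∧
      (∀ x ∈ X, ∀ y ∈ X, h x ≤ h y ↔ r x y) ∧
      (∀ x ∈ X, ∃ ε > 0, ∀ y ∈ X, (h y < h x → h y + ε ≤ h x) ∧ (h x < h y → h x + ε ≤ h y)) ∧
      ∀ g ∈ closure (h '' X), ∀ g' ∈ closure (h '' X), g < g' →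
        ∃ x ∈ X, g ≤ h x ∧ h x ≤ g' := by
  classical
  let w : ℕ → ℝ := fun z => 1 / 2 * (1 / 2) ^ z
  -- The weight of `z` is split: one half is counted from `z` itself onwards, the other half only
  -- strictly above `z`. So there is a jump just below and another one just above every point, which
  -- isolates it.
  let c : ℕ → ℕ → ℝ := fun x z =>
    (if z ∈ X ∧ r z x then 1 / 2 else 0) + (if z ∈ X ∧ ¬ r x z then 1 / 2 else 0)
  have hw0 : ∀ z, 0 < w z := fun z => by positivity
  have hws : Summable w := summable_geometric_two.mul_left _
  have hw1 : ∑' z, w z = 1 := by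
    rw [tsum_mul_left, tsum_geometric_two]; norm_num
  have hc0 : ∀ x z, 0 ≤ c x z := fun x z => by positivity
  have hc1 : ∀ x z, c x z ≤ 1 := fun x z => by
    simp only [c]; split_ifs <;> norm_num
  have hsum : ∀ x, Summable fun z => w z * c x z := fun x =>
    Summable.of_nonneg_of_le (fun z => mul_nonneg (hw0 z).le (hc0 x z))
      (fun z => mul_le_of_le_one_right (hw0 z).le (hc1 x z)) hws
  let h : ℕ → ℝ := fun x => ∑' z, w z * c x z
  have hsub : ∀ x y, HasSum (fun z => w z * (c y z - c x z)) (h y - h x) := fun x y => by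
    have := (hsum y).hasSum.sub (hsum x).hasSum
    simpa only [mul_sub] using this
  have hmono : ∀ x y, r x y → ∀ z, 0 ≤ c y z - c x z := by
    intro x y hxy z
    have h1 : z ∈ X ∧ r z x → z ∈ X ∧ r z y := fun h => ⟨h.1, htrans _ _ _ h.2 hxy⟩
    have h2 : z ∈ X ∧ ¬ r x z → z ∈ X ∧ ¬ r y z := fun h =>
      ⟨h.1, fun hyz => h.2 (htrans _ _ _ hxy hyz)⟩
    simp only [c]
    split_ifs <;> first | (exfalso; tauto) | norm_num
  have hle : ∀ x y, r x y → h x ≤ h y := fun x y hxy => by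
    have := (hsub x y).nonneg fun z => mul_nonneg (hw0 z).le (hmono x y hxy z)
    linarith
  have hrefl : ∀ x ∈ X, r x x := fun x hx => (htotal x hx x hx).elim id id
  have hgap : ∀ x ∈ X, ∀ y ∈ X, ¬ r y x → h x + w x / 2 ≤ h y ∧ h x + w y / 2 ≤ h y := by
    intro x hx y hy hyx
    have hxy : r x y := (htotal x hx y hy).resolve_right hyx
    have hterm : ∀ z, w z * (c y z - c x z) ≤ h y - h x := fun z => by
      rw [← (hsub x y).tsum_eq]
      exact (hsub x y).summable.le_tsum z fun z _ => mul_nonneg (hw0 z).le (hmono x y hxy z)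
    have h1 := hterm x
    have h2 := hterm y
    have e1 : c y x - c x x = 1 / 2 := by
      simp only [c, hx, hxy, hyx, hrefl x hx]; norm_num
    have e2 : c y y - c x y = 1 / 2 := by
      simp only [c, hy, hxy, hyx, hrefl y hy]; norm_num
    rw [e1] at h1
    rw [e2] at h2
    constructor <;> linarith
  have hiff : ∀ x ∈ X, ∀ y ∈ X, h x ≤ h y ↔ r x y := by
    intro x hx y hy
    refine ⟨fun hxy => ?_, hle x y⟩
    by_contra hcon
    have := (hgap y hy x hx hcon).1
    linarith [hw0 y]
  refine ⟨h, fun x => ⟨tsum_nonneg fun z => mul_nonneg (hw0 z).le (hc0 x z), ?_⟩, hiff, ?_, ?_⟩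
  · rw [← hw1]
    exact (hsum x).tsum_le_tsum (fun z => mul_le_of_le_one_right (hw0 z).le (hc1 x z)) hws
  · intro x hx
    refine ⟨w x / 2, half_pos (hw0 x), fun y hy => ⟨fun hyx => ?_, fun hxy => ?_⟩⟩
    · exact (hgap y hy x hx fun hr => not_le.2 hyx (hle _ _ hr)).2
    · exact (hgap x hx y hy fun hr => not_le.2 hxy (hle _ _ hr)).1
  · intro g hg g' hg' hgg
    by_contra hcon
    push Not at hcon
    obtain ⟨N, hN⟩ := exists_pow_lt_of_lt_one (sub_pos.2 hgg) (y := (1 / 2 : ℝ)) (by norm_num)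
    have hout : ∀ z ∈ X, h z < g ∨ g' < h z := fun z hz =>
      (lt_or_ge (h z) g).imp_right fun h1 => hcon z hz h1
    -- If no point has its value in `[g, g']`, take `x` and `y` with values so near to `g` and `g'`
    -- that none of the first `N` points lies between them. Then only the tail of the weights
    -- contributes to `h y - h x`, which is at most `2 ^ (-N) < g' - g`, although `h x < g` and `g'
    -- < h y`.
    have ev1 : ∀ᶠ η in 𝓝 g, ∀ z ∈ Finset.range N, h z < g → h z < η :=
      (Filter.eventually_all_finset _).2 fun z _ => by
        by_cases hz : h z < g
        · exact (lt_mem_nhds hz).mono fun η hη _ => hη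
        · exact Filter.Eventually.of_forall fun η h1 => absurd h1 hz
    have ev2 : ∀ᶠ η in 𝓝 g', ∀ z ∈ Finset.range N, g' < h z → η < h z :=
      (Filter.eventually_all_finset _).2 fun z _ => by
        by_cases hz : g' < h z
        · exact (gt_mem_nhds hz).mono fun η hη _ => hη
        · exact Filter.Eventually.of_forall fun η h1 => absurd h1 hz
    obtain ⟨_, ⟨x, hx, rfl⟩, hx1, hx2⟩ := ((mem_closure_iff_frequently.1 hg).and_eventually
      (ev1.and (gt_mem_nhds hgg))).exists
    obtain ⟨_, ⟨y, hy, rfl⟩, hy1, hy2⟩ := ((mem_closure_iff_frequently.1 hg').and_eventually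
      (ev2.and (lt_mem_nhds hgg))).exists
    have hxg : h x < g := (hout x hx).resolve_right (not_lt.2 hx2.le)
    have hyg : g' < h y := (hout y hy).resolve_left (not_lt.2 hy2.le)
    have hzero : ∀ z < N, c y z - c x z = 0 := by
      intro z hz
      by_cases hzX : z ∈ X
      · rcases hout z hzX with h1 | h1
        · have hzx : h z < h x := hx1 z (Finset.mem_range.2 hz) h1
          have n1 : ¬ r x z := fun hr => not_le.2 hzx (hle _ _ hr)
          have n2 : ¬ r y z := fun hr => not_le.2 (hzx.trans (hx2.trans hyg)) (hle _ _ hr)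
          have p1 : r z x := (htotal z hzX x hx).resolve_right n1
          have p2 : r z y := (htotal z hzX y hy).resolve_right n2
          simp only [c, hzX, n1, n2, p1, p2]; norm_num
        · have hyz : h y < h z := hy1 z (Finset.mem_range.2 hz) h1
          have n1 : ¬ r z y := fun hr => not_le.2 hyz (hle _ _ hr)
          have n2 : ¬ r z x := fun hr => not_le.2 ((hx2.trans hyg).trans hyz) (hle _ _ hr)
          have p1 : r y z := (htotal z hzX y hy).resolve_left n1
          have p2 : r x z := (htotal z hzX x hx).resolve_left n2
          simp only [c, hzX, n1, n2, p1, p2]; norm_num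
      · simp [c, hzX]
    have hle1 := le_of_hasSum_geometric (hsub x y)
      (fun z => by linarith [hc0 x z, hc1 y z]) hzero
    linarith

/-! ### Models -/

/-- The layer `a` belongs to the corner number `i` of the triangle number `f`. -/
def Code.Admits (B : Code) (f : ℕ) (i : Fin 3) (a : ℕ) : Prop :=
  f < B.faces.length ∧ (B.corner f i).bot ≤ a ∧ a ≤ (B.corner f i).top

/-- The name of the point obtained from the point `x` over the corner `i` of the triangle `f` by
passing to the corner `j`. -/
def stepTerm (f : ℕ) (i j : Fin 3) (x : ℕ) : ℕ :=
  3 * Nat.pair f (Nat.pair i (Nat.pair j x)) + 1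

/-- The name of the highest point in the layer of `x`. -/
def topTerm (x : ℕ) : ℕ := 3 * x + 2

/-- The name of a point over the first corner of the triangle `f`. -/
def baseTerm (f : ℕ) : ℕ := 3 * f

/-- A set of named points over the vertices: `At x v a` says that `x` is a point over the vertex
`v`, in the layer `a`; `Le x y` says that `x` does not lie above `y` over the same vertex. -/
structure Code.IsModel (B : Code) (At : ℕ → ℕ → ℕ → Prop) (Le : ℕ → ℕ → Prop) : Prop where
  total : ∀ x y v a b, At x v a → At y v b → Le x y ∨ Le y x
  trans : ∀ x y z, Le x y → Le y z → Le x z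
  layered : ∀ x y v a b, a < b → At x v a → At y v b → ¬ Le y x
  -- The new point has a name in advance, so its layer is the only unknown, and it ranges over a
  -- finite set.
  step_at : ∀ f i j x a, B.Admits f i a → At x (B.corner f i).vertex a →
    ∃ b, B.Admits f j b ∧ At (stepTerm f i j x) (B.corner f j).vertex b
  -- Order is compared over the vertices, so following plaques preserves or reverses it according to
  -- whether the flips of the two corners agree.
  step_mono : ∀ f i j x y a b, B.Admits f i a → B.Admits f i b →
    (B.corner f i).flip = (B.corner f j).flip → At x (B.corner f i).vertex a →
    At y (B.corner f i).vertex b → Le x y → Le (stepTerm f i j x) (stepTerm f i j y)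
  step_anti : ∀ f i j x y a b, B.Admits f i a → B.Admits f i b →
    (B.corner f i).flip ≠ (B.corner f j).flip → At x (B.corner f i).vertex a →
    At y (B.corner f i).vertex b → Le x y → Le (stepTerm f i j y) (stepTerm f i j x)
  step_self_le : ∀ f i x a, B.Admits f i a → At x (B.corner f i).vertex a → Le (stepTerm f i i x) x
  le_step_self : ∀ f i x a, B.Admits f i a → At x (B.corner f i).vertex a → Le x (stepTerm f i i x)
  step_step_le : ∀ f i j k x a, B.Admits f i a → At x (B.corner f i).vertex a →
    Le (stepTerm f j k (stepTerm f i j x)) (stepTerm f i k x)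
  le_step_step : ∀ f i j k x a, B.Admits f i a → At x (B.corner f i).vertex a →
    Le (stepTerm f i k x) (stepTerm f j k (stepTerm f i j x))
  small_le_whole : ∀ e ∈ B.edges, ∀ s ∈ e.small, ∀ x a, B.Admits s.face s.src a →
    At x (B.corner s.face s.src).vertex a →
    Le (stepTerm s.face s.src s.tgt x) (stepTerm e.whole.face e.whole.src e.whole.tgt x)
  whole_le_small : ∀ e ∈ B.edges, ∀ s ∈ e.small, ∀ x a, B.Admits s.face s.src a →
    At x (B.corner s.face s.src).vertex a →
    Le (stepTerm e.whole.face e.whole.src e.whole.tgt x) (stepTerm s.face s.src s.tgt x)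
  -- The top of a layer separates points of the closure in that layer from those in higher layers.
  top_at : ∀ x v a, At x v a → At (topTerm x) v a
  le_top : ∀ x y v a, At x v a → At y v a → Le y (topTerm x)

/-! ### From models to plaque systems -/

theorem Corner.eps_mul_le_iff (k : Corner) {a b : ℝ} :
    k.eps * a ≤ k.eps * b ↔ if k.flip then b ≤ a else a ≤ b := by
  unfold Corner.eps
  split_ifs <;> simp

namespace Code.IsModel

variable {B : Code} {At : ℕ → ℕ → ℕ → Prop} {Le : ℕ → ℕ → Prop} (M : B.IsModel At Le)
include M

/-- An embedding of the layer `a` over the vertex `v`. -/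
noncomputable def emb (v a : ℕ) : ℕ → ℝ :=
  (exists_embedding {x | At x v a} Le (fun x hx y hy => M.total x y v a a hx hy) M.trans).choose

theorem emb_spec (v a : ℕ) : (∀ x, 0 ≤ M.emb v a x ∧ M.emb v a x ≤ 1) ∧
    (∀ x ∈ {x | At x v a}, ∀ y ∈ {x | At x v a}, M.emb v a x ≤ M.emb v a y ↔ Le x y) ∧
    (∀ x ∈ {x | At x v a}, ∃ ε > 0, ∀ y ∈ {x | At x v a},
      (M.emb v a y < M.emb v a x → M.emb v a y + ε ≤ M.emb v a x) ∧
      (M.emb v a x < M.emb v a y → M.emb v a x + ε ≤ M.emb v a y)) ∧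
    ∀ g ∈ closure (M.emb v a '' {x | At x v a}), ∀ g' ∈ closure (M.emb v a '' {x | At x v a}),
      g < g' → ∃ x ∈ {x | At x v a}, g ≤ M.emb v a x ∧ M.emb v a x ≤ g' :=
  (exists_embedding {x | At x v a} Le (fun x hx y hy => M.total x y v a a hx hy)
    M.trans).choose_spec

/-- The height of a point of a model. -/
noncomputable def level (v a x : ℕ) : ℝ := 2 * a + M.emb v a x

theorem level_mem (v a x : ℕ) : 2 * (a : ℝ) ≤ M.level v a x ∧ M.level v a x ≤ 2 * a + 1 := by
  have := (M.emb_spec v a).1 x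
  constructor <;> simp only [level] <;> linarith [this.1, this.2]

theorem level_lt {v a b : ℕ} (h : a < b) (x y : ℕ) : M.level v a x + 1 ≤ M.level v b y := by
  have h1 := (M.level_mem v a x).2
  have h2 := (M.level_mem v b y).1
  have h3 : (a : ℝ) + 1 ≤ b := by exact_mod_cast h
  linarith

theorem level_le_iff {v a b x y : ℕ} (hx : At x v a) (hy : At y v b) :
    M.level v a x ≤ M.level v b y ↔ Le x y := by
  rcases lt_trichotomy a b with h | h | h
  · have h1 := M.level_lt (v := v) h x y
    have h2 := M.layered x y v a b h hx hy
    exact ⟨fun _ => (M.total x y v a b hx hy).resolve_right h2, fun _ => by linarith⟩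
  · subst h
    have := (M.emb_spec v a).2.1 x hx y hy
    simp only [level]
    rw [← this, add_le_add_iff_left]
  · have h1 := M.level_lt (v := v) h y x
    have h2 := M.layered y x v b a h hy hx
    exact ⟨fun h => by linarith, fun h => absurd h h2⟩

theorem level_eq {v a b x y : ℕ} (hx : At x v a) (hy : At y v b) (h : Le x y) (h' : Le y x) :
    M.level v a x = M.level v b y :=
  le_antisymm ((M.level_le_iff hx hy).2 h) ((M.level_le_iff hy hx).2 h')

theorem level_isolated {v a x : ℕ} (hx : At x v a) : ∃ ε > 0, ∀ y b, At y v b →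
    (M.level v b y < M.level v a x → M.level v b y + ε ≤ M.level v a x) ∧
    (M.level v a x < M.level v b y → M.level v a x + ε ≤ M.level v b y) := by
  obtain ⟨ε, hε, h⟩ := (M.emb_spec v a).2.2.1 x hx
  refine ⟨min ε 1, lt_min hε one_pos, fun y b hy => ?_⟩
  have h1 := min_le_left ε 1
  have h2 := min_le_right ε 1
  rcases lt_trichotomy a b with hab | hab | hab
  · have := M.level_lt (v := v) hab x y
    exact ⟨fun h => by linarith, fun h => by linarith⟩
  · subst hab
    have := h y hy
    simp only [level]
    exact ⟨fun h => by linarith [this.1 (by linarith)], fun h => by linarith [this.2 (by linarith)]⟩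
  · have := M.level_lt (v := v) hab y x
    exact ⟨fun h => by linarith, fun h => by linarith⟩

/-- The heights of the points of a model over a vertex. -/
def levels (v : ℕ) : Set ℝ := {η | ∃ x a, At x v a ∧ M.level v a x = η}

theorem exists_layer {v : ℕ} {η : ℝ} (h : η ∈ closure (M.levels v)) :
    ∃ a : ℕ, 2 * (a : ℝ) ≤ η ∧ η ≤ 2 * (a : ℝ) + 1 := by
  have h0 : 0 ≤ η := by
    refine closure_minimal ?_ isClosed_Ici h
    rintro _ ⟨x, a, hx, rfl⟩
    exact le_trans (by positivity) (M.level_mem v a x).1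
  obtain ⟨a, ha | ha⟩ := exists_layer_or_gap h0
  · exact ⟨a, ha⟩
  · obtain ⟨_, h1, x, b, hx, rfl⟩ := mem_closure_iff.1 h (Ioo (2 * (a : ℝ) + 1) (2 * a + 2))
      isOpen_Ioo ha
    have h2 := M.level_mem v b x
    have h3 := h1.1.trans_le h2.2
    have h4 := h2.1.trans_lt h1.2
    have h5 : a < b := by exact_mod_cast (by linarith : (a : ℝ) < b)
    have h6 : b < a + 1 := by exact_mod_cast (by linarith : (b : ℝ) < a + 1)
    omega

theorem mem_closure_layer {v a : ℕ} {η : ℝ} (h : η ∈ closure (M.levels v))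
    (ha : 2 * (a : ℝ) ≤ η ∧ η ≤ 2 * (a : ℝ) + 1) :
    η - 2 * a ∈ closure (M.emb v a '' {x | At x v a}) := by
  rw [Metric.mem_closure_iff] at h ⊢
  intro ε hε
  obtain ⟨_, ⟨x, b, hx, rfl⟩, hd⟩ := h (min ε (1 / 2)) (lt_min hε (by norm_num))
  have hl := M.level_mem v b x
  rw [Real.dist_eq] at hd
  have hd1 := hd.trans_le (min_le_left _ _)
  have hd2 := abs_lt.1 (hd.trans_le (min_le_right _ _))
  have h5 : a < b + 1 := by exact_mod_cast (by linarith [hd2.1, hd2.2] : (a : ℝ) < b + 1)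
  have h6 : b < a + 1 := by exact_mod_cast (by linarith [hd2.1, hd2.2] : (b : ℝ) < a + 1)
  obtain rfl : a = b := by omega
  refine ⟨_, ⟨x, hx, rfl⟩, ?_⟩
  rw [Real.dist_eq]
  have e : η - 2 * a - M.emb v a x = η - M.level v a x := by
    simp only [level]; ring
  rwa [e]

/-- Within one layer this is the separation property of the embedding. For different layers the top
of the lower one lies between; without it a limit point could be the highest point of its layer with
no named point above it there. -/
theorem exists_between {v : ℕ} {g g' : ℝ} (hg : g ∈ closure (M.levels v))
    (hg' : g' ∈ closure (M.levels v)) (h : g < g') :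
    ∃ x a, At x v a ∧ g ≤ M.level v a x ∧ M.level v a x ≤ g' := by
  obtain ⟨a, ha⟩ := M.exists_layer hg
  obtain ⟨a', ha'⟩ := M.exists_layer hg'
  have h1 := M.mem_closure_layer hg ha
  rcases lt_trichotomy a a' with haa | haa | haa
  · obtain ⟨_, x, hx, -⟩ := closure_nonempty_iff.1 ⟨_, h1⟩
    have ht := M.top_at x v a hx
    refine ⟨topTerm x, a, ht, ?_, ?_⟩
    · have : g - 2 * a ∈ Iic (M.emb v a (topTerm x)) := by
        refine closure_minimal ?_ isClosed_Iic h1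
        rintro _ ⟨y, hy, rfl⟩
        have := (M.level_le_iff hy ht).2 (M.le_top x y v a hx hy)
        simp only [level] at this
        exact le_of_add_le_add_left this
      simp only [level]
      linarith [mem_Iic.1 this]
    · have h3 : (a : ℝ) + 1 ≤ a' := by exact_mod_cast haa
      linarith [(M.level_mem v a (topTerm x)).2]
  · subst haa
    obtain ⟨x, hx, hx1, hx2⟩ := (M.emb_spec v a).2.2.2 _ h1 _
      (M.mem_closure_layer hg' ha') (by linarith)
    refine ⟨x, a, hx, ?_, ?_⟩ <;> simp only [level] <;> linarith
  · have h3 : (a' : ℝ) + 1 ≤ a := by exact_mod_cast haa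
    linarith

/-- The heights of the plaques of a model over a triangle. -/
def triples (f : ℕ) : Set (Fin 3 → ℝ) :=
  {g | ∃ x a : Fin 3 → ℕ, (∀ i, At (x i) (B.corner f i).vertex (a i)) ∧
    (∀ i, B.Admits f i (a i)) ∧
    (∀ i j, Le (stepTerm f i j (x i)) (x j) ∧ Le (x j) (stepTerm f i j (x i))) ∧
    ∀ i, g i = (B.corner f i).eps * M.level (B.corner f i).vertex (a i) (x i)}

/-- The points reached from `x` by single steps to the three corners are coherent, since two
successive steps are equivalent to one. -/
theorem exists_triple {f : ℕ} {i : Fin 3} {a x : ℕ} (ha : B.Admits f i a)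
    (hx : At x (B.corner f i).vertex a) : ∃ g ∈ M.triples f,
      g i = (B.corner f i).eps * M.level (B.corner f i).vertex a x ∧
      ∀ j b, At (stepTerm f i j x) (B.corner f j).vertex b →
        g j = (B.corner f j).eps * M.level (B.corner f j).vertex b (stepTerm f i j x) := by
  choose b hb hbx using fun j => M.step_at f i j x a ha hx
  refine ⟨_, ⟨fun j => stepTerm f i j x, b, hbx, hb, fun j k =>
    ⟨M.step_step_le f i j k x a ha hx, M.le_step_step f i j k x a ha hx⟩, fun j => rfl⟩, ?_, ?_⟩
  · simp only
    rw [M.level_eq (hbx i) hx (M.step_self_le f i x a ha hx) (M.le_step_self f i x a ha hx)]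
  · intro j c hc
    simp only
    rw [M.level_eq (hbx j) hc]
    all_goals exact (M.total _ _ _ _ _ hc hc).elim id id

theorem triples_subset (f : ℕ) :
    M.triples f ⊆ univ.pi fun i => Icc (B.corner f i).lo (B.corner f i).hi := by
  rintro g ⟨x, a, hx, ha, -, hg⟩ i -
  refine (Corner.mem_range_iff _ _).2 ?_
  rw [hg, Corner.eps_mul_cancel]
  have h1 := M.level_mem (B.corner f i).vertex (a i) (x i)
  have h2 : ((B.corner f i).bot : ℝ) ≤ a i := by exact_mod_cast (ha i).2.1
  have h3 : (a i : ℝ) ≤ (B.corner f i).top := by exact_mod_cast (ha i).2.2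
  constructor <;> linarith

/-- Steps reverse the order over the vertices exactly when the flips differ, and `eps` undoes this
when heights are measured with respect to the triangle. -/
theorem triples_le {f : ℕ} {g g' : Fin 3 → ℝ} (hg : g ∈ M.triples f) (hg' : g' ∈ M.triples f)
    {i : Fin 3} (j : Fin 3) (h : g i ≤ g' i) : g j ≤ g' j := by
  obtain ⟨x, a, hx, ha, hs, hg⟩ := hg
  obtain ⟨x', a', hx', ha', hs', hg'⟩ := hg'
  rw [hg, hg', Corner.eps_mul_le_iff, M.level_le_iff (hx' _) (hx _),
    M.level_le_iff (hx _) (hx' _)] at h ⊢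
  have key : Le (stepTerm f i j (x i)) (stepTerm f i j (x' i)) → Le (x j) (x' j) :=
    fun h => M.trans _ _ _ (hs i j).2 (M.trans _ _ _ h (hs' i j).1)
  have key' : Le (stepTerm f i j (x' i)) (stepTerm f i j (x i)) → Le (x' j) (x j) :=
    fun h => M.trans _ _ _ (hs' i j).2 (M.trans _ _ _ h (hs i j).1)
  by_cases hij : (B.corner f i).flip = (B.corner f j).flip
  · rw [← hij]
    split_ifs at h ⊢
    · exact key' (M.step_mono _ _ _ _ _ _ _ (ha' i) (ha i) hij (hx' i) (hx i) h)
    · exact key (M.step_mono _ _ _ _ _ _ _ (ha i) (ha' i) hij (hx i) (hx' i) h)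
  · split_ifs at h ⊢ with h1 h2
    · exact absurd (h2.trans h1.symm) hij
    · exact key' (M.step_anti _ _ _ _ _ _ _ (ha i) (ha' i) hij (hx i) (hx' i) h)
    · exact key (M.step_anti _ _ _ _ _ _ _ (ha' i) (ha i) hij (hx' i) (hx i) h)
    · simp_all

theorem triples_isolated {f : ℕ} {g : Fin 3 → ℝ} (hg : g ∈ M.triples f) (i : Fin 3) :
    ∃ ε > 0, ∀ t ∈ M.triples f, (t i < g i → t i + ε ≤ g i) ∧ (g i < t i → g i + ε ≤ t i) := by
  obtain ⟨x, a, hx, -, -, hg⟩ := hg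
  obtain ⟨ε, hε, h⟩ := M.level_isolated (hx i)
  refine ⟨ε, hε, ?_⟩
  rintro t ⟨y, b, hy, -, -, ht⟩
  rw [hg, ht]
  have := h (y i) (b i) (hy i)
  unfold Corner.eps
  split_ifs
  · exact ⟨fun h => by linarith [this.2 (by linarith)], fun h => by linarith [this.1 (by linarith)]⟩
  · exact ⟨fun h => by linarith [this.1 (by linarith)], fun h => by linarith [this.2 (by linarith)]⟩

/-- As `t` is isolated at corner `i`, a triple close enough to `g` compares with `t` there in the
same weak sense as `g`. Triples compare alike at all corners, and the weak inequality at `j` passes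
to the limit. -/
theorem le_of_mem_closure {f : ℕ} {g t : Fin 3 → ℝ} (hg : g ∈ closure (M.triples f))
    (ht : t ∈ M.triples f) {i : Fin 3} (j : Fin 3) :
    (t i ≤ g i → t j ≤ g j) ∧ (g i ≤ t i → g j ≤ t j) := by
  obtain ⟨ε, hε, hiso⟩ := M.triples_isolated ht i
  have happ : ∀ U : Set (Fin 3 → ℝ), IsOpen U → g ∈ U → ∃ k ∈ M.triples f, k ∈ U :=
    fun U hU hgU => by
      obtain ⟨k, hk, hk'⟩ := mem_closure_iff.1 hg U hU hgU
      exact ⟨k, hk', hk⟩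
  have hI : ∀ (i : Fin 3) (c : ℝ), IsOpen {k : Fin 3 → ℝ | c < k i} := fun i c =>
    isOpen_lt continuous_const (continuous_apply i)
  have hI' : ∀ (i : Fin 3) (c : ℝ), IsOpen {k : Fin 3 → ℝ | k i < c} := fun i c =>
    isOpen_lt (continuous_apply i) continuous_const
  constructor
  · intro h
    by_contra hcon
    obtain ⟨k, hk, hk1, hk2⟩ := happ _ ((hI i (t i - ε)).inter (hI' j (t j)))
      ⟨by change t i - ε < g i; linarith, not_le.1 hcon⟩
    have h1 : t i ≤ k i := by
      by_contra hc
      have := (hiso k hk).1 (not_le.1 hc)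
      linarith [show t i - ε < k i from hk1]
    exact absurd (M.triples_le ht hk j h1) (not_le.2 hk2)
  · intro h
    by_contra hcon
    obtain ⟨k, hk, hk1, hk2⟩ := happ _ ((hI' i (t i + ε)).inter (hI j (t j)))
      ⟨by change g i < t i + ε; linarith, not_le.1 hcon⟩
    have h1 : k i ≤ t i := by
      by_contra hc
      have := (hiso k hk).2 (not_le.1 hc)
      linarith [show k i < t i + ε from hk1]
    exact absurd (M.triples_le hk ht j h1) (not_le.2 hk2)

theorem admits_of_level {f : ℕ} {i : Fin 3} (hf : f < B.faces.length) {v x a : ℕ}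
    (h : 2 * ((B.corner f i).bot : ℝ) ≤ M.level v a x ∧
      M.level v a x ≤ 2 * ((B.corner f i).top : ℝ) + 1) : B.Admits f i a :=
  ⟨hf, layer_of_nat_height h.1 h.2 (M.level_mem v a x)⟩

theorem eps_mul_mem {f : ℕ} {g : Fin 3 → ℝ} (hg : g ∈ closure (M.triples f)) (i : Fin 3) :
    (B.corner f i).eps * g i ∈ closure (M.levels (B.corner f i).vertex) ∧
      2 * ((B.corner f i).bot : ℝ) ≤ (B.corner f i).eps * g i ∧
      (B.corner f i).eps * g i ≤ 2 * ((B.corner f i).top : ℝ) + 1 := by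
  refine ⟨?_, (Corner.mem_range_iff _ _).1 ?_⟩
  · refine map_mem_closure (f := fun g : Fin 3 → ℝ => (B.corner f i).eps * g i) (by fun_prop) hg ?_
    rintro g ⟨x, a, hx, ha, -, hg⟩
    refine ⟨x i, a i, hx i, ?_⟩
    simp only
    rw [hg, Corner.eps_mul_cancel]
  · exact closure_minimal (M.triples_subset f) (isClosed_set_pi fun i _ => isClosed_Icc) hg i
      (mem_univ i)

theorem exists_triple_between {f : ℕ} (hf : f < B.faces.length) {g g' : Fin 3 → ℝ}
    (hg : g ∈ closure (M.triples f)) (hg' : g' ∈ closure (M.triples f)) {i : Fin 3}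
    (h : g i < g' i) : ∃ t ∈ M.triples f, g i ≤ t i ∧ t i ≤ g' i := by
  have h1 := M.eps_mul_mem hg i
  have h2 := M.eps_mul_mem hg' i
  have key : ∃ x a, At x (B.corner f i).vertex a ∧ B.Admits f i a ∧
      g i ≤ (B.corner f i).eps * M.level (B.corner f i).vertex a x ∧
      (B.corner f i).eps * M.level (B.corner f i).vertex a x ≤ g' i := by
    by_cases hfl : (B.corner f i).flip
    · have he : (B.corner f i).eps = -1 := by simp [Corner.eps, hfl]
      rw [he] at h1 h2 ⊢
      obtain ⟨x, a, hx, hx1, hx2⟩ := M.exists_between h2.1 h1.1 (by linarith)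
      exact ⟨x, a, hx, M.admits_of_level hf ⟨by linarith, by linarith⟩, by linarith, by linarith⟩
    · have he : (B.corner f i).eps = 1 := by simp [Corner.eps, hfl]
      rw [he] at h1 h2 ⊢
      obtain ⟨x, a, hx, hx1, hx2⟩ := M.exists_between h1.1 h2.1 (by linarith)
      exact ⟨x, a, hx, M.admits_of_level hf ⟨by linarith, by linarith⟩, by linarith, by linarith⟩
  obtain ⟨x, a, hx, ha, hx1, hx2⟩ := key
  obtain ⟨t, ht, hti, -⟩ := M.exists_triple ha hx
  exact ⟨t, ht, by rwa [hti], by rwa [hti]⟩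

theorem isCompact_closure_triples (f : ℕ) : IsCompact (closure (M.triples f)) :=
  (isCompact_univ_pi fun _ => isCompact_Icc).of_isClosed_subset isClosed_closure
    (closure_minimal (M.triples_subset f) (isClosed_set_pi fun _ _ => isClosed_Icc))

/-- The plaque system of a model. -/
def plaqueSystem (hB : B.IsBranchedSurface) : PlaqueSystem B where
  pts v := closure (M.levels v)
  plaques f := closure (M.triples f)
  isCompact_plaques f _ := M.isCompact_closure_triples f
  exists_layer v h hh := M.exists_layer hh
  lt_of_lt f hf g hg g' hg' i j h := by
    -- The triple `t` lies weakly between at `i`, hence at `j`. Were `g` and `g'` equal at `j`, both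
    -- would equal `t` there, and comparison with `t` carried back to `i` would contradict `g i < g'
    -- i`.
    obtain ⟨t, ht, h1, h2⟩ := M.exists_triple_between hf hg hg' h
    have a1 := (M.le_of_mem_closure hg ht (i := i) j).2 h1
    have a2 := (M.le_of_mem_closure hg' ht (i := i) j).1 h2
    refine lt_of_le_of_ne (a1.trans a2) fun he => ?_
    have b1 := (M.le_of_mem_closure hg ht (i := j) i).1 (he ▸ a2)
    have b2 := (M.le_of_mem_closure hg' ht (i := j) i).2 (he ▸ a1)
    linarith
  exists_plaque_iff f hf i h := by
    constructor
    · rintro ⟨g, hg, rfl⟩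
      exact M.eps_mul_mem hg i
    · rintro ⟨hh, h1, h2⟩
      have hcl : IsClosed ((fun g : Fin 3 → ℝ => (B.corner f i).eps * g i) ''
          closure (M.triples f)) :=
        ((M.isCompact_closure_triples f).image (by fun_prop)).isClosed
      -- The approximating named points must lie in layers of the corner; widening its range by one
      -- half meets no further layer.
      have h3 : h ∈ closure (Ioo (2 * ((B.corner f i).bot : ℝ) - 1 / 2)
          (2 * ((B.corner f i).top : ℝ) + 3 / 2) ∩ M.levels (B.corner f i).vertex) :=
        isOpen_Ioo.inter_closure ⟨⟨by linarith, by linarith⟩, hh⟩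
      refine closure_minimal ?_ hcl h3
      rintro _ ⟨h4, x, a, hx, rfl⟩
      have h5 := M.level_mem (B.corner f i).vertex a x
      have h6 : (B.corner f i).bot < a + 1 := by
        exact_mod_cast (by linarith [h4.1] : ((B.corner f i).bot : ℝ) < a + 1)
      have h7 : a < (B.corner f i).top + 1 := by
        exact_mod_cast (by linarith [h4.2] : (a : ℝ) < (B.corner f i).top + 1)
      obtain ⟨t, ht, hti, -⟩ := M.exists_triple ⟨hf, by omega, by omega⟩ hx
      exact ⟨t, subset_closure ht, by simp only; rw [hti, Corner.eps_mul_cancel]⟩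
  exists_whole e he s hs g hg := by
    have hss := Edge.small_mem_sides hs
    -- The pairs of end heights occurring over `whole` form a compact set, so it is enough to
    -- continue the triples of named points.
    have hcl : IsClosed ((fun g : Fin 3 → ℝ => (g e.whole.src, g e.whole.tgt)) ''
        closure (M.triples e.whole.face)) :=
      ((M.isCompact_closure_triples _).image (by fun_prop)).isClosed
    have hcl' : IsClosed ((fun g : Fin 3 → ℝ => (B.sign e s * g s.src, B.sign e s * g s.tgt)) ⁻¹'
        ((fun g : Fin 3 → ℝ => (g e.whole.src, g e.whole.tgt)) ''
          closure (M.triples e.whole.face))) := hcl.preimage (by fun_prop)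
    have hsub : M.triples s.face ⊆ (fun g : Fin 3 → ℝ =>
        (B.sign e s * g s.src, B.sign e s * g s.tgt)) ⁻¹'
        ((fun g : Fin 3 → ℝ => (g e.whole.src, g e.whole.tgt)) ''
          closure (M.triples e.whole.face)) := by
      rintro g ⟨x, a, hx, ha, hstep, hg⟩
      have hv := hB.vertex_end he (Or.inl rfl) hss
      have hv' := hB.vertex_end he (Or.inr rfl) hss
      have hr := hB.range_le he (Or.inl rfl) hs
      have hw : B.Admits e.whole.face e.whole.src (a s.src) :=
        ⟨hB.face_lt he e.whole_mem_sides, hr.1.trans (ha _).2.1, (ha _).2.2.trans hr.2⟩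
      have hxs := hx s.src
      rw [hv] at hxs
      obtain ⟨t, ht, ht1, ht2⟩ := M.exists_triple hw hxs
      obtain ⟨b, -, hb⟩ := M.step_at _ _ e.whole.tgt _ _ hw hxs
      refine ⟨t, subset_closure ht, Prod.ext ?_ ?_⟩
      · simp only
        rw [ht1, hg, hB.sign_eq_end he (Or.inl rfl) hss, hv, mul_assoc, Corner.eps_mul_cancel]
      · simp only
        have hxt := hx s.tgt
        rw [hv'] at hxt
        rw [ht2 _ _ hb, hg, hB.sign_eq_end he (Or.inr rfl) hss, hv', mul_assoc,
          Corner.eps_mul_cancel]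
        congr 1
        refine M.level_eq hb hxt (M.trans _ _ _ (M.whole_le_small e he s hs _ _ (ha _) (hx _))
          (hstep _ _).1) (M.trans _ _ _ (hstep _ _).2
            (M.small_le_whole e he s hs _ _ (ha _) (hx _)))
    obtain ⟨g', hg', h⟩ := closure_minimal hsub hcl' hg
    exact ⟨g', hg', congrArg Prod.fst h, congrArg Prod.snd h⟩

theorem plaques_nonempty (hB : B.IsBranchedSurface) {f : ℕ} {i : Fin 3} {a x : ℕ}
    (ha : B.Admits f i a) (hx : At x (B.corner f i).vertex a) :
    ((M.plaqueSystem hB).plaques f).Nonempty := by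
  obtain ⟨g, hg, -⟩ := M.exists_triple ha hx
  exact ⟨g, subset_closure hg⟩

end Code.IsModel

/-! ### From plaque systems to models -/

/-- Names of points of a plaque system. -/
inductive Term
  | base (f : ℕ)
  | step (f : ℕ) (i j : Fin 3) (t : Term)
  | top (t : Term)

/-- The number of a name. -/
def Term.code : Term → ℕ
  | base f => baseTerm f
  | step f i j t => stepTerm f i j t.code
  | top t => topTerm t.code

/-- Residues modulo three distinguish the constructors, and the pairing function recovers the
arguments. -/
theorem Term.code_injective : Function.Injective Term.code := by
  intro s
  induction s with
  | base f =>
    rintro (f' | ⟨f', i', j', t'⟩ | t') h <;>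
      simp only [code, baseTerm, stepTerm, topTerm] at h
    · rw [show f = f' by omega]
    all_goals omega
  | step f i j t ih =>
    rintro (f' | ⟨f', i', j', t'⟩ | t') h <;>
      simp only [code, baseTerm, stepTerm, topTerm] at h
    · omega
    · have h1 : Nat.pair f (Nat.pair i (Nat.pair j t.code)) =
          Nat.pair f' (Nat.pair i' (Nat.pair j' t'.code)) := by omega
      simp only [Nat.pair_eq_pair] at h1
      obtain ⟨rfl, h2, h3, h4⟩ := h1
      rw [Fin.ext h2, Fin.ext h3, ih h4]
    all_goals omega
  | top t ih =>
    rintro (f' | ⟨f', i', j', t'⟩ | t') h <;>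
      simp only [code, baseTerm, stepTerm, topTerm] at h
    · omega
    · omega
    · rw [ih (show t.code = t'.code by omega)]

namespace PlaqueSystem

variable {B : Code} (P : PlaqueSystem B)

/-- The points over a vertex in a given layer. -/
def layer (v a : ℕ) : Set ℝ := {h ∈ P.pts v | 2 * (a : ℝ) ≤ h ∧ h ≤ 2 * (a : ℝ) + 1}

variable {P} in
theorem layer_unique {v v' a b : ℕ} {h : ℝ} (ha : h ∈ P.layer v a) (hb : h ∈ P.layer v' b) :
    a = b := by
  have := layer_of_nat_height (b := b) (t := b) hb.2.1 hb.2.2 ha.2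
  omega

/-- `h` is the height of the point with the name `t`, over the vertex `v`; here `g f` is a plaque
over the triangle `f`. -/
def Val (g : ℕ → Fin 3 → ℝ) : Term → ℕ → ℝ → Prop
  | .base f, v, h => f < B.faces.length ∧ g f ∈ P.plaques f ∧ v = (B.corner f 0).vertex ∧
      h = (B.corner f 0).eps * g f 0
  | .step f i j t, v, h => f < B.faces.length ∧ ∃ g' ∈ P.plaques f,
      Val g t (B.corner f i).vertex ((B.corner f i).eps * g' i) ∧ v = (B.corner f j).vertex ∧
      h = (B.corner f j).eps * g' j
  | .top t, v, h => ∃ h' a, Val g t v h' ∧ h' ∈ P.layer v a ∧ IsGreatest (P.layer v a) h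

variable {P} {g : ℕ → Fin 3 → ℝ}

/-- A name denotes at most one point: a plaque is determined by one corner, and layers over a vertex
do not overlap. -/
theorem Val.unique {t : Term} {v v' : ℕ} {h h' : ℝ} (ht : P.Val g t v h) (ht' : P.Val g t v' h') :
    v = v' ∧ h = h' := by
  induction t generalizing v v' h h' with
  | base f =>
    obtain ⟨-, -, rfl, rfl⟩ := ht
    obtain ⟨-, -, rfl, rfl⟩ := ht'
    exact ⟨rfl, rfl⟩
  | step f i j t ih =>
    obtain ⟨hf, k, hk, h1, rfl, rfl⟩ := ht
    obtain ⟨-, k', hk', h2, rfl, rfl⟩ := ht'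
    have h3 := mul_left_cancel₀ (B.corner f i).eps_ne_zero (ih h1 h2).2
    rw [P.ext_corner hf hk hk' h3]
    exact ⟨rfl, rfl⟩
  | top t ih =>
    obtain ⟨k, a, h1, h2, h3⟩ := ht
    obtain ⟨k', a', h1', h2', h3'⟩ := ht'
    obtain ⟨rfl, rfl⟩ := ih h1 h1'
    obtain rfl := layer_unique h2 h2'
    exact ⟨rfl, h3.unique h3'⟩

theorem isCompact_layer {f : ℕ} (hf : f < B.faces.length) {i : Fin 3}
    {a : ℕ} (h1 : (B.corner f i).bot ≤ a) (h2 : a ≤ (B.corner f i).top) :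
    IsCompact (P.layer (B.corner f i).vertex a) := by
  have h1' : ((B.corner f i).bot : ℝ) ≤ a := by exact_mod_cast h1
  have h2' : (a : ℝ) ≤ (B.corner f i).top := by exact_mod_cast h2
  have : P.layer (B.corner f i).vertex a =
      (fun g : Fin 3 → ℝ => (B.corner f i).eps * g i) '' P.plaques f ∩
        Icc (2 * (a : ℝ)) (2 * a + 1) := by
    ext h
    constructor
    · rintro ⟨hp, hh⟩
      exact ⟨(P.exists_plaque_iff f hf i h).2 ⟨hp, by linarith, by linarith⟩, hh⟩
    · rintro ⟨hp, hh⟩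
      exact ⟨((P.exists_plaque_iff f hf i h).1 hp).1, hh⟩
  rw [this]
  exact ((P.isCompact_plaques f hf).image (by fun_prop)).inter_right isClosed_Icc

/-- Every named point lies at a corner of a triangle. -/
theorem Val.exists_corner {t : Term} {v : ℕ} {h : ℝ}
    (ht : P.Val g t v h) : ∃ f < B.faces.length, ∃ i, (B.corner f i).vertex = v ∧
      2 * ((B.corner f i).bot : ℝ) ≤ h ∧ h ≤ 2 * ((B.corner f i).top : ℝ) + 1 := by
  induction t generalizing v h with
  | base f =>
    obtain ⟨hf, hg, rfl, rfl⟩ := ht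
    exact ⟨f, hf, 0, rfl, (Corner.mem_range_iff _ _).1 (P.mem_range hf hg 0)⟩
  | step f i j t =>
    obtain ⟨hf, g', hg', -, rfl, rfl⟩ := ht
    exact ⟨f, hf, j, rfl, (Corner.mem_range_iff _ _).1 (P.mem_range hf hg' j)⟩
  | top t ih =>
    obtain ⟨h', a, h1, h2, h3⟩ := ht
    obtain ⟨f, hf, i, hi, hr⟩ := ih h1
    have hl := layer_of_nat_height hr.1 hr.2 h2.2
    have h1' : ((B.corner f i).bot : ℝ) ≤ a := by exact_mod_cast hl.1
    have h2' : (a : ℝ) ≤ (B.corner f i).top := by exact_mod_cast hl.2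
    exact ⟨f, hf, i, hi, by linarith [h3.1.2.1], by linarith [h3.1.2.2]⟩

theorem Val.isCompact_layer {t : Term} {v a : ℕ} {h : ℝ}
    (ht : P.Val g t v h) (ha : h ∈ P.layer v a) : IsCompact (P.layer v a) := by
  obtain ⟨f, hf, i, rfl, hr⟩ := ht.exists_corner
  have hl := layer_of_nat_height hr.1 hr.2 ha.2
  exact PlaqueSystem.isCompact_layer hf hl.1 hl.2

variable (P g) in
/-- The named point `x` lies over the vertex `v`, in the layer `a`. -/
def At (x v a : ℕ) : Prop := ∃ t h, Term.code t = x ∧ P.Val g t v h ∧ h ∈ P.layer v a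

variable (P g) in
/-- The named points `x` and `y` lie over the same vertex, and `x` does not lie above `y`. -/
def Le (x y : ℕ) : Prop :=
  ∃ t t' v h h', Term.code t = x ∧ Term.code t' = y ∧ P.Val g t v h ∧ P.Val g t' v h' ∧ h ≤ h'

theorem le_iff {t t' : Term} {v : ℕ} {h h' : ℝ} (ht : P.Val g t v h) (ht' : P.Val g t' v h') :
    P.Le g t.code t'.code ↔ h ≤ h' := by
  constructor
  · rintro ⟨s, s', w, k, k', hs, hs', h1, h2, hk⟩
    obtain rfl := Term.code_injective hs
    obtain rfl := Term.code_injective hs'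
    rw [(ht.unique h1).2, (ht'.unique h2).2]
    exact hk
  · intro hh
    exact ⟨t, t', v, h, h', rfl, rfl, ht, ht', hh⟩

theorem val_step {f : ℕ} (hf : f < B.faces.length) {i : Fin 3} (j : Fin 3) {g' : Fin 3 → ℝ}
    (hg' : g' ∈ P.plaques f) {t : Term}
    (ht : P.Val g t (B.corner f i).vertex ((B.corner f i).eps * g' i)) :
    P.Val g (.step f i j t) (B.corner f j).vertex ((B.corner f j).eps * g' j) :=
  ⟨hf, g', hg', ht, rfl, rfl⟩

theorem exists_plaque {f : ℕ} {i : Fin 3} {a x : ℕ} (ha : B.Admits f i a)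
    (hx : P.At g x (B.corner f i).vertex a) : ∃ t, Term.code t = x ∧ ∃ g' ∈ P.plaques f,
      P.Val g t (B.corner f i).vertex ((B.corner f i).eps * g' i) := by
  obtain ⟨t, h, rfl, ht, hl⟩ := hx
  have h1 : ((B.corner f i).bot : ℝ) ≤ a := by exact_mod_cast ha.2.1
  have h2 : (a : ℝ) ≤ (B.corner f i).top := by exact_mod_cast ha.2.2
  obtain ⟨g', hg', rfl⟩ := (P.exists_plaque_iff f ha.1 i h).2
    ⟨hl.1, by linarith [hl.2.1], by linarith [hl.2.2]⟩
  exact ⟨t, rfl, g', hg', ht⟩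

theorem exists_admits {f : ℕ} (hf : f < B.faces.length) {g' : Fin 3 → ℝ} (hg' : g' ∈ P.plaques f)
    (j : Fin 3) : ∃ b, B.Admits f j b ∧
      (B.corner f j).eps * g' j ∈ P.layer (B.corner f j).vertex b := by
  have hp := P.mem_pts hf hg' j
  obtain ⟨b, hb⟩ := P.exists_layer _ _ hp
  have hr := (Corner.mem_range_iff _ _).1 (P.mem_range hf hg' j)
  exact ⟨b, ⟨hf, layer_of_nat_height hr.1 hr.2 hb⟩, hp, hb⟩

theorem eps_mul_mono {f : ℕ} (hf : f < B.faces.length) {k k' : Fin 3 → ℝ} (hk : k ∈ P.plaques f)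
    (hk' : k' ∈ P.plaques f) {i j : Fin 3} (h : (B.corner f i).flip = (B.corner f j).flip)
    (hi : (B.corner f i).eps * k i ≤ (B.corner f i).eps * k' i) :
    (B.corner f j).eps * k j ≤ (B.corner f j).eps * k' j := by
  rw [Corner.eps_mul_le_iff] at hi ⊢
  rw [← h]
  split_ifs at hi ⊢
  · exact not_lt.1 fun hlt => not_lt.2 hi ((P.lt_iff_lt hf hk hk' i j).2 hlt)
  · exact not_lt.1 fun hlt => not_lt.2 hi ((P.lt_iff_lt hf hk' hk i j).2 hlt)

theorem eps_mul_anti {f : ℕ} (hf : f < B.faces.length) {k k' : Fin 3 → ℝ} (hk : k ∈ P.plaques f)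
    (hk' : k' ∈ P.plaques f) {i j : Fin 3} (h : (B.corner f i).flip ≠ (B.corner f j).flip)
    (hi : (B.corner f i).eps * k i ≤ (B.corner f i).eps * k' i) :
    (B.corner f j).eps * k' j ≤ (B.corner f j).eps * k j := by
  rw [Corner.eps_mul_le_iff] at hi ⊢
  rw [(Bool.eq_not_of_ne h.symm)]
  cases hfl : (B.corner f i).flip
  · rw [hfl] at hi
    simp only [Bool.false_eq_true, if_false, Bool.not_false, if_true] at hi ⊢
    exact not_lt.1 fun hlt => not_lt.2 hi ((P.lt_iff_lt hf hk' hk i j).2 hlt)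
  · rw [hfl] at hi
    simp only [Bool.false_eq_true, if_false, Bool.not_true, if_true] at hi ⊢
    exact not_lt.1 fun hlt => not_lt.2 hi ((P.lt_iff_lt hf hk hk' i j).2 hlt)

/-- The model of a plaque system. -/
theorem isModel (hB : B.IsBranchedSurface) : B.IsModel (P.At g) (P.Le g) where
  total := by
    rintro _ _ v a b ⟨t, h, rfl, ht, -⟩ ⟨t', h', rfl, ht', -⟩
    rw [le_iff ht ht', le_iff ht' ht]
    exact le_total _ _
  trans := by
    rintro _ _ _ ⟨t, t', v, h, h', rfl, rfl, ht, ht', hh⟩ ⟨s, s', v', k, k', hs, rfl, hs', ht'', hk⟩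
    obtain rfl := Term.code_injective hs
    obtain ⟨rfl, rfl⟩ := ht'.unique hs'
    exact (le_iff ht ht'').2 (hh.trans hk)
  layered := by
    rintro _ _ v a b hab ⟨t, h, rfl, ht, hl⟩ ⟨t', h', rfl, ht', hl'⟩
    rw [le_iff ht' ht]
    have : (a : ℝ) + 1 ≤ b := by exact_mod_cast hab
    have h1 := hl.2.2
    have h2 := hl'.2.1
    linarith
  step_at := by
    intro f i j x a ha hx
    obtain ⟨t, rfl, k, hk, ht⟩ := exists_plaque ha hx
    obtain ⟨b, hb, hl⟩ := exists_admits ha.1 hk j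
    exact ⟨b, hb, .step f i j t, _, rfl, val_step ha.1 j hk ht, hl⟩
  step_mono := by
    intro f i j x y a b ha hb hij hx hy hxy
    obtain ⟨t, rfl, k, hk, ht⟩ := exists_plaque ha hx
    obtain ⟨t', rfl, k', hk', ht'⟩ := exists_plaque hb hy
    rw [le_iff ht ht'] at hxy
    exact (le_iff (val_step ha.1 j hk ht) (val_step ha.1 j hk' ht')).2
      (eps_mul_mono ha.1 hk hk' hij hxy)
  step_anti := by
    intro f i j x y a b ha hb hij hx hy hxy
    obtain ⟨t, rfl, k, hk, ht⟩ := exists_plaque ha hx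
    obtain ⟨t', rfl, k', hk', ht'⟩ := exists_plaque hb hy
    rw [le_iff ht ht'] at hxy
    exact (le_iff (val_step ha.1 j hk' ht') (val_step ha.1 j hk ht)).2
      (eps_mul_anti ha.1 hk hk' hij hxy)
  step_self_le := by
    intro f i x a ha hx
    obtain ⟨t, rfl, k, hk, ht⟩ := exists_plaque ha hx
    exact (le_iff (val_step ha.1 i hk ht) ht).2 le_rfl
  le_step_self := by
    intro f i x a ha hx
    obtain ⟨t, rfl, k, hk, ht⟩ := exists_plaque ha hx
    exact (le_iff ht (val_step ha.1 i hk ht)).2 le_rfl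
  step_step_le := by
    intro f i j l x a ha hx
    obtain ⟨t, rfl, k, hk, ht⟩ := exists_plaque ha hx
    exact (le_iff (val_step ha.1 l hk (val_step ha.1 j hk ht)) (val_step ha.1 l hk ht)).2 le_rfl
  le_step_step := by
    intro f i j l x a ha hx
    obtain ⟨t, rfl, k, hk, ht⟩ := exists_plaque ha hx
    exact (le_iff (val_step ha.1 l hk ht) (val_step ha.1 l hk (val_step ha.1 j hk ht))).2 le_rfl
  small_le_whole := by
    intro e he s hs x a ha hx
    obtain ⟨t, rfl, k, hk, ht⟩ := exists_plaque ha hx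
    have hss := Edge.small_mem_sides hs
    obtain ⟨k', hk', hm⟩ := P.exists_match_whole hB he hss hk
    have h1 := hm Side.src (Or.inl rfl)
    have h2 := hm Side.tgt (Or.inr rfl)
    have t1 := val_step ha.1 s.tgt hk ht
    rw [h1, hB.vertex_end he (Or.inl rfl) hss] at ht
    have t2 := val_step (hB.face_lt he e.whole_mem_sides) e.whole.tgt hk' ht
    rw [h2, hB.vertex_end he (Or.inr rfl) hss] at t1
    exact (le_iff t1 t2).2 le_rfl
  whole_le_small := by
    intro e he s hs x a ha hx
    obtain ⟨t, rfl, k, hk, ht⟩ := exists_plaque ha hx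
    have hss := Edge.small_mem_sides hs
    obtain ⟨k', hk', hm⟩ := P.exists_match_whole hB he hss hk
    have h1 := hm Side.src (Or.inl rfl)
    have h2 := hm Side.tgt (Or.inr rfl)
    have t1 := val_step ha.1 s.tgt hk ht
    rw [h1, hB.vertex_end he (Or.inl rfl) hss] at ht
    have t2 := val_step (hB.face_lt he e.whole_mem_sides) e.whole.tgt hk' ht
    rw [h2, hB.vertex_end he (Or.inr rfl) hss] at t1
    exact (le_iff t2 t1).2 le_rfl
  top_at := by
    rintro _ v a ⟨t, h, rfl, ht, hl⟩
    -- The layer has a highest point because the plaques over a triangle form a compact set.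
    obtain ⟨m, hm⟩ := (ht.isCompact_layer hl).exists_isGreatest ⟨h, hl⟩
    exact ⟨.top t, m, rfl, ⟨h, a, ht, hl, hm⟩, hm.1⟩
  le_top := by
    rintro _ _ v a ⟨t, h, rfl, ht, hl⟩ ⟨t', h', rfl, ht', hl'⟩
    obtain ⟨m, hm⟩ := (ht.isCompact_layer hl).exists_isGreatest ⟨h, hl⟩
    have : P.Val g (.top t) v m := ⟨h, a, ht, hl, hm⟩
    exact (le_iff ht' this).2 (hm.2 hl')

theorem at_base {f : ℕ} (hf : f < B.faces.length) (hg : g f ∈ P.plaques f) :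
    ∃ a, B.Admits f 0 a ∧ P.At g (baseTerm f) (B.corner f 0).vertex a := by
  obtain ⟨a, ha, hl⟩ := exists_admits hf hg 0
  exact ⟨a, ha, .base f, _, rfl, ⟨hf, hg, rfl, rfl⟩, hl⟩

end PlaqueSystem

theorem Code.IsBranchedSurface.carriesLamination_iff_isModel {B : Code}
    (hB : B.IsBranchedSurface) : B.CarriesLamination ↔ ∃ At Le, B.IsModel At Le ∧
      ∃ f a, B.Admits f 0 a ∧ At (baseTerm f) (B.corner f 0).vertex a := by
  classical
  rw [hB.carriesLamination_iff]
  constructor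
  · rintro ⟨P, f, hf, g, hg⟩
    -- The same triple is assigned to all triangles; where it is not a plaque, the base name simply
    -- denotes nothing.
    obtain ⟨a, ha⟩ := PlaqueSystem.at_base (P := P) (g := fun _ => g) hf hg
    exact ⟨_, _, P.isModel (g := fun _ => g) hB, f, a, ha⟩
  · rintro ⟨At, Le, M, f, a, ha, hx⟩
    exact ⟨M.plaqueSystem hB, f, ha.1, M.plaques_nonempty hB ha hx⟩

theorem Code.IsBranchedSurface.fullyCarriesLamination_iff_isModel {B : Code}
    (hB : B.IsBranchedSurface) : B.FullyCarriesLamination ↔ ∃ At Le, B.IsModel At Le ∧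
      ∀ f < B.faces.length, ∃ a, B.Admits f 0 a ∧ At (baseTerm f) (B.corner f 0).vertex a := by
  classical
  rw [hB.fullyCarriesLamination_iff]
  constructor
  · rintro ⟨P, hP⟩
    choose! g hg using hP
    exact ⟨_, _, P.isModel (g := g) hB, fun f hf =>
      PlaqueSystem.at_base (P := P) hf (hg f hf)⟩
  · rintro ⟨At, Le, M, h⟩
    refine ⟨M.plaqueSystem hB, fun f hf => ?_⟩
    obtain ⟨a, ha, hx⟩ := h f hf
    exact M.plaques_nonempty hB ha hx

/-! ### Clausal theories -/

section Clausal

variable {α β : Type} [Primcodable α] [Primcodable β]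

/-- A propositional theory with a parameter, given by a primitive recursive sequence of clauses. -/
def IsClausal (p : α → (ℕ → Bool) → Prop) : Prop :=
  ∃ cl : α → ℕ → List (ℕ × Bool), Primrec₂ cl ∧ ∀ a σ, p a σ ↔ ∀ k, ∃ l ∈ cl a k, σ l.1 = l.2

attribute [fun_prop] Primrec
attribute [fun_prop] Primrec.id Primrec.const Primrec.comp Primrec.pair Primrec.fst Primrec.snd

/-- The existential form hides the decision procedure contained in `PrimrecPred`, which would
otherwise have to match an instance. -/
theorem exists_primrec_ite {c : α → Prop} (hc : PrimrecPred c) {f g : α → β} (hf : Primrec f)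
    (hg : Primrec g) : ∃ h : α → β, Primrec h ∧ ∀ a, (c a → h a = f a) ∧ (¬ c a → h a = g a) := by
  obtain ⟨hd, hc⟩ := hc
  refine ⟨fun a => if c a then f a else g a, Primrec.ite ⟨hd, hc⟩ hf hg, fun a => ⟨fun h => ?_,
    fun h => ?_⟩⟩
  · exact if_pos h
  · exact if_neg h

/-- A clause which always holds. -/
def trivialClause : List (ℕ × Bool) := [(0, true), (0, false)]

theorem exists_mem_trivialClause (σ : ℕ → Bool) : ∃ l ∈ trivialClause, σ l.1 = l.2 := by
  unfold trivialClause
  cases h : σ 0 <;> simp [h]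

namespace IsClausal

theorem of_iff {p q : α → (ℕ → Bool) → Prop} (hp : IsClausal p) (h : ∀ a σ, q a σ ↔ p a σ) :
    IsClausal q := by
  obtain ⟨cl, hcl, hp⟩ := hp
  exact ⟨cl, hcl, fun a σ => (h a σ).trans (hp a σ)⟩

theorem clause {L : α → List (ℕ × Bool)} (hL : Primrec L) :
    IsClausal fun a σ => ∃ l ∈ L a, σ l.1 = l.2 :=
  ⟨fun a _ => L a, hL.comp₂ Primrec₂.left, fun _ _ => ⟨fun h _ => h, fun h => h 0⟩⟩

theorem lit {f : α → ℕ} (hf : Primrec f) (b : Bool) : IsClausal fun a σ => σ (f a) = b :=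
  (clause (L := fun a => [(f a, b)]) (Primrec.list_cons.comp (by fun_prop) (by fun_prop))).of_iff
    fun a σ => by simp

theorem or_lit {f g : α → ℕ} (hf : Primrec f) (hg : Primrec g) :
    IsClausal fun a σ => σ (f a) = true ∨ σ (g a) = true :=
  (clause (L := fun a => [(f a, true), (g a, true)]) (Primrec.list_cons.comp (by fun_prop)
    (Primrec.list_cons.comp (by fun_prop) (by fun_prop)))).of_iff fun a σ => by simp

theorem exists_mem {L : α → List β} (hL : Primrec L) {c : α × β → Prop} (hc : PrimrecPred c)
    {f : α × β → ℕ} (hf : Primrec f) :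
    IsClausal fun a σ => ∃ b ∈ L a, c (a, b) ∧ σ (f (a, b)) = true := by
  obtain ⟨h, hh, hc⟩ := exists_primrec_ite hc (f := fun x => [(f x, true)]) (g := fun _ => [])
    (Primrec.list_cons.comp (by fun_prop) (by fun_prop)) (by fun_prop)
  refine (clause (L := fun a => (L a).flatMap fun b => h (a, b))
    (Primrec.list_flatMap hL hh.to₂)).of_iff fun a σ => ?_
  simp only [List.mem_flatMap]
  constructor
  · rintro ⟨b, hb, hcb, hσ⟩
    exact ⟨_, ⟨b, hb, by rw [(hc _).1 hcb]; exact List.mem_singleton_self _⟩, hσ⟩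
  · rintro ⟨l, ⟨b, hb, hl⟩, hσ⟩
    by_cases hcb : c (a, b)
    · rw [(hc _).1 hcb, List.mem_singleton] at hl
      subst hl
      exact ⟨b, hb, hcb, hσ⟩
    · rw [(hc _).2 hcb] at hl
      exact absurd hl List.not_mem_nil

theorem and {p q : α → (ℕ → Bool) → Prop} (hp : IsClausal p) (hq : IsClausal q) :
    IsClausal fun a σ => p a σ ∧ q a σ := by
  obtain ⟨cl, hcl, hp⟩ := hp
  obtain ⟨cl', hcl', hq⟩ := hq
  -- The two sequences of clauses are interleaved, the first at odd and the second at even indices.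
  refine ⟨fun a k => cond k.bodd (cl a k.div2) (cl' a k.div2), ?_, fun a σ => ?_⟩
  · exact Primrec.cond (Primrec.nat_bodd.comp Primrec.snd)
      (hcl.comp Primrec.fst (Primrec.nat_div2.comp Primrec.snd))
      (hcl'.comp Primrec.fst (Primrec.nat_div2.comp Primrec.snd))
  · simp only [hp, hq]
    constructor
    · rintro ⟨h, h'⟩ k
      cases hk : k.bodd
      · exact h' _
      · exact h _
    · intro h
      refine ⟨fun k => ?_, fun k => ?_⟩
      · simpa using h (2 * k + 1)
      · simpa using h (2 * k)

/-- A universal quantifier over a coded type is absorbed in the index of the clause, which codes a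
pair (instance, index). Indices decoding to no instance receive a trivial clause. -/
theorem forall_ {p : α → β → (ℕ → Bool) → Prop} (hp : IsClausal fun ab : α × β => p ab.1 ab.2) :
    IsClausal fun a σ => ∀ b, p a b σ := by
  obtain ⟨cl, hcl, hp⟩ := hp
  refine ⟨fun a k => Option.casesOn (motive := fun _ => List (ℕ × Bool))
    (Encodable.decode (α := β) k.unpair.1) trivialClause fun b => cl (a, b) k.unpair.2, ?_,
    fun a σ => ?_⟩
  · refine Primrec.option_casesOn (o := fun x : α × ℕ => Encodable.decode (α := β) x.2.unpair.1)
      (f := fun _ => trivialClause) (g := fun x b => cl (x.1, b) x.2.unpair.2)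
      (Primrec.decode.comp (Primrec.fst.comp (Primrec.unpair.comp Primrec.snd)))
      (Primrec.const _) ?_
    exact hcl.comp (Primrec.pair (Primrec.fst.comp Primrec.fst) Primrec.snd)
      (Primrec.snd.comp (Primrec.unpair.comp (Primrec.snd.comp Primrec.fst)))
  · constructor
    · intro h k
      simp only
      cases hk : Encodable.decode (α := β) k.unpair.1 with
      | none => exact exists_mem_trivialClause σ
      | some b => exact (hp (a, b) σ).1 (h b) _
    · intro h b
      refine (hp (a, b) σ).2 fun k => ?_
      have := h (Nat.pair (Encodable.encode b) k)
      simpa using this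

theorem imp {c : α → Prop} (hc : PrimrecPred c) {p : α → (ℕ → Bool) → Prop} (hp : IsClausal p) :
    IsClausal fun a σ => c a → p a σ := by
  obtain ⟨cl, hcl, hp⟩ := hp
  obtain ⟨h, hh, hc⟩ := exists_primrec_ite (hc.comp (f := fun x : α × ℕ => x.1) Primrec.fst)
    (f := fun x => cl x.1 x.2) (g := fun _ => trivialClause) hcl (Primrec.const _)
  refine ⟨fun a k => h (a, k), hh.to₂, fun a σ => ?_⟩
  by_cases hca : c a
  · have : ∀ k, h (a, k) = cl a k := fun k => (hc (a, k)).1 hca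
    simp only [hca, true_imp_iff, this]
    exact hp a σ
  · have : ∀ k, h (a, k) = trivialClause := fun k => (hc (a, k)).2 hca
    simp only [hca, false_imp_iff, this, true_iff]
    exact fun _ => exists_mem_trivialClause σ

theorem lit_imp {f : α → ℕ} (hf : Primrec f) {p : α → (ℕ → Bool) → Prop} (hp : IsClausal p) :
    IsClausal fun a σ => σ (f a) = true → p a σ := by
  obtain ⟨cl, hcl, hp⟩ := hp
  refine ⟨fun a k => (f a, false) :: cl a k, ?_, fun a σ => ?_⟩
  · exact Primrec.list_cons.comp ((hf.comp Primrec.fst).pair (Primrec.const _)) hcl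
  · cases h : σ (f a) <;> simp [h, hp]

end IsClausal

/-- A clausal theory is unsatisfiable if and only if some finite initial segment of any assignment
refutes one of the first clauses. -/
theorem refutable_iff (cl : ℕ → List (ℕ × Bool)) :
    (∃ n, ∀ m < 2 ^ n, ∃ k < n, ∀ l ∈ cl k, l.1 < n ∧ m.testBit l.1 ≠ l.2) ↔
      ¬ ∃ σ : ℕ → Bool, ∀ k, ∃ l ∈ cl k, σ l.1 = l.2 := by
  constructor
  · rintro ⟨n, hn⟩ ⟨σ, hσ⟩
    -- The numbers below `2 ^ n` run through the assignments to the first `n` variables by their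
    -- binary digits.
    obtain ⟨k, -, hk⟩ := hn (Nat.ofBits fun i : Fin n => σ i) (Nat.ofBits_lt_two_pow _)
    obtain ⟨l, hl, hl'⟩ := hσ k
    obtain ⟨h1, h2⟩ := hk l hl
    rw [Nat.testBit_ofBits_lt _ _ h1] at h2
    exact h2 hl'
  · intro h
    by_contra hcon
    push Not at hcon
    refine h ?_
    -- The Cantor space is compact and each clause defines a closed set, as it involves finitely
    -- many variables.
    have hne : (⋂ k, {σ : ℕ → Bool | ∃ l ∈ cl k, σ l.1 = l.2}).Nonempty := by
      refine CompactSpace.iInter_nonempty (fun k => ?_) fun s => ?_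
      · have : {σ : ℕ → Bool | ∃ l ∈ cl k, σ l.1 = l.2} =
            ⋃ l ∈ {l | l ∈ cl k}, {σ : ℕ → Bool | σ l.1 = l.2} := by
          ext σ; simp
        rw [this]
        exact (List.finite_toSet (cl k)).isClosed_biUnion fun l _ =>
          isClosed_eq (continuous_apply l.1) continuous_const
      -- This bound exceeds the indices of all selected clauses and of all variables in them, so an
      -- unrefuted assignment of length `n` satisfies them.
      · set n := s.sup (fun k => k + 1 + ((cl k).map fun l => l.1 + 1).sum) with hn
        obtain ⟨m, -, hm⟩ := hcon n
        refine ⟨m.testBit, mem_iInter₂.2 fun k hk => ?_⟩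
        have hkn : k + 1 + ((cl k).map fun l => l.1 + 1).sum ≤ n :=
          Finset.le_sup (f := fun k => k + 1 + ((cl k).map fun l => l.1 + 1).sum) hk
        obtain ⟨l, hl, hl'⟩ := hm k (by omega)
        have : l.1 + 1 ≤ ((cl k).map fun l => l.1 + 1).sum :=
          List.single_le_sum (by simp) _ (List.mem_map.2 ⟨l, hl, rfl⟩)
        exact ⟨l, hl, hl' (by omega)⟩
    obtain ⟨σ, hσ⟩ := hne
    exact ⟨σ, fun k => mem_iInter.1 hσ k⟩

theorem primrec_pow : Primrec₂ fun m n : ℕ => m ^ n :=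
  Primrec₂.unpaired'.1 Nat.Primrec.pow

/-- Unsatisfiability of clausal theories is recursively enumerable. -/
theorem IsClausal.rePred {p : α → (ℕ → Bool) → Prop} (hp : IsClausal p) :
    REPred fun a => ¬ ∃ σ, p a σ := by
  obtain ⟨cl, hcl, hp⟩ := hp
  have htest : PrimrecRel fun (l : ℕ × Bool) (x : (α × ℕ) × ℕ) =>
      l.1 < x.1.2 ∧ ¬ (decide (x.2 / 2 ^ l.1 % 2 = 1) = l.2) := by
    refine PrimrecPred.and ?_ (PrimrecPred.not ?_)
    · exact Primrec.nat_lt.comp (by fun_prop) (by fun_prop)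
    · refine Primrec.eq.comp ?_ (by fun_prop)
      refine PrimrecPred.decide (Primrec.eq.comp ?_ (Primrec.const 1))
      exact Primrec.nat_mod.comp (Primrec.nat_div.comp (by fun_prop)
        (primrec_pow.comp (Primrec.const 2) (by fun_prop))) (Primrec.const 2)
  have hR : PrimrecPred fun x : α × ℕ => ∀ m < 2 ^ x.2, ∃ k < x.2, ∀ l ∈ cl x.1 k,
      l.1 < x.2 ∧ ¬ (decide (m / 2 ^ l.1 % 2 = 1) = l.2) := by
    have h1 : PrimrecRel fun (k : ℕ) (x : (α × ℕ) × ℕ) => ∀ l ∈ cl x.1.1 k,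
        l.1 < x.1.2 ∧ ¬ (decide (x.2 / 2 ^ l.1 % 2 = 1) = l.2) :=
      htest.forall_mem_list.comp (hcl.comp (by fun_prop) (by fun_prop)) (by fun_prop)
    have h2 : PrimrecRel fun (m : ℕ) (x : α × ℕ) => ∃ k ∈ List.range x.2, ∀ l ∈ cl x.1 k,
        l.1 < x.2 ∧ ¬ (decide (m / 2 ^ l.1 % 2 = 1) = l.2) :=
      h1.exists_mem_list.comp (f := fun y : ℕ × (α × ℕ) => List.range y.2.2)
        (g := fun y => (y.2, y.1)) (Primrec.list_range.comp (by fun_prop)) (by fun_prop)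
    have h3 : PrimrecPred fun x : α × ℕ => ∀ m ∈ List.range (2 ^ x.2),
        ∃ k ∈ List.range x.2, ∀ l ∈ cl x.1 k,
          l.1 < x.2 ∧ ¬ (decide (m / 2 ^ l.1 % 2 = 1) = l.2) :=
      h2.forall_mem_list.comp (f := fun x : α × ℕ => List.range (2 ^ x.2)) (g := fun x => x)
        (Primrec.list_range.comp (primrec_pow.comp (Primrec.const 2) (by fun_prop)))
        (by fun_prop)
    exact h3.of_eq fun x => by simp only [List.mem_range]
  obtain ⟨hd, hR⟩ := hR
  let d : α → ℕ → Bool := fun a n => @decide _ (hd (a, n))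
  have hcomp : Computable₂ d := hR.to_comp
  -- The procedure is an unbounded search for a length at which all assignments are refuted.
  have hpart : Partrec fun a => Nat.rfind (d a : ℕ →. Bool) := Partrec.rfind hcomp.partrec₂
  refine hpart.dom_re.of_eq fun a => ?_
  rw [Nat.rfind_dom]
  simp only [hp, ← refutable_iff, Nat.testBit_eq_decide_div_mod_eq]
  refine exists_congr fun n => ?_
  simp [d]

end Clausal

/-! ### The theory of models -/

section Computability

variable {α β : Type} [Primcodable α] [Primcodable β]

attribute [fun_prop] Primrec.fin_val Primrec.list_range Primrec.list_length

@[fun_prop]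
theorem primrec_add {f g : α → ℕ} (hf : Primrec f) (hg : Primrec g) :
    Primrec fun a => f a + g a := Primrec.nat_add.comp hf hg

@[fun_prop]
theorem primrec_mul {f g : α → ℕ} (hf : Primrec f) (hg : Primrec g) :
    Primrec fun a => f a * g a := Primrec.nat_mul.comp hf hg

@[fun_prop]
theorem primrec_natPair {f g : α → ℕ} (hf : Primrec f) (hg : Primrec g) :
    Primrec fun a => Nat.pair (f a) (g a) := Primrec₂.natPair.comp hf hg

@[fun_prop]
theorem primrec_faces : Primrec Code.faces :=
  (Primrec.fst.comp Primrec.snd).comp (Primrec.of_equiv (e := Code.equivProd))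

@[fun_prop]
theorem primrec_edges : Primrec Code.edges :=
  (Primrec.snd.comp Primrec.snd).comp (Primrec.of_equiv (e := Code.equivProd))

@[fun_prop]
theorem primrec_vertex : Primrec Corner.vertex :=
  Primrec.fst.comp (Primrec.of_equiv (e := Corner.equivProd))

@[fun_prop]
theorem primrec_bot : Primrec Corner.bot :=
  (Primrec.fst.comp Primrec.snd).comp (Primrec.of_equiv (e := Corner.equivProd))

@[fun_prop]
theorem primrec_top : Primrec Corner.top :=
  (Primrec.fst.comp (Primrec.snd.comp Primrec.snd)).comp
    (Primrec.of_equiv (e := Corner.equivProd))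

@[fun_prop]
theorem primrec_flip : Primrec Corner.flip :=
  (Primrec.snd.comp (Primrec.snd.comp Primrec.snd)).comp
    (Primrec.of_equiv (e := Corner.equivProd))

@[fun_prop]
theorem primrec_face : Primrec Side.face :=
  Primrec.fst.comp (Primrec.of_equiv (e := Side.equivProd))

@[fun_prop]
theorem primrec_src : Primrec Side.src :=
  (Primrec.dom_finite fun x : Fin 3 × Bool => if x.2 then x.1 + 2 else x.1 + 1).comp
    (Primrec.snd.comp (Primrec.of_equiv (e := Side.equivProd)))

@[fun_prop]
theorem primrec_tgt : Primrec Side.tgt :=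
  (Primrec.dom_finite fun x : Fin 3 × Bool => if x.2 then x.1 + 1 else x.1 + 2).comp
    (Primrec.snd.comp (Primrec.of_equiv (e := Side.equivProd)))

@[fun_prop]
theorem primrec_whole : Primrec Edge.whole :=
  Primrec.fst.comp (Primrec.of_equiv (e := Edge.equivProd))

@[fun_prop]
theorem primrec_small : Primrec Edge.small :=
  Primrec.list_cons.comp
    ((Primrec.fst.comp Primrec.snd).comp (Primrec.of_equiv (e := Edge.equivProd)))
    (Primrec.optionToList.comp
      ((Primrec.snd.comp Primrec.snd).comp (Primrec.of_equiv (e := Edge.equivProd))))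

@[fun_prop]
theorem primrec_corner {B : α → Code} {f : α → ℕ} {i : α → Fin 3} (hB : Primrec B)
    (hf : Primrec f) (hi : Primrec i) : Primrec fun a => (B a).corner (f a) (i a) :=
  Primrec.fin_app.comp ((Primrec.list_getD _).comp (primrec_faces.comp hB) hf) hi

theorem primrecPred_admits {B : α → Code} {f : α → ℕ} {i : α → Fin 3} {a : α → ℕ}
    (hB : Primrec B) (hf : Primrec f) (hi : Primrec i) (ha : Primrec a) :
    PrimrecPred fun x => (B x).Admits (f x) (i x) (a x) :=
  (Primrec.nat_lt.comp (by fun_prop) (by fun_prop)).and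
    ((Primrec.nat_le.comp (by fun_prop) (by fun_prop)).and
      (Primrec.nat_le.comp (by fun_prop) (by fun_prop)))

theorem primrecPred_mem {f : α → β} {L : α → List β} (hf : Primrec f) (hL : Primrec L) :
    PrimrecPred fun a => f a ∈ L a :=
  (Primrec.eq.exists_mem_list.comp hL hf).of_eq fun a => by simp

@[fun_prop]
theorem primrec_stepTerm {f : α → ℕ} {i j : α → Fin 3} {x : α → ℕ} (hf : Primrec f)
    (hi : Primrec i) (hj : Primrec j) (hx : Primrec x) :
    Primrec fun a => stepTerm (f a) (i a) (j a) (x a) := by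
  unfold stepTerm
  fun_prop

@[fun_prop]
theorem primrec_topTerm : Primrec topTerm := by
  unfold topTerm
  fun_prop

@[fun_prop]
theorem primrec_baseTerm : Primrec baseTerm := by
  unfold baseTerm
  fun_prop

/-- The propositional variable for `At x v a`. -/
def atVar (x v a : ℕ) : ℕ := 2 * Nat.pair x (Nat.pair v a)

/-- The propositional variable for `Le x y`. -/
def leVar (x y : ℕ) : ℕ := 2 * Nat.pair x y + 1

@[fun_prop]
theorem primrec_atVar {x v a : α → ℕ} (hx : Primrec x) (hv : Primrec v) (ha : Primrec a) :
    Primrec fun z => atVar (x z) (v z) (a z) := by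
  unfold atVar
  fun_prop

@[fun_prop]
theorem primrec_leVar {x y : α → ℕ} (hx : Primrec x) (hy : Primrec y) :
    Primrec fun z => leVar (x z) (y z) := by
  unfold leVar
  fun_prop

/-- An assignment describes a model. -/
def Code.Describes (B : Code) (σ : ℕ → Bool) : Prop :=
  B.IsModel (fun x v a => σ (atVar x v a) = true) (fun x y => σ (leVar x y) = true)

/-- Even variables code `At` and odd ones `Le`, so every pair of relations comes from an assignment.
-/
theorem exists_describes {p : (ℕ → ℕ → ℕ → Prop) → Prop} {B : Code} :
    (∃ At Le, B.IsModel At Le ∧ p At) ↔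
      ∃ σ, B.Describes σ ∧ p fun x v a => σ (atVar x v a) = true := by
  classical
  constructor
  · rintro ⟨At, Le, M, hp⟩
    let σ : ℕ → Bool := fun n => if n % 2 = 0 then
      decide (At (n / 2).unpair.1 (n / 2).unpair.2.unpair.1 (n / 2).unpair.2.unpair.2) else
      decide (Le (n / 2).unpair.1 (n / 2).unpair.2)
    have h1 : (fun x v a => σ (atVar x v a) = true) = At := by
      funext x v a
      simp [σ, atVar]
    have h2 : (fun x y => σ (leVar x y) = true) = Le := by
      funext x y
      have e1 : (2 * Nat.pair x y + 1) / 2 = Nat.pair x y := by omega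
      have e2 : (2 * Nat.pair x y + 1) % 2 = 1 := by omega
      simp [σ, leVar, e1, e2]
    refine ⟨σ, ?_, ?_⟩
    · unfold Code.Describes
      rwa [h1, h2]
    · rwa [h1]
  · rintro ⟨σ, M, hp⟩
    exact ⟨_, _, M, hp⟩

/-- The existential quantifier is bounded by the highest layer of the corner, so it is a finite
disjunction. -/
theorem isClausal_exists_at {B : α → Code} {f : α → ℕ} {i : α → Fin 3} {x : α → ℕ}
    (hB : Primrec B) (hf : Primrec f) (hi : Primrec i) (hx : Primrec x) :
    IsClausal fun z σ => ∃ b, (B z).Admits (f z) (i z) b ∧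
      σ (atVar (x z) ((B z).corner (f z) (i z)).vertex b) = true := by
  refine (IsClausal.exists_mem (L := fun z => List.range (((B z).corner (f z) (i z)).top + 1))
    (c := fun zb : α × ℕ => (B zb.1).Admits (f zb.1) (i zb.1) zb.2)
    (f := fun zb : α × ℕ => atVar (x zb.1) ((B zb.1).corner (f zb.1) (i zb.1)).vertex zb.2)
    (by fun_prop) (primrecPred_admits (by fun_prop) (by fun_prop) (by fun_prop) (by fun_prop))
    (by fun_prop)).of_iff fun z σ => exists_congr fun b => ⟨fun h => ⟨?_, h⟩, fun h => h.2⟩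
  exact List.mem_range.2 (Nat.lt_succ_of_le h.1.2.2)

/-- The axioms are rearranged so that the two of special shape come first: `step_at` contains a
disjunction over layers, and `layered` has a negative conclusion. The others are implications from
literals to one positive literal, or to two in the case of `total`. -/
theorem isClausal_describes : IsClausal fun (B : Code) σ => B.Describes σ := by
  refine IsClausal.of_iff (.and ?_ (.and ?_ (.and ?_ (.and ?_ (.and ?_ (.and ?_ (.and ?_ (.and ?_
    (.and ?_ (.and ?_ (.and ?_ (.and ?_ (.and ?_ ?_))))))))))))) fun B σ =>
    ⟨fun h => ⟨h.step_at, h.layered, h.total, h.trans, h.step_mono, h.step_anti, h.step_self_le,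
      h.le_step_self, h.step_step_le, h.le_step_step, h.small_le_whole, h.whole_le_small,
      h.top_at, h.le_top⟩,
    fun ⟨h1, h2, h3, h4, h5, h6, h7, h8, h9, h10, h11, h12, h13, h14⟩ =>
      ⟨h3, h4, h2, h1, h5, h6, h7, h8, h9, h10, h11, h12, h13, h14⟩⟩
  · iterate 5 refine .forall_ ?_
    refine .imp (primrecPred_admits (by fun_prop) (by fun_prop) (by fun_prop) (by fun_prop)) ?_
    refine .lit_imp (by fun_prop) ?_
    exact isClausal_exists_at (by fun_prop) (by fun_prop) (by fun_prop) (by fun_prop)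
  · iterate 5 refine .forall_ ?_
    refine .imp (Primrec.nat_lt.comp (by fun_prop) (by fun_prop)) ?_
    iterate 2 refine .lit_imp (by fun_prop) ?_
    exact (IsClausal.lit (f := fun z : ((((Code × ℕ) × ℕ) × ℕ) × ℕ) × ℕ =>
      leVar z.1.1.1.2 z.1.1.1.1.2) (by fun_prop) false).of_iff fun z σ => by simp
  all_goals
    repeat first
      | exact IsClausal.lit (by fun_prop) true
      | exact IsClausal.or_lit (by fun_prop) (by fun_prop)
      | refine .forall_ ?_
      | refine .lit_imp (by fun_prop) ?_
      | refine .imp (primrecPred_admits (by fun_prop) (by fun_prop) (by fun_prop)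
          (by fun_prop)) ?_
      | refine .imp (Primrec.eq.comp (by fun_prop) (by fun_prop)) ?_
      | refine .imp (Primrec.eq.comp (by fun_prop) (by fun_prop)).not ?_
      | refine .imp (primrecPred_mem (by fun_prop) (by fun_prop)) ?_

end Computability

/-! ### The two semi-decision procedures. -/

theorem rePred_not_carriesLamination : ∃ p : Code → Prop, REPred p ∧
    ∀ B : Code, B.IsBranchedSurface → (p B ↔ ¬ B.CarriesLamination) := by
  have hstart : IsClausal fun (B : Code) σ => ∃ f a, B.Admits f 0 a ∧
      σ (atVar (baseTerm f) (B.corner f 0).vertex a) = true := by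
    refine (IsClausal.exists_mem (L := fun B : Code => (List.range B.faces.length).flatMap fun f =>
        (List.range ((B.corner f 0).top + 1)).map fun a => (f, a))
      (c := fun z : Code × ℕ × ℕ => z.1.Admits z.2.1 0 z.2.2)
      (f := fun z : Code × ℕ × ℕ => atVar (baseTerm z.2.1) (z.1.corner z.2.1 0).vertex z.2.2)
      ?_ (primrecPred_admits (by fun_prop) (by fun_prop) (by fun_prop) (by fun_prop))
      (by fun_prop)).of_iff fun B σ => ?_
    · refine Primrec.list_flatMap (by fun_prop) (Primrec.list_map
        (f := fun z : Code × ℕ => List.range ((z.1.corner z.2 0).top + 1))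
        (g := fun z a => (z.2, a)) (by fun_prop) ?_)
      exact Primrec.pair (by fun_prop) (by fun_prop)
    · constructor
      · rintro ⟨f, a, ha, hσ⟩
        refine ⟨(f, a), ?_, ha, hσ⟩
        simp only [List.mem_flatMap, List.mem_map, List.mem_range]
        exact ⟨f, ha.1, a, Nat.lt_succ_of_le ha.2.2, rfl⟩
      · rintro ⟨⟨f, a⟩, -, ha, hσ⟩
        exact ⟨f, a, ha, hσ⟩
  -- The search makes sense for every code; that the code describes a branched surface is used only
  -- to interpret its outcome, and need not be decided.
  refine ⟨_, (isClausal_describes.and hstart).rePred, fun B hB => not_congr ?_⟩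
  rw [hB.carriesLamination_iff_isModel]
  exact (exists_describes (p := fun At => ∃ f a, B.Admits f 0 a ∧
    At (baseTerm f) (B.corner f 0).vertex a)).symm

theorem rePred_not_fullyCarriesLamination : ∃ p : Code → Prop, REPred p ∧
    ∀ B : Code, B.IsBranchedSurface → (p B ↔ ¬ B.FullyCarriesLamination) := by
  have hstart : IsClausal fun (B : Code) σ => ∀ f, f < B.faces.length → ∃ a, B.Admits f 0 a ∧
      σ (atVar (baseTerm f) (B.corner f 0).vertex a) = true :=
    .forall_ (.imp (Primrec.nat_lt.comp (by fun_prop) (by fun_prop))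
      (isClausal_exists_at (by fun_prop) (by fun_prop) (by fun_prop) (by fun_prop)))
  refine ⟨_, (isClausal_describes.and hstart).rePred, fun B hB => not_congr ?_⟩
  rw [hB.fullyCarriesLamination_iff_isModel]
  exact (exists_describes (p := fun At => ∀ f < B.faces.length, ∃ a, B.Admits f 0 a ∧
    At (baseTerm f) (B.corner f 0).vertex a)).symm

theorem exists_procedure {p : Code → Prop} (hp : REPred p) :
    ∃ procedure : Code →. Unit, Partrec procedure ∧ ∀ B, (procedure B).Dom ↔ p B :=
  ⟨_, hp, fun _ => ⟨fun h => h.1, fun h => ⟨h, trivial⟩⟩⟩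

end BranchedSurface

theorem mainTheorem6 :
    (∃ procedure : BranchedSurface.Code →. Unit, Partrec procedure ∧
      ∀ B : BranchedSurface.Code, B.IsBranchedSurface →
        ((procedure B).Dom ↔ ¬ B.FullyCarriesLamination)) ∧
    (∃ procedure : BranchedSurface.Code →. Unit, Partrec procedure ∧
      ∀ B : BranchedSurface.Code, B.IsBranchedSurface →
        ((procedure B).Dom ↔ ¬ B.CarriesLamination)) := by
  constructor
  · obtain ⟨p, hp, h⟩ := BranchedSurface.rePred_not_fullyCarriesLamination
    obtain ⟨procedure, hpr, hdom⟩ := BranchedSurface.exists_procedure hp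
    exact ⟨procedure, hpr, fun B hB => (hdom B).trans (h B hB)⟩
  · obtain ⟨p, hp, h⟩ := BranchedSurface.rePred_not_carriesLamination
    obtain ⟨procedure, hpr, hdom⟩ := BranchedSurface.exists_procedure hp
    exact ⟨procedure, hpr, fun B hB => (hdom B).trans (h B hB)⟩
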